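/- **Setting.** Let $n\ge 2$, $m\ge 0$, $1\le k\le n$. An edge set $X\subseteq \mathcal S\times\mathcal E$ with $\mathcal S=\{0,\dots,n-1\}$ (sets) and $\mathcal E=\{0,\dots,m-1\}$ (elements) is an instance of $k$-cover: $(S,e)\in X$ means that the set $S$ contains the element $e$. Its value is $\mathrm{OPT}_k(X)=\max_{\mathcal P\subseteq\mathcal S,|\mathcal P|=k}|\{e : \exists S\in\mathcal P,\ (S,e)\in X\}|$. For $\alpha\le 1$, a number $B\ge 0$ is an $\alpha$-approximation of $A$ if $\alpha A\le B\le A$. A (randomized) bucketing-based sketch of $X\subseteq\mathcal X$ with one sub-sketch is given by a filter function $h:\mathcal X\to\{0,1\}$, a bucketing function $g:\mathcal X\to\mathcal B$, a processing function $\zeta:\mathcal X\to\mathcal I$ (with space $|\zeta(x)|$) and a threshold $T\ge 0$. Its value $Z(X)\subseteq\{(x,\zeta(x)) : x\in X,\ h(x)=1\}$ is such that for each bucket $B$, with $X_B=\{x\in X: h(x)=1,g(x)=B\}$: if $\sum_{x\in X_B}|\zeta(x)|\le T$, then all $x\in X_B$ are stored; otherwise an arbitrary $Y\subsetneq X_B$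 is stored with $\sum_{x\in Y}|\zeta(x)|\le T$ and $|\zeta(x')|+\sum_{x\in Y}|\zeta(x)|>T$ for some $x'\in X_B\setminus Y$. Its space budget on $X$ is $\sum_B\min(T,\sum_{x\in X_B}|\zeta(x)|)$. For $\hslash:\mathcal E\to[0,1]$, $p\in[0,1]$, $T\ge0$, a subsampled sketch graph $H'_p$ of $X$ is a subset $H\subseteq X$ in which every element $e$ with $\hslash(e)\le p$ keeps all its edges if it has at most $T$ of them and arbitrary $\lfloor T\rfloor$ of them otherwise, and every other element has no edges. Running times are those of fixed programs (independent of all parameters) on a unit-cost random access machine whose words are natural numbers (addition, truncated subtraction, comparison, indexing) and which also has real cells (field operations, comparison, reduction modulo $1$). **Theorem.** There are absolute constants $c\in(0,1]$ and $A,C>0$ and two fixed programs such that the following holds for all $n\ge2$, $m$, $1\le k\le n$, $\varepsilon,\delta\in(0,\tfrac12)$, $o\ge 1$, $\alpha\in[0,1]$. Put $\varepsilon'=c\varepsilon$, $\delta'=c\delta$, and $$p=\min\Big(\frac{k\log(1/\delta')\log n}{\varepsilon'^2\,o},1\Big),\qquad T=\frac{n\log(1/\varepsilon')}{\varepsilon'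 k},\qquad t=\lceil A\,k\log(1/\delta)\log n\rceil .$$ There are a $t$-wise independent hash function $\hslash:\mathcal E\to[0,1]$ with uniformly distributed values, given by a seed of $t$ independent uniform numbers in $[0,1]$, and a recover function, such that the bucketing-based sketch $Z^o$ with one sub-sketch, $h(S,e)=1$ iff $\hslash(e)\le p$, $g(S,e)=e$ (one bucket per element), $\zeta(S,e)=(S,e)$ with $|\zeta(S,e)|=1$, and threshold $T$ satisfies: 0. For every seed and every $X$, the possible values of $Z^o(X)$ are exactly the sets $\{(x,x):x\in H\}$ with $H$ a subsampled sketch graph $H'_p$ of $X$. 1. $Z^o$ is an $o$-restricted $(\alpha-\varepsilon)$-approximate sketch: for every $X$ with $\mathrm{OPT}_k(X)\ge o$, with probability at least $1-\delta$ the recover function outputs an $(\alpha-\varepsilon)$-approximation of $\mathrm{OPT}_k(X)$, for all choices of the edges stored in full buckets and any order in which the sketch is stored. 2. For every $X$ with $\mathrm{OPT}_k(X)\le 2o$, with probability at least $1-\delta$ the space budget of $Z^o(X)$ is at most $C\,n\log(1/\delta)\log(1/\varepsilon)\log n/\varepsilon^3$. 3. For every seed and every edge $(S,e)$, the first program computes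 $h(S,e)$, $g(S,e)$ and $\zeta(S,e)$ from $S$, $e$, $t$, $p$ and the seed in at most $C\,k\log(1/\delta)\log n$ steps. 4. If $\alpha\le 1-1/e$, the second program computes the recover function from the stored sketch and $n,m,k,\varepsilon,p$ in at most $C\,(|Z^o(X)|+1)\log(|Z^o(X)|+2)$ steps. -/

import Mathlib

open MeasureTheory ProbabilityTheory
open scoped NNReal

noncomputable section

/-! ### Approximations and probabilities -/

/-- `B` is an `α`-approximation of `A` (all numbers nonnegative): `A ≤ B ≤ α A` if `α ≥ 1`,
and `α A ≤ B ≤ A` if `α ≤ 1`. -/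
def IsApproximation (α A B : ℝ) : Prop :=
  0 ≤ B ∧ ((1 ≤ α ∧ A ≤ B ∧ B ≤ α * A) ∨ (α ≤ 1 ∧ α * A ≤ B ∧ B ≤ A))

/-- `P` holds with probability at least `q`: it holds on an event of measure at least `q`. -/
def HoldsWithProb {Ω : Type*} [MeasurableSpace Ω] (μ : Measure Ω) (q : ℝ) (P : Ω → Prop) : Prop :=
  ∃ A : Set Ω, MeasurableSet A ∧ ENNReal.ofReal q ≤ μ A ∧ ∀ ω ∈ A, P ω

/-- `ħ` is a `t`-wise independent hash function from `E` to `[0,1]`: each value is uniformly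
distributed on `[0,1]`, and the values at any at most `t` distinct keys are independent. -/
def IsWiseIndependentHash {Ω E : Type*} [MeasurableSpace Ω] (μ : Measure Ω) (t : ℕ)
    (ħ : Ω → E → unitInterval) : Prop :=
  (∀ e, MeasurePreserving (fun ω => ħ ω e) μ volume) ∧
  ∀ s : Finset E, s.card ≤ t → iIndepFun (fun (e : s) ω => ħ ω e) μ

/-! ### Bucketing-based sketches -/

/-- The data of one sub-sketch: filter function, bucketing function, processing function,
the space `size` needed to store a piece of information, and the threshold of each bucket. -/
structure SubSketch (𝒳 ℬ ℐ : Type*) where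
  filter : 𝒳 → Bool
  bucket : 𝒳 → ℬ
  process : 𝒳 → ℐ
  size : ℐ → ℝ≥0
  threshold : ℝ≥0

namespace SubSketch

variable {𝒳 ℬ ℐ : Type*} [DecidableEq 𝒳] [DecidableEq ℬ] [DecidableEq ℐ]

/-- The items of `X` that pass the filter and are mapped to the bucket `B`. -/
def items (Z : SubSketch 𝒳 ℬ ℐ) (X : Finset 𝒳) (B : ℬ) : Finset 𝒳 :=
  X.filter fun x => Z.filter x = true ∧ Z.bucket x = B

/-- The total space of the information of the items in `Y`. -/
def space (Z : SubSketch 𝒳 ℬ ℐ) (Y : Finset 𝒳) : ℝ≥0 := ∑ x ∈ Y, Z.size (Z.process x)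

/-- `Y` is a possible value of the sub-sketch on `X`: only pairs `(x, ζ(x))` with `x ∈ X` not
filtered out are stored; a bucket whose content fits into the threshold is stored completely;
of any other bucket an arbitrary subset is stored that fits into the threshold and that would
not fit any more after adding a certain further item of the bucket. -/
def IsOutput (Z : SubSketch 𝒳 ℬ ℐ) (X : Finset 𝒳) (Y : Finset (𝒳 × ℐ)) : Prop :=
  (∀ y ∈ Y, y.1 ∈ X ∧ Z.filter y.1 = true ∧ y.2 = Z.process y.1) ∧
  ∀ B : ℬ,
    if Z.space (Z.items X B) ≤ Z.threshold then
      ∀ x ∈ Z.items X B, (x, Z.process x) ∈ Y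
    else
      Z.space ((Z.items X B).filter fun x => (x, Z.process x) ∈ Y) ≤ Z.threshold ∧
      ∃ x' ∈ Z.items X B, (x', Z.process x') ∉ Y ∧
        Z.threshold < Z.size (Z.process x') +
          Z.space ((Z.items X B).filter fun x => (x, Z.process x) ∈ Y)

/-- The space budget of the sub-sketch on `X`. (Buckets that receive no item of `X` contribute
`0`, so the sum is taken over the buckets of the items of `X`.) -/
def budget (Z : SubSketch 𝒳 ℬ ℐ) (X : Finset 𝒳) : ℝ≥0 :=
  ∑ B ∈ X.image Z.bucket, min Z.threshold (Z.space (Z.items X B))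

end SubSketch

/-- A bucketing-based sketch function: a tuple of sub-sketches. A randomized one is a function
from a probability space to this type. -/
abbrev BucketingSketch (r : ℕ) (𝒳 ℬ ℐ : Type*) := Fin r → SubSketch 𝒳 ℬ ℐ

namespace BucketingSketch

variable {r : ℕ} {𝒳 ℬ ℐ : Type*} [DecidableEq 𝒳] [DecidableEq ℬ] [DecidableEq ℐ]

/-- The tuple `Y` is a possible value of the sketch on the set `X`. -/
def IsOutput (Z : BucketingSketch r 𝒳 ℬ ℐ) (X : Finset 𝒳) (Y : Fin r → Finset (𝒳 × ℐ)) : Prop :=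
  ∀ i, (Z i).IsOutput X (Y i)

/-- `L` stores a possible value of the sketch on `X`: a list without repetitions, in any order,
for each sub-sketch. -/
def IsStored (Z : BucketingSketch r 𝒳 ℬ ℐ) (X : Finset 𝒳) (L : Fin r → List (𝒳 × ℐ)) : Prop :=
  (∀ i, (L i).Nodup) ∧ IsOutput Z X fun i => (L i).toFinset

/-- The space budget of the sketch on `X`. -/
def spaceBudget (Z : BucketingSketch r 𝒳 ℬ ℐ) (X : Finset 𝒳) : ℝ≥0 := ∑ i, (Z i).budget X

end BucketingSketch

/-- The randomized bucketing-based sketch `Z` with recover function `recover` is an `o`-restricted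
`α`-approximate sketch for `f` with failure probability `δ`: for each `X` with `f X ≥ o`, with
probability at least `1 - δ`, the recover function outputs an `α`-approximation of `f X`,
whatever items were selected in the full buckets. -/
def IsRestrictedApproxSketch {Ω : Type*} [MeasurableSpace Ω] (μ : Measure Ω)
    {r : ℕ} {𝒳 ℬ ℐ : Type*} [DecidableEq 𝒳] [DecidableEq ℬ] [DecidableEq ℐ]
    (Z : Ω → BucketingSketch r 𝒳 ℬ ℐ) (recover : (Fin r → List (𝒳 × ℐ)) → ℝ)
    (f : Finset 𝒳 → ℝ) (o α δ : ℝ) : Prop :=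
  ∀ X : Finset 𝒳, o ≤ f X → HoldsWithProb μ (1 - δ) fun ω =>
    ∀ L, (Z ω).IsStored X L → IsApproximation α (f X) (recover L)

/-! ### `k`-cover, with `n` sets and `m` elements, given by the set `X` of edges -/

/-- The elements covered by the sets in `P`. -/
def coverNbrs {n m : ℕ} (X : Finset (Fin n × Fin m)) (P : Finset (Fin n)) : Finset (Fin m) :=
  Finset.univ.filter fun e => ∃ S ∈ P, (S, e) ∈ X

/-- The optimal `k`-cover value (used for `k ≤ n` only). -/
def optCover {n m : ℕ} (k : ℕ) (X : Finset (Fin n × Fin m)) : ℕ :=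
  ((Finset.univ : Finset (Fin n)).powersetCard k).sup fun P => (coverNbrs X P).card

/-- The edges of `X` at the element `e`. -/
def edgesAt {n m : ℕ} (X : Finset (Fin n × Fin m)) (e : Fin m) : Finset (Fin n × Fin m) :=
  X.filter fun x => x.2 = e

/-- `H` is (the edge set of) a subsampled sketch graph `H'_p` of the graph `X` with degree bound
`T`: an element whose hash value is at most `p` keeps all its edges if its degree is at most `T`
and arbitrary `⌊T⌋` of them otherwise; any other element loses all its edges. -/
def IsSubsampledGraph {n m : ℕ} (ħ : Fin m → unitInterval) (p : ℝ) (T : ℝ≥0)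
    (X H : Finset (Fin n × Fin m)) : Prop :=
  H ⊆ X ∧ ∀ e : Fin m,
    if (ħ e : ℝ) ≤ p then
      if ((edgesAt X e).card : ℝ≥0) ≤ T then edgesAt H e = edgesAt X e
      else (edgesAt H e).card = ⌊T⌋₊
    else edgesAt H e = ∅

/-- The bucketing-based sketch for `k`-cover: one sub-sketch; an edge `(S, e)` passes the filter
iff the hash value of `e` is at most `p`; there is one bucket for each element; the stored
information is the edge itself, which takes one unit of space; the threshold is `T`. -/
def kCoverSketch {n m : ℕ} (ħ : Fin m → unitInterval) (p : ℝ) (T : ℝ≥0) :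
    BucketingSketch 1 (Fin n × Fin m) (Fin m) (Fin n × Fin m) :=
  fun _ =>
    { filter := fun x => decide ((ħ x.2 : ℝ) ≤ p)
      bucket := fun x => x.2
      process := fun x => x
      size := fun _ => 1
      threshold := T }

/-- `k log(1/δ) log n` -/
def coverLog (n k : ℕ) (δ : ℝ) : ℝ := k * Real.log (1 / δ) * Real.log n

/-- The sampling rate `p = min (k log(1/δ) log n / (ε² o), 1)`. -/
def samplingRate (n k : ℕ) (ε δ o : ℝ) : ℝ := min (coverLog n k δ / (ε ^ 2 * o)) 1

/-- The threshold `n log(1/ε) / (ε k)` (a positive number for `n, k ≥ 1` and `0 < ε < 1`). -/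
def bucketThreshold (n k : ℕ) (ε : ℝ) : ℝ≥0 := Real.toNNReal (n * Real.log (1 / ε) / (ε * k))

/-! ### The machine model

Programs for a random access machine with unit cost. Its memory consists of arrays of words
(natural numbers) and arrays of real numbers, named by constants. Words can be added, subtracted
(truncated at `0`), compared and used as indices, but not multiplied. The operations on reals are
the field operations, comparison, reduction modulo one, and the conversion of a word; the only
constants in programs are natural numbers. -/

/-- The memory content. Array `a` has in position `i` the word `word a i` or the real `real a i`. -/
structure RamState where
  word : ℕ → ℕ → ℕ
  real : ℕ → ℕ → ℝ

inductive WordExp where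
  | lit (c : ℕ)
  | get (a : ℕ) (i : WordExp)
  | add (u v : WordExp)
  | sub (u v : WordExp)

def WordExp.eval (s : RamState) : WordExp → ℕ
  | .lit c => c
  | .get a i => s.word a (i.eval s)
  | .add u v => u.eval s + v.eval s
  | .sub u v => u.eval s - v.eval s

inductive RealExp where
  | ofWord (u : WordExp)
  | get (a : ℕ) (i : WordExp)
  | add (u v : RealExp)
  | sub (u v : RealExp)
  | mul (u v : RealExp)
  | div (u v : RealExp)
  | fract (u : RealExp)

def RealExp.eval (s : RamState) : RealExp → ℝ
  | .ofWord u => (u.eval s : ℝ)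
  | .get a i => s.real a (i.eval s)
  | .add u v => u.eval s + v.eval s
  | .sub u v => u.eval s - v.eval s
  | .mul u v => u.eval s * v.eval s
  | .div u v => u.eval s / v.eval s
  | .fract u => Int.fract (u.eval s)

inductive RamTest where
  | wordLe (u v : WordExp)
  | realLe (u v : RealExp)
  | not (b : RamTest)
  | and (b c : RamTest)

def RamTest.Holds (s : RamState) : RamTest → Prop
  | .wordLe u v => u.eval s ≤ v.eval s
  | .realLe u v => u.eval s ≤ v.eval s
  | .not b => ¬ b.Holds s
  | .and b c => b.Holds s ∧ c.Holds s

inductive RamProg where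
  | skip
  | setWord (a : ℕ) (i v : WordExp)
  | setReal (a : ℕ) (i : WordExp) (v : RealExp)
  | seq (P Q : RamProg)
  | ite (b : RamTest) (P Q : RamProg)
  | while (b : RamTest) (P : RamProg)

def RamState.setWord (s : RamState) (a i v : ℕ) : RamState :=
  { s with word := Function.update s.word a (Function.update (s.word a) i v) }

def RamState.setReal (s : RamState) (a i : ℕ) (v : ℝ) : RamState :=
  { s with real := Function.update s.real a (Function.update (s.real a) i v) }

/-- `RamRun P s c s'`: started in `s`, the program `P` halts in `s'` after `c` steps. A step is an
assignment or a test. (The expressions in a program have a constant size, so that a step is a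
constant number of unit-cost operations.) -/
inductive RamRun : RamProg → RamState → ℕ → RamState → Prop
  | skip (s : RamState) : RamRun .skip s 0 s
  | setWord (a : ℕ) (i v : WordExp) (s : RamState) :
      RamRun (.setWord a i v) s 1 (s.setWord a (i.eval s) (v.eval s))
  | setReal (a : ℕ) (i : WordExp) (v : RealExp) (s : RamState) :
      RamRun (.setReal a i v) s 1 (s.setReal a (i.eval s) (v.eval s))
  | seq {P Q : RamProg} {s₁ s₂ s₃ : RamState} {c d : ℕ} :
      RamRun P s₁ c s₂ → RamRun Q s₂ d s₃ → RamRun (.seq P Q) s₁ (c + d) s₃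
  | iteTrue {b : RamTest} {P Q : RamProg} {s s' : RamState} {c : ℕ} :
      b.Holds s → RamRun P s c s' → RamRun (.ite b P Q) s (1 + c) s'
  | iteFalse {b : RamTest} {P Q : RamProg} {s s' : RamState} {c : ℕ} :
      ¬ b.Holds s → RamRun Q s c s' → RamRun (.ite b P Q) s (1 + c) s'
  | whileFalse {b : RamTest} {P : RamProg} {s : RamState} :
      ¬ b.Holds s → RamRun (.while b P) s 1 s
  | whileTrue {b : RamTest} {P : RamProg} {s₁ s₂ s₃ : RamState} {c d : ℕ} :
      b.Holds s₁ → RamRun P s₁ c s₂ → RamRun (.while b P) s₂ d s₃ →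
      RamRun (.while b P) s₁ (1 + c + d) s₃

/-- The memory before an edge `(S, e)` is processed: word array `0` is `S, e, t`, real array `0`
is the sampling rate `p`, real array `1` is the random seed `ω₀, …, ω_{t-1}` of the hash
function. All other cells are `0`. -/
def edgeInput {n m t : ℕ} (p : ℝ) (ω : Fin t → unitInterval) (x : Fin n × Fin m) : RamState where
  word a i := if a = 0 then [(x.1 : ℕ), (x.2 : ℕ), t].getD i 0 else 0
  real a i :=
    if a = 0 then [p].getD i 0
    else if a = 1 then (if h : i < t then (ω ⟨i, h⟩ : ℝ) else 0)
    else 0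

/-- In the final memory word array `1` is `h(x), g(x), ζ(x)`, the value `h(x)` as `0` or `1`, the
edge `ζ(x)` as the pair of its ends. -/
def EdgeOutput {n m : ℕ} (Z : SubSketch (Fin n × Fin m) (Fin m) (Fin n × Fin m))
    (x : Fin n × Fin m) (s : RamState) : Prop :=
  s.word 1 0 = (if Z.filter x = true then 1 else 0) ∧
  s.word 1 1 = (Z.bucket x : ℕ) ∧
  s.word 1 2 = ((Z.process x).1 : ℕ) ∧
  s.word 1 3 = ((Z.process x).2 : ℕ)

/-- The memory before the recover function is applied to a stored sketch: word array `0` is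
`n, m, k` and the number of stored edges, word arrays `1` and `2` hold the first and the second
ends of the stored edges, and real array `0` is the accuracy `ε` and the sampling rate `p`. All
other cells are `0`. -/
def recoverInput {n m : ℕ} (k : ℕ) (ε p : ℝ)
    (l : List ((Fin n × Fin m) × (Fin n × Fin m))) : RamState where
  word a i :=
    if a = 0 then [n, m, k, l.length].getD i 0
    else if a = 1 then (l.map fun y => (y.2.1 : ℕ)).getD i 0
    else if a = 2 then (l.map fun y => (y.2.2 : ℕ)).getD i 0
    else 0
  real a i := if a = 0 then [ε, p].getD i 0 else 0

end

/-! The hash value of `e` is a polynomial of degree below `t` with random coefficients, evaluated at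
the integer `e` and reduced modulo one. At integer points this evaluation is defined on coefficients
in the circle, where it is a continuous group homomorphism. By Lagrange interpolation over the reals
it is surjective onto the values at any at most `t` points, so it carries Haar measure to Haar
measure: any `t` values are independent and uniform (`isWiseIndependentHash_polyHash`).

Moments of order `q ≤ t` see only the joint laws of at most `q` values, so they agree with those of
full independence. There the exponential moment bounds them, and Markov's inequality gives deviation
probability `e^{-q}` (`IsWiseIndependentHash.measure_abs_sum_ge_le`). As `t` is of order `k log(1/δ)
log n`, this survives a union bound over the at most `n ^ k` choices of `k` sets: sampling preserves
the coverage of all of them up to `(ε/4) p OPT` (`IsWiseIndependentHash.holdsWithProb_good`).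

Truncating degrees at `T` costs a factor `1 - 3ε'` (`le_optCover_of_degree_bound`): of `k` optimal
sets a fraction of about `ε'` is given up and replaced by random sets. These hit nearly all
truncated elements, whose degrees are still of order `T`, and little is lost on the intact elements.
Rescaling a solution in the sketch by `(1 - ε/4)/p` therefore estimates the optimum from below
(`IsEstimate.isApproximation`).

For the space, `k` random sets cover an element of degree `d` with probability at least `min(1,
dk/n)/2`. Since `T ≥ n/k`, the degrees capped at `T` sum to at most `2 T OPT`
(`sum_min_degree_le_optCover`), and the tail bound applies to the sampled part of this sum.

The recovery program is the greedy algorithm in linear time. Levels `v` run downwards, and level `v`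
visits the edges that have rank `v` within their set; these meet each set of original degree at
least `v` exactly once, so all levels together make one visit per edge. At level `v` no residual
degree exceeds `v`, so any set found with residual degree `v` is a greedy choice
(`achieves_selectLevel`, `achieves_recoverProgram`). -/

noncomputable section

/-! ### The polynomial hash function -/

/-- The fractional part, as an element of the unit interval. -/
def unitFract (x : ℝ) : unitInterval :=
  ⟨Int.fract x, Int.fract_nonneg x, (Int.fract_lt_one x).le⟩

/-- The value at `x`, modulo one, of the polynomial with coefficients `ω`. -/
def polyHash {t : ℕ} (ω : Fin t → unitInterval) (x : ℕ) : unitInterval :=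
  unitFract (∑ j, (ω j : ℝ) * (x : ℝ) ^ (j : ℕ))

/-- The representative in the unit interval of a point of the circle. -/
def circleToUnit (u : UnitAddCircle) : unitInterval :=
  unitFract (AddCircle.equivIco (1 : ℝ) 0 u)

/-- The quotient map from the unit interval to the circle. -/
def unitToCircle (x : unitInterval) : UnitAddCircle := ((x : ℝ) : UnitAddCircle)

theorem measurable_unitFract : Measurable unitFract :=
  Measurable.subtype_mk measurable_fract

theorem circleToUnit_coe (x : ℝ) : circleToUnit (x : UnitAddCircle) = unitFract x := by
  apply Subtype.ext
  simp only [circleToUnit, unitFract]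
  rw [AddCircle.coe_equivIco_mk_apply]
  simp

theorem measurePreserving_unitToCircle : MeasurePreserving unitToCircle volume volume := by
  have h1 : MeasurePreserving ((↑) : ℝ → UnitAddCircle) (volume.restrict (Set.Icc (0 : ℝ) 1))
      volume := by
    have := AddCircle.measurePreserving_mk (1 : ℝ) 0
    rw [zero_add, Measure.restrict_congr_set Ioc_ae_eq_Icc] at this
    exact this
  exact h1.comp unitInterval.measurePreserving_coe

theorem measurable_circleToUnit : Measurable circleToUnit :=
  measurable_unitFract.comp
    (measurable_subtype_coe.comp (AddCircle.measurableEquivIco (1 : ℝ) 0).measurable)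

/-- The composition with the quotient map from the interval is the identity except at the endpoint
`1`, a null set, and the quotient map preserves the measure. -/
theorem measurePreserving_circleToUnit : MeasurePreserving circleToUnit volume volume := by
  refine ⟨measurable_circleToUnit, ?_⟩
  rw [← measurePreserving_unitToCircle.map_eq,
    Measure.map_map measurable_circleToUnit measurePreserving_unitToCircle.measurable]
  have h : circleToUnit ∘ unitToCircle =ᵐ[volume] id := by
    have h1 : ∀ᵐ x : unitInterval, x ≠ 1 := by
      simp [ae_iff]
    filter_upwards [h1] with x hx
    rw [Function.comp_apply, unitToCircle, circleToUnit_coe]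
    apply Subtype.ext
    simp only [unitFract, id]
    exact Int.fract_eq_self.2 ⟨x.2.1, lt_of_le_of_ne x.2.2 fun h => hx (Subtype.ext h)⟩
  rw [Measure.map_congr h, Measure.map_id]

/-- Evaluation at the points of `s` of the polynomials with coefficients in the circle. -/
def circleEval {t : ℕ} {ι : Type*} (x : ι → ℕ) :
    (Fin t → UnitAddCircle) →+ (ι → UnitAddCircle) where
  toFun u e := ∑ j : Fin t, (x e ^ (j : ℕ)) • u j
  map_zero' := by ext; simp
  map_add' u v := by ext e; simp [Finset.sum_add_distrib]

theorem coe_sum_mul_pow {t : ℕ} (a : Fin t → ℝ) (x : ℕ) :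
    ((∑ j, a j * (x : ℝ) ^ (j : ℕ) : ℝ) : UnitAddCircle) =
      ∑ j : Fin t, (x ^ (j : ℕ)) • (a j : UnitAddCircle) := by
  have h := map_sum (QuotientAddGroup.mk' (AddSubgroup.zmultiples (1 : ℝ)))
    (fun j : Fin t => a j * (x : ℝ) ^ (j : ℕ)) Finset.univ
  refine h.trans (Finset.sum_congr rfl fun j _ => ?_)
  rw [← Nat.cast_pow, mul_comm, ← nsmul_eq_mul, map_nsmul]
  rfl

theorem continuous_circleEval {t : ℕ} {ι : Type*} (x : ι → ℕ) :
    Continuous (circleEval (t := t) x) := by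
  refine continuous_pi fun e => ?_
  simp only [circleEval, AddMonoidHom.coe_mk, ZeroHom.coe_mk]
  fun_prop

/-- Real lifts of the prescribed circle values are interpolated by a real polynomial of degree below
`t`. Its coefficients may be reduced modulo one because the nodes are integers. No finite field is
needed. -/
theorem circleEval_surjective {t : ℕ} {ι : Type*} [Fintype ι] {x : ι → ℕ}
    (hx : Function.Injective x) (ht : Fintype.card ι ≤ t) :
    Function.Surjective (circleEval (t := t) x) := by
  classical
  intro y
  choose r hr using fun e => QuotientAddGroup.mk_surjective (y e)
  let P : Polynomial ℝ := Lagrange.interpolate Finset.univ (fun e => (x e : ℝ)) r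
  have hinj : Set.InjOn (fun e => (x e : ℝ)) (Finset.univ : Finset ι) :=
    fun a _ b _ h => hx (Nat.cast_injective h)
  refine ⟨fun j => ((P.coeff j : ℝ) : UnitAddCircle), ?_⟩
  ext e
  simp only [circleEval, AddMonoidHom.coe_mk, ZeroHom.coe_mk]
  have h1 : P.eval (x e : ℝ) = r e :=
    Lagrange.eval_interpolate_at_node r hinj (Finset.mem_univ e)
  have h2 : P.eval (x e : ℝ) = ∑ j ∈ Finset.range t, P.coeff j * (x e : ℝ) ^ j := by
    rcases Nat.eq_zero_or_pos t with h0 | h0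
    · exfalso
      have : 0 < Fintype.card ι := Fintype.card_pos_iff.2 ⟨e⟩
      omega
    · refine Polynomial.eval_eq_sum_range' ?_ _
      by_cases hP : P = 0
      · simpa [hP] using h0
      · rw [Polynomial.natDegree_lt_iff_degree_lt hP]
        refine (Lagrange.degree_interpolate_lt r hinj).trans_le ?_
        exact_mod_cast ht
  rw [← hr e]
  change _ = ((r e : ℝ) : UnitAddCircle)
  rw [← h1, h2, ← Fin.sum_univ_eq_sum_range (fun j => P.coeff j * (x e : ℝ) ^ j),
    coe_sum_mul_pow (fun j : Fin t => P.coeff j)]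

theorem polyHash_eq {t : ℕ} {ι : Type*} (x : ι → ℕ) (ω : Fin t → unitInterval) (e : ι) :
    polyHash ω (x e) = circleToUnit (circleEval x (fun j => unitToCircle (ω j)) e) := by
  have : circleEval x (fun j => unitToCircle (ω j)) e =
      ((∑ j, (ω j : ℝ) * (x e : ℝ) ^ (j : ℕ) : ℝ) : UnitAddCircle) := by
    rw [coe_sum_mul_pow (fun j => (ω j : ℝ))]
    rfl
  rw [this, circleToUnit_coe, polyHash]

/-- A continuous surjective homomorphism between compact groups pushes Haar measure to Haar measure.
Applied to `circleEval`, this makes the values jointly uniform on the torus. -/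
theorem measurePreserving_polyHash {t : ℕ} {ι : Type*} [Fintype ι] {x : ι → ℕ}
    (hx : Function.Injective x) (ht : Fintype.card ι ≤ t) :
    MeasurePreserving (fun (ω : Fin t → unitInterval) e => polyHash ω (x e))
      volume volume := by
  have h1 : MeasurePreserving (fun (ω : Fin t → unitInterval) j => unitToCircle (ω j))
      volume volume := volume_preserving_pi fun _ => measurePreserving_unitToCircle
  have h2 : MeasurePreserving (circleEval (t := t) x) volume volume :=
    AddMonoidHom.measurePreserving (continuous_circleEval x) (circleEval_surjective hx ht)
      (by rw [volume_pi, volume_pi, Measure.pi_univ, Measure.pi_univ]; simp)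
  have h3 : MeasurePreserving (fun (u : ι → UnitAddCircle) e => circleToUnit (u e))
      volume volume := volume_preserving_pi fun _ => measurePreserving_circleToUnit
  have := h3.comp (h2.comp h1)
  convert this using 1
  ext ω e
  simp only [Function.comp_apply]
  rw [polyHash_eq]

theorem isWiseIndependentHash_polyHash (t m : ℕ) (ht : 1 ≤ t) :
    IsWiseIndependentHash (volume : Measure (Fin t → unitInterval)) t
      fun ω (e : Fin m) => polyHash ω e := by
  have h1 : ∀ e : Fin m, MeasurePreserving
      (fun (ω : Fin t → unitInterval) => polyHash ω (e : ℕ)) volume volume := by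
    intro e
    have h := measurePreserving_polyHash (t := t) (ι := Unit) (x := fun _ => (e : ℕ))
      (fun _ _ _ => rfl) (by simpa using ht)
    exact (measurePreserving_eval (fun _ : Unit => (volume : Measure unitInterval)) ()).comp h
  refine ⟨h1, fun s hs => ?_⟩
  rw [iIndepFun_iff_map_fun_eq_pi_map fun e : s => (h1 e).measurable.aemeasurable]
  have h := measurePreserving_polyHash (t := t) (x := fun e : s => ((e : Fin m) : ℕ))
    (fun a b hab => Subtype.ext (Fin.ext hab)) (by simpa using hs)
  rw [h.map_eq, volume_pi]
  congr 1
  ext e : 1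
  exact (h1 e).map_eq.symm

/-! ### Moments of sums over a hash function with limited independence -/

section Moments

variable {Ω E : Type*} [MeasurableSpace Ω] {μ : Measure Ω} [IsProbabilityMeasure μ]

/-- The joint law of at most `t` values is the uniform distribution. -/
theorem IsWiseIndependentHash.map_eq {t : ℕ} {ħ : Ω → E → unitInterval}
    (hħ : IsWiseIndependentHash μ t ħ) {s : Finset E} (hs : s.card ≤ t) :
    μ.map (fun ω (e : s) => ħ ω e) = volume := by
  have h := (iIndepFun_iff_map_fun_eq_pi_map
    fun e : s => (hħ.1 e).measurable.aemeasurable).1 (hħ.2 s hs)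
  rw [h, volume_pi]
  congr 1
  ext e : 1
  exact (hħ.1 e).map_eq

theorem isWiseIndependentHash_id [Fintype E] (t : ℕ) :
    IsWiseIndependentHash (volume : Measure (E → unitInterval)) t fun ω e => ω e := by
  refine ⟨fun e => measurePreserving_eval (fun _ : E => (volume : Measure unitInterval)) e,
    fun s _ => ?_⟩
  have h : iIndepFun (fun (e : E) (ω : E → unitInterval) => ω e) volume :=
    iIndepFun_pi (X := fun (_ : E) (u : unitInterval) => u)
      (μ := fun _ => (volume : Measure unitInterval)) fun _ => aemeasurable_id
  exact h.precomp (g := fun e : s => (e : E)) Subtype.val_injective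

/-- The tuple `f` may repeat keys, but its image has at most `q ≤ t` of them, and their joint law is
known. -/
theorem IsWiseIndependentHash.integral_prod [DecidableEq E] {t q : ℕ}
    {ħ : Ω → E → unitInterval} (hħ : IsWiseIndependentHash μ t ħ) (hq : q ≤ t)
    {g : E → unitInterval → ℝ} (hg : ∀ e, Measurable (g e)) (f : Fin q → E) :
    ∫ ω, ∏ j, g (f j) (ħ ω (f j)) ∂μ =
      ∫ v : (↥(Finset.univ.image f) → unitInterval),
        ∏ j, g (f j) (v ⟨f j, Finset.mem_image_of_mem f (Finset.mem_univ j)⟩) := by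
  have hs : (Finset.univ.image f).card ≤ t :=
    Finset.card_image_le.trans (by simpa using hq)
  rw [← hħ.map_eq hs, integral_map]
  · exact (measurable_pi_lambda (fun ω (e : ↥(Finset.univ.image f)) => ħ ω e)
      fun e => (hħ.1 e).measurable).aemeasurable
  · refine Measurable.aestronglyMeasurable ?_
    exact Finset.measurable_prod _ fun j _ => (hg _).comp (measurable_pi_apply _)

omit [IsProbabilityMeasure μ] in
theorem IsWiseIndependentHash.measurable_sum [Fintype E] {t : ℕ} {ħ : Ω → E → unitInterval}
    (hħ : IsWiseIndependentHash μ t ħ) {g : E → unitInterval → ℝ} (hg : ∀ e, Measurable (g e)) :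
    Measurable fun ω => ∑ e, g e (ħ ω e) :=
  Finset.measurable_sum _ fun e _ => (hg e).comp (hħ.1 e).measurable

/-- The right-hand side no longer depends on `ħ` or `μ`, so any two such hash functions have the
same moment. -/
theorem IsWiseIndependentHash.integral_sum_pow_eq_sum [Fintype E] [DecidableEq E] {t q : ℕ}
    {ħ : Ω → E → unitInterval} (hħ : IsWiseIndependentHash μ t ħ) (hq : q ≤ t)
    {g : E → unitInterval → ℝ} (hg : ∀ e, Measurable (g e)) (hb : ∀ e u, |g e u| ≤ 1) :
    ∫ ω, (∑ e, g e (ħ ω e)) ^ q ∂μ = ∑ f : Fin q → E,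
      ∫ v : (↥(Finset.univ.image f) → unitInterval),
        ∏ j, g (f j) (v ⟨f j, Finset.mem_image_of_mem f (Finset.mem_univ j)⟩) := by
  simp_rw [Finset.sum_pow', Fintype.piFinset_univ]
  rw [integral_finsetSum]
  · exact Finset.sum_congr rfl fun f _ => hħ.integral_prod hq hg f
  · intro f _
    refine Integrable.of_bound (Measurable.aestronglyMeasurable ?_) 1 (ae_of_all _ fun ω => ?_)
    · exact Finset.measurable_prod _ fun j _ => (hg _).comp (hħ.1 _).measurable
    · rw [Real.norm_eq_abs, Finset.abs_prod]
      exact Finset.prod_le_one (fun _ _ => abs_nonneg _) fun _ _ => hb _ _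

/-- The `q`-th moment of a sum over a `q`-wise independent hash function is the same as in the
fully independent case. -/
theorem IsWiseIndependentHash.integral_sum_pow [Fintype E] {t q : ℕ}
    {ħ : Ω → E → unitInterval} (hħ : IsWiseIndependentHash μ t ħ) (hq : q ≤ t)
    {g : E → unitInterval → ℝ} (hg : ∀ e, Measurable (g e)) (hb : ∀ e u, |g e u| ≤ 1) :
    ∫ ω, (∑ e, g e (ħ ω e)) ^ q ∂μ =
      ∫ u : E → unitInterval, (∑ e, g e (u e)) ^ q := by
  classical
  rw [hħ.integral_sum_pow_eq_sum hq hg hb,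
    (isWiseIndependentHash_id (E := E) t).integral_sum_pow_eq_sum hq hg hb]

end Moments

/-- The centred indicator of the event that a uniform number is at most `p`. -/
def centredInd (p : ℝ) (u : unitInterval) : ℝ := (if (u : ℝ) ≤ p then 1 else 0) - p

theorem measurable_centredInd (p : ℝ) : Measurable (centredInd p) :=
  (Measurable.ite (measurableSet_le measurable_subtype_coe measurable_const)
    measurable_const measurable_const).sub_const p

theorem abs_centredInd_le {p : ℝ} (h0 : 0 ≤ p) (h1 : p ≤ 1) (u : unitInterval) :
    |centredInd p u| ≤ 1 := by
  unfold centredInd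
  split_ifs <;> rw [abs_le] <;> constructor <;> linarith

/-- As `|a * centredInd p u| ≤ 1`, the estimate `e^x ≤ 1 + x + x²` applies. The linear term has mean
zero and the quadratic one contributes the variance `p(1 - p) ≤ p`. -/
theorem integral_exp_centredInd_le {p a : ℝ} (h0 : 0 ≤ p) (h1 : p ≤ 1) (ha : |a| ≤ 1) :
    ∫ u, Real.exp (a * centredInd p u) ≤ Real.exp (a ^ 2 * p) := by
  have hind : ∫ u : unitInterval, (if (u : ℝ) ≤ p then (1 : ℝ) else 0) = p := by
    have : (fun u : unitInterval => if (u : ℝ) ≤ p then (1 : ℝ) else 0) =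
        (Set.Iic (⟨p, h0, h1⟩ : unitInterval)).indicator fun _ => 1 := by
      ext u
      simp only [Set.indicator, Set.mem_Iic]
      congr 1
    rw [this, integral_indicator measurableSet_Iic]
    simp [Measure.real, ENNReal.toReal_ofReal h0]
  have hint : Integrable (fun u : unitInterval => if (u : ℝ) ≤ p then (1 : ℝ) else 0) := by
    refine Integrable.of_bound (Measurable.aestronglyMeasurable ?_) 1 (ae_of_all _ fun ω => ?_)
    · exact Measurable.ite (measurableSet_le measurable_subtype_coe measurable_const)
        measurable_const measurable_const
    · split_ifs <;> simp
  have hc : ∀ u, |a * centredInd p u| ≤ 1 := fun u => by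
    rw [abs_mul]
    exact mul_le_one₀ ha (abs_nonneg _) (abs_centredInd_le h0 h1 u)
  calc ∫ u, Real.exp (a * centredInd p u)
      ≤ ∫ u : unitInterval, ((1 - a * p + a ^ 2 * p ^ 2) +
          (a + a ^ 2 * (1 - 2 * p)) * (if (u : ℝ) ≤ p then (1 : ℝ) else 0)) := by
        refine integral_mono_of_nonneg (ae_of_all _ fun _ => (Real.exp_pos _).le)
          ((integrable_const _).add (hint.const_mul _)) (ae_of_all _ fun u => ?_)
        have h := (abs_le.1 (Real.abs_exp_sub_one_sub_id_le (hc u))).2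
        have h2 : Real.exp (a * centredInd p u) ≤
            1 + a * centredInd p u + (a * centredInd p u) ^ 2 := by linarith
        refine h2.trans (le_of_eq ?_)
        -- An indicator equals its square, so `1 + x + x²` is affine in it.
        simp only [centredInd]
        split_ifs <;> ring
    _ = 1 + a ^ 2 * (p * (1 - p)) := by
        rw [integral_add (integrable_const _) (hint.const_mul _), integral_const_mul, hind]
        simp
        ring
    _ ≤ 1 + a ^ 2 * p := by
        have : p * (1 - p) ≤ p := by nlinarith
        nlinarith [sq_nonneg a]
    _ ≤ _ := by linarith [Real.add_one_le_exp (a ^ 2 * p)]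

/-- One term of the power series of `cosh`, all of whose terms are nonnegative. -/
theorem pow_le_factorial_mul_exp_add_exp (r : ℕ) (x : ℝ) :
    x ^ (2 * r) ≤ (2 * r).factorial * ((Real.exp x + Real.exp (-x)) / 2) := by
  have h := Real.hasSum_cosh x
  have h1 : x ^ (2 * r) / (2 * r).factorial ≤ Real.cosh x := by
    refine le_hasSum h r fun j _ => ?_
    have : 0 ≤ x ^ (2 * j) := by rw [pow_mul]; positivity
    positivity
  rw [div_le_iff₀ (by positivity), Real.cosh_eq] at h1
  linarith

/-! ### Exponential moments, even moments and the resulting tail bound for weighted sums. -/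

section Tail

variable {E : Type*} [Fintype E] {w : E → ℝ} {p M : ℝ}

/-- Independence factorizes the integral. Weights in `[0,1]` satisfy `w² ≤ w`, so the variances add
up to at most the mean, hence to at most `M`. -/
theorem integral_exp_sum_centredInd_le (hw0 : ∀ e, 0 ≤ w e) (hw1 : ∀ e, w e ≤ 1)
    (hp0 : 0 ≤ p) (hp1 : p ≤ 1) (hM : p * ∑ e, w e ≤ M) {a : ℝ} (ha : |a| ≤ 1) :
    ∫ u : E → unitInterval, Real.exp (a * ∑ e, w e * centredInd p (u e)) ≤
      Real.exp (a ^ 2 * M) := by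
  simp_rw [Finset.mul_sum, Real.exp_sum, ← mul_assoc]
  rw [integral_fintype_prod_volume_eq_prod
    (fun (e : E) (u : unitInterval) => Real.exp (a * w e * centredInd p u))]
  calc ∏ e, ∫ u, Real.exp (a * w e * centredInd p u)
      ≤ ∏ e, Real.exp (a ^ 2 * (p * w e)) := by
        refine Finset.prod_le_prod (fun e _ => integral_nonneg fun _ => (Real.exp_pos _).le)
          fun e _ => ?_
        refine (integral_exp_centredInd_le hp0 hp1 ?_).trans (Real.exp_le_exp.2 ?_)
        · rw [abs_mul, abs_of_nonneg (hw0 e)]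
          exact mul_le_one₀ ha (hw0 e) (hw1 e)
        · have : w e ^ 2 ≤ w e := by nlinarith [hw0 e, hw1 e]
          calc (a * w e) ^ 2 * p = a ^ 2 * (p * w e ^ 2) := by ring
            _ ≤ _ := by gcongr
    _ = Real.exp (a ^ 2 * (p * ∑ e, w e)) := by
        rw [← Real.exp_sum, Finset.mul_sum, Finset.mul_sum]
    _ ≤ _ := by gcongr

theorem abs_sum_centredInd_le (hw0 : ∀ e, 0 ≤ w e) (hw1 : ∀ e, w e ≤ 1)
    (hp0 : 0 ≤ p) (hp1 : p ≤ 1) (u : E → unitInterval) :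
    |∑ e, w e * centredInd p (u e)| ≤ Fintype.card E := by
  refine (Finset.abs_sum_le_sum_abs _ _).trans ?_
  calc ∑ e, |w e * centredInd p (u e)| ≤ ∑ _e : E, (1 : ℝ) := by
        refine Finset.sum_le_sum fun e _ => ?_
        rw [abs_mul, abs_of_nonneg (hw0 e)]
        exact mul_le_one₀ (hw1 e) (abs_nonneg _) (abs_centredInd_le hp0 hp1 _)
    _ = _ := by simp

/-- With `q = 2r`, the bound `x^q ≤ q! cosh x` at `x = aS` gives `E S^q ≤ a^{-q} q! e^{a²M}`. The
choice `a² = q/M` and `q! ≤ q^q` turn this into `(e² q M)^r`. -/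
theorem integral_sum_centredInd_pow_le (hw0 : ∀ e, 0 ≤ w e) (hw1 : ∀ e, w e ≤ 1)
    (hp0 : 0 ≤ p) (hp1 : p ≤ 1) (hM : p * ∑ e, w e ≤ M) {r : ℕ} (hr : 1 ≤ r)
    (hrM : (2 * r : ℕ) ≤ M) :
    ∫ u : E → unitInterval, (∑ e, w e * centredInd p (u e)) ^ (2 * r) ≤
      (Real.exp 2 * (2 * r : ℕ) * M) ^ r := by
  set q : ℕ := 2 * r with hq
  have hq0 : (0 : ℝ) < q := by exact_mod_cast (by omega : 0 < q)
  have hM0 : 0 < M := hq0.trans_le hrM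
  -- This choice makes `a² M = q`; the hypothesis `q ≤ M` is what keeps `|a| ≤ 1`.
  set a : ℝ := Real.sqrt (q / M) with ha
  have ha2 : a ^ 2 = q / M := Real.sq_sqrt (by positivity)
  have ha0 : 0 < a := Real.sqrt_pos.2 (by positivity)
  have ha1 : |a| ≤ 1 := by
    rw [abs_of_pos ha0, ha, Real.sqrt_le_one]
    exact (div_le_one hM0).2 hrM
  have haM : a ^ 2 * M = q := by rw [ha2]; field_simp
  set S : (E → unitInterval) → ℝ := fun u => ∑ e, w e * centredInd p (u e) with hS
  have hSm : Measurable S := Finset.measurable_sum _ fun e _ =>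
    ((measurable_centredInd p).comp (measurable_pi_apply e)).const_mul _
  have hint : ∀ b : ℝ, Integrable fun u => Real.exp (b * S u) := fun b => by
    refine Integrable.of_bound (Measurable.aestronglyMeasurable (hSm.const_mul b).exp)
      (Real.exp (|b| * Fintype.card E)) (ae_of_all _ fun u => ?_)
    rw [Real.norm_eq_abs, abs_of_pos (Real.exp_pos _), Real.exp_le_exp]
    refine (le_abs_self _).trans ?_
    rw [abs_mul]
    exact mul_le_mul_of_nonneg_left (abs_sum_centredInd_le hw0 hw1 hp0 hp1 u) (abs_nonneg b)
  have h1 : ∫ u, (a * S u) ^ q ≤ q.factorial * Real.exp q := by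
    calc ∫ u, (a * S u) ^ q
        ≤ ∫ u, (q.factorial : ℝ) * ((Real.exp (a * S u) + Real.exp (-a * S u)) / 2) := by
          refine integral_mono_of_nonneg (ae_of_all _ fun u => ?_)
            ((((hint a).add (hint (-a))).div_const 2).const_mul _) (ae_of_all _ fun u => ?_)
          · change 0 ≤ (a * S u) ^ (2 * r)
            rw [pow_mul]; positivity
          · have := pow_le_factorial_mul_exp_add_exp r (a * S u)
            rwa [← neg_mul] at this
      _ = q.factorial * ((∫ u, Real.exp (a * S u)) + ∫ u, Real.exp (-a * S u)) / 2 := by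
          rw [integral_const_mul, integral_div, integral_add (hint a) (hint (-a))]
          ring
      _ ≤ q.factorial * (Real.exp q + Real.exp q) / 2 := by
          have e1 := integral_exp_sum_centredInd_le hw0 hw1 hp0 hp1 hM ha1
          have e2 := integral_exp_sum_centredInd_le hw0 hw1 hp0 hp1 hM
            (a := -a) (by rwa [abs_neg])
          rw [haM] at e1
          rw [neg_sq, haM] at e2
          gcongr
      _ = _ := by ring
  simp_rw [mul_pow] at h1
  rw [integral_const_mul] at h1
  have haq : a ^ q = (q / M) ^ r := by rw [hq, pow_mul, ha2]
  rw [haq] at h1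
  have h2 : ∫ u, S u ^ q ≤ (M / q) ^ r * (q.factorial * Real.exp q) := by
    have h3 : (M / q) ^ r * (q / M) ^ r = (1 : ℝ) := by
      rw [← mul_pow]; field_simp; simp
    calc ∫ u, S u ^ q = (M / q) ^ r * ((q / M) ^ r * ∫ u, S u ^ q) := by
          rw [← mul_assoc, h3, one_mul]
      _ ≤ _ := by gcongr
  refine h2.trans ?_
  have h4 : (q.factorial : ℝ) ≤ (q ^ 2 : ℝ) ^ r := by
    rw [← pow_mul]
    exact_mod_cast Nat.factorial_le_pow q
  have h5 : Real.exp q = Real.exp 2 ^ r := by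
    rw [← Real.exp_nat_mul, hq]; push_cast; ring_nf
  calc (M / q) ^ r * (q.factorial * Real.exp q) ≤ (M / q) ^ r * ((q ^ 2 : ℝ) ^ r * Real.exp 2 ^ r) := by
        rw [h5]; gcongr
    _ = _ := by
        rw [← mul_pow, ← mul_pow]
        congr 1
        field_simp

/-- A tail bound for sums over a hash function with limited independence. -/
theorem IsWiseIndependentHash.measure_abs_sum_ge_le {Ω : Type*} [MeasurableSpace Ω]
    {μ : Measure Ω} [IsProbabilityMeasure μ] {t : ℕ} {ħ : Ω → E → unitInterval}
    (hħ : IsWiseIndependentHash μ t ħ) (hw0 : ∀ e, 0 ≤ w e) (hw1 : ∀ e, w e ≤ 1)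
    (hp0 : 0 ≤ p) (hp1 : p ≤ 1) (hM : p * ∑ e, w e ≤ M) {r : ℕ} (hr : 1 ≤ r)
    (hrt : 2 * r ≤ t) (hrM : (2 * r : ℕ) ≤ M) {D : ℝ} (hD : 0 < D)
    (hDM : Real.exp 4 * (2 * r : ℕ) * M ≤ D ^ 2) :
    μ {ω | D ≤ |∑ e, w e * centredInd p (ħ ω e)|} ≤ ENNReal.ofReal (Real.exp (-(2 * r : ℕ))) := by
  have hgm : ∀ e, Measurable fun u => w e * centredInd p u :=
    fun e => (measurable_centredInd p).const_mul _
  have hgb : ∀ e u, |w e * centredInd p u| ≤ 1 := fun e u => by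
    rw [abs_mul, abs_of_nonneg (hw0 e)]
    exact mul_le_one₀ (hw1 e) (abs_nonneg _) (abs_centredInd_le hp0 hp1 _)
  have hmom := hħ.integral_sum_pow hrt hgm hgb
  have hle := integral_sum_centredInd_pow_le hw0 hw1 hp0 hp1 hM hr hrM
  rw [← hmom] at hle
  have hSm := hħ.measurable_sum hgm
  have hset : {ω | D ≤ |∑ e, w e * centredInd p (ħ ω e)|} ⊆
      {ω | D ^ (2 * r) ≤ (∑ e, w e * centredInd p (ħ ω e)) ^ (2 * r)} := by
    intro ω hω
    change D ^ (2 * r) ≤ (∑ e, w e * centredInd p (ħ ω e)) ^ (2 * r)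
    rw [← (even_two_mul r).pow_abs (∑ e, w e * centredInd p (ħ ω e))]
    exact pow_le_pow_left₀ hD.le hω _
  -- Markov's inequality for the power `2r`. By `hDM` the moment bound `(e² q M)^r` is at most
  -- `(e^{-2} D²)^r`.
  have hmark := mul_meas_ge_le_integral_of_nonneg (μ := μ)
    (f := fun ω => (∑ e, w e * centredInd p (ħ ω e)) ^ (2 * r))
    (ae_of_all _ fun ω => by
      change 0 ≤ (∑ e, w e * centredInd p (ħ ω e)) ^ (2 * r)
      rw [pow_mul]; positivity)
    (Integrable.of_bound (hSm.pow_const _).aestronglyMeasurable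
      ((Fintype.card E : ℝ) ^ (2 * r)) (ae_of_all _ fun ω => by
        rw [Real.norm_eq_abs, abs_pow]
        exact pow_le_pow_left₀ (abs_nonneg _) (abs_sum_centredInd_le hw0 hw1 hp0 hp1 _) _))
    (D ^ (2 * r))
  refine (measure_mono hset).trans ?_
  rw [← ENNReal.ofReal_toReal (measure_ne_top μ _)]
  refine ENNReal.ofReal_le_ofReal ?_
  change μ.real _ ≤ _
  have h1 := hmark.trans hle
  have hD2 : 0 < D ^ (2 * r) := by positivity
  refine le_of_mul_le_mul_left (h1.trans ?_) hD2
  have he : Real.exp (-(2 * r : ℕ)) = Real.exp (-2) ^ r := by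
    rw [← Real.exp_nat_mul]; push_cast; ring_nf
  rw [he, pow_mul, ← mul_pow]
  refine pow_le_pow_left₀ ?_ ?_ r
  · have : (0 : ℝ) ≤ (2 * r : ℕ) := by positivity
    have : 0 ≤ M := this.trans hrM
    positivity
  · calc Real.exp 2 * (2 * r : ℕ) * M = (Real.exp 4 * (2 * r : ℕ) * M) * Real.exp (-2) := by
          have : Real.exp 2 = Real.exp 4 * Real.exp (-2) := by
            rw [← Real.exp_add]; norm_num
          rw [this]; ring
      _ ≤ _ := by gcongr

end Tail

/-! ### Combinatorics of covers -/

section Cover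

variable {n m : ℕ}

theorem mem_coverNbrs {X : Finset (Fin n × Fin m)} {P : Finset (Fin n)} {e : Fin m} :
    e ∈ coverNbrs X P ↔ ∃ S ∈ P, (S, e) ∈ X := by
  simp [coverNbrs]

theorem coverNbrs_mono {X Y : Finset (Fin n × Fin m)} (h : X ⊆ Y) {P Q : Finset (Fin n)}
    (hPQ : P ⊆ Q) : coverNbrs X P ⊆ coverNbrs Y Q := by
  intro e he
  obtain ⟨S, hS, hX⟩ := mem_coverNbrs.1 he
  exact mem_coverNbrs.2 ⟨S, hPQ hS, h hX⟩

theorem card_edgesAt (X : Finset (Fin n × Fin m)) (e : Fin m) :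
    (edgesAt X e).card = (Finset.univ.filter fun S => (S, e) ∈ X).card := by
  refine (Finset.card_bij (fun S _ => (S, e)) ?_ ?_ ?_).symm
  · intro S hS
    simpa [edgesAt] using hS
  · intro a _ b _ h
    exact (Prod.ext_iff.1 h).1
  · rintro ⟨S, e'⟩ h
    simp only [edgesAt, Finset.mem_filter] at h
    obtain ⟨h1, rfl⟩ := h
    exact ⟨S, by simpa using h1, rfl⟩

theorem card_edgesAt_le (X : Finset (Fin n × Fin m)) (e : Fin m) : (edgesAt X e).card ≤ n := by
  rw [card_edgesAt]
  exact (Finset.card_le_univ _).trans (by simp)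

/-- Some `r` sets cover as many elements of `F` as `r` random sets do on average. -/
theorem exists_card_le_sum_le_card_cover (hn : 1 ≤ n) (X : Finset (Fin n × Fin m))
    (F : Finset (Fin m)) (r : ℕ) :
    ∃ P : Finset (Fin n), P.card ≤ r ∧
      ∑ e ∈ F, (1 - (1 - ((edgesAt X e).card : ℝ) / n) ^ r) ≤ ((coverNbrs X P ∩ F).card : ℝ) := by
  have hn0 : (0 : ℝ) < n := by exact_mod_cast hn
  -- The random sets are tuples drawn with replacement: an element of degree `d` is missed by `(n -
  -- d)^r` of the `n^r` tuples. Some tuple then does at least as well as the average.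
  have hcount : ∀ e, ((Finset.univ.filter fun f : Fin r → Fin n =>
      e ∈ coverNbrs X (Finset.univ.image f)).card : ℝ) =
      n ^ r * (1 - (1 - ((edgesAt X e).card : ℝ) / n) ^ r) := by
    intro e
    have h1 : (Finset.univ.filter fun f : Fin r → Fin n =>
        ¬ e ∈ coverNbrs X (Finset.univ.image f)) =
        Fintype.piFinset fun _ : Fin r => (Finset.univ.filter fun S => (S, e) ∈ X)ᶜ := by
      ext f
      simp [mem_coverNbrs, Fintype.mem_piFinset]
    have h2 := Finset.card_filter_add_card_filter_not (s := Finset.univ)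
      fun f : Fin r → Fin n => e ∈ coverNbrs X (Finset.univ.image f)
    rw [h1, Fintype.card_piFinset_const, Finset.card_compl, ← card_edgesAt] at h2
    simp only [Finset.card_univ, Fintype.card_fin, Fintype.card_fun] at h2
    have h3 : (((Finset.univ.filter fun f : Fin r → Fin n =>
      e ∈ coverNbrs X (Finset.univ.image f)).card : ℝ)) +
        (n - (edgesAt X e).card : ℝ) ^ r = n ^ r := by
      have := congrArg (Nat.cast (R := ℝ)) h2
      push_cast [Nat.cast_sub (card_edgesAt_le X e)] at this
      exact this
    have h4 : (n - (edgesAt X e).card : ℝ) ^ r =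
        n ^ r * (1 - ((edgesAt X e).card : ℝ) / n) ^ r := by
      rw [← mul_pow]; congr 1; field_simp
    linarith
  have hne : (Finset.univ : Finset (Fin r → Fin n)).Nonempty :=
    ⟨fun _ => ⟨0, hn⟩, Finset.mem_univ _⟩
  obtain ⟨f, -, hf⟩ := Finset.exists_le_of_sum_le (s := Finset.univ)
    (f := fun _ : Fin r → Fin n => ∑ e ∈ F, (1 - (1 - ((edgesAt X e).card : ℝ) / n) ^ r))
    (g := fun f => ((coverNbrs X (Finset.univ.image f) ∩ F).card : ℝ)) hne (by
      have : ∀ f : Fin r → Fin n, ((coverNbrs X (Finset.univ.image f) ∩ F).card : ℝ) =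
          ∑ e ∈ F, if e ∈ coverNbrs X (Finset.univ.image f) then (1 : ℝ) else 0 := by
        intro f
        rw [Finset.inter_comm, ← Finset.filter_mem_eq_inter, Finset.sum_boole]
      simp_rw [this]
      rw [Finset.sum_const, Finset.card_univ, Fintype.card_fun, Fintype.card_fin,
        Fintype.card_fin, nsmul_eq_mul, Finset.mul_sum, Finset.sum_comm]
      refine Finset.sum_le_sum fun e _ => ?_
      rw [Finset.sum_boole, hcount]
      push_cast
      exact le_rfl)
  exact ⟨Finset.univ.image f, Finset.card_image_le.trans (by simp), hf⟩

/-- Each covered element is charged to one set `φ e` of `P` containing it. Removing `S` uncovers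
only elements charged to `S`, and on average over the `j + 1` sets this is a fraction `1/(j + 1)`.
-/
theorem exists_erase_cover (X : Finset (Fin n × Fin m)) (F : Finset (Fin m))
    (P : Finset (Fin n)) {j : ℕ} (hP : P.card = j + 1) :
    ∃ S ∈ P, j * (coverNbrs X P ∩ F).card ≤ (j + 1) * (coverNbrs X (P.erase S) ∩ F).card := by
  classical
  have hch : ∀ e ∈ coverNbrs X P ∩ F, ∃ S ∈ P, (S, e) ∈ X := fun e he =>
    mem_coverNbrs.1 (Finset.mem_inter.1 he).1
  have hne : P.Nonempty := Finset.card_pos.1 (by omega)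
  have : Nonempty (Fin n) := ⟨hne.choose⟩
  choose! φ hφ using hch
  set A := coverNbrs X P ∩ F
  obtain ⟨S, hS, h⟩ := Finset.exists_le_of_sum_le (s := P) (f := fun _ => j * A.card)
    (g := fun S => (j + 1) * (A.filter fun e => φ e ≠ S).card) hne (by
      rw [Finset.sum_const, hP, smul_eq_mul, ← Finset.mul_sum]
      refine Nat.mul_le_mul_left _ ?_
      simp_rw [Finset.card_filter]
      rw [Finset.sum_comm]
      have : ∀ e ∈ A, (∑ S ∈ P, if φ e ≠ S then 1 else 0) = j := by
        intro e he
        rw [← Finset.card_filter, Finset.filter_ne, Finset.card_erase_of_mem (hφ e he).1, hP]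
        rfl
      rw [Finset.sum_congr rfl this, Finset.sum_const, smul_eq_mul, mul_comm])
  refine ⟨S, hS, h.trans (Nat.mul_le_mul_left _ (Finset.card_le_card fun e he => ?_))⟩
  rw [Finset.mem_filter] at he
  have he2 := hφ e he.1
  exact Finset.mem_inter.2 ⟨mem_coverNbrs.2 ⟨φ e, Finset.mem_erase.2 ⟨he.2, he2.1⟩, he2.2⟩,
    (Finset.mem_inter.1 he.1).2⟩

/-- Some `k - r` of `k` sets cover a proportional part of what the `k` sets cover. -/
theorem exists_subset_cover (X : Finset (Fin n × Fin m)) (F : Finset (Fin m))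
    (P : Finset (Fin n)) : ∀ r ≤ P.card, ∃ Q ⊆ P, Q.card = P.card - r ∧
      (P.card - r) * (coverNbrs X P ∩ F).card ≤ P.card * (coverNbrs X Q ∩ F).card := by
  intro r
  induction r with
  | zero => exact fun _ => ⟨P, subset_rfl, by simp, by simp⟩
  | succ r ih =>
    intro hr
    obtain ⟨Q, hQP, hQ, h⟩ := ih (by omega)
    obtain ⟨j, hj⟩ : ∃ j, P.card - r = j + 1 := ⟨P.card - r - 1, by omega⟩
    obtain ⟨S, hS, h2⟩ := exists_erase_cover X F Q (hQ.trans hj)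
    refine ⟨Q.erase S, (Finset.erase_subset _ _).trans hQP, ?_, ?_⟩
    · rw [Finset.card_erase_of_mem hS]; omega
    · have e1 : P.card - (r + 1) = j := by omega
      rw [e1]
      rw [hj] at h
      -- The retained fractions `j/(j + 1)` telescope; the common factor `j + 1` is cancelled here.
      refine Nat.le_of_mul_le_mul_left ?_ (Nat.succ_pos j)
      calc (j + 1) * (j * (coverNbrs X P ∩ F).card)
          = j * ((j + 1) * (coverNbrs X P ∩ F).card) := by ring
        _ ≤ j * (P.card * (coverNbrs X Q ∩ F).card) := Nat.mul_le_mul_left _ h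
        _ = P.card * (j * (coverNbrs X Q ∩ F).card) := by ring
        _ ≤ P.card * ((j + 1) * (coverNbrs X (Q.erase S) ∩ F).card) := Nat.mul_le_mul_left _ h2
        _ = _ := by rw [Nat.succ_eq_add_one]; ring

theorem card_coverNbrs_le_optCover {k : ℕ} (hk : k ≤ n) (X : Finset (Fin n × Fin m))
    {P : Finset (Fin n)} (hP : P.card ≤ k) : (coverNbrs X P).card ≤ optCover k X := by
  obtain ⟨Q, hPQ, -, hQ⟩ := Finset.exists_subsuperset_card_eq (Finset.subset_univ P) hP (by simpa)
  refine (Finset.card_le_card (coverNbrs_mono subset_rfl hPQ)).trans ?_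
  exact Finset.le_sup (f := fun P => (coverNbrs X P).card)
    (Finset.mem_powersetCard.2 ⟨Finset.subset_univ _, hQ⟩)

theorem exists_card_coverNbrs_eq_optCover {k : ℕ} (hk : k ≤ n) (X : Finset (Fin n × Fin m)) :
    ∃ P : Finset (Fin n), P.card = k ∧ (coverNbrs X P).card = optCover k X := by
  obtain ⟨P, hP, h⟩ := Finset.exists_mem_eq_sup ((Finset.univ : Finset (Fin n)).powersetCard k)
    (Finset.powersetCard_nonempty.2 (by simpa)) fun P => (coverNbrs X P).card
  exact ⟨P, (Finset.mem_powersetCard.1 hP).2, h.symm⟩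

/-- The number of elements, each weighted with its degree up to `n / k`, is at most twice the
optimal value. -/
theorem sum_min_degree_le_optCover {k : ℕ} (hk : 1 ≤ k) (hkn : k ≤ n)
    (X : Finset (Fin n × Fin m)) :
    ∑ e, min 1 (((edgesAt X e).card : ℝ) * k / n) ≤ 2 * optCover k X := by
  obtain ⟨P, hP, h⟩ := exists_card_le_sum_le_card_cover (hk.trans hkn) X Finset.univ k
  have hn0 : (0 : ℝ) < n := by exact_mod_cast hk.trans hkn
  have h1 : ((coverNbrs X P ∩ Finset.univ).card : ℝ) ≤ optCover k X := by
    rw [Finset.inter_univ]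
    exact_mod_cast card_coverNbrs_le_optCover hkn X hP
  -- With `x = d/n` and `y = kx`: `1 - (1 - x)^k ≥ 1 - e^{-y} ≥ y/(1 + y) ≥ min(1, y)/2`.
  have h2 : ∀ e, min 1 (((edgesAt X e).card : ℝ) * k / n) ≤
      2 * (1 - (1 - ((edgesAt X e).card : ℝ) / n) ^ k) := by
    intro e
    set x : ℝ := ((edgesAt X e).card : ℝ) / n with hx
    have hx0 : 0 ≤ x := by positivity
    have hx1 : x ≤ 1 := (div_le_one hn0).2 (by exact_mod_cast card_edgesAt_le X e)
    have e1 : ((edgesAt X e).card : ℝ) * k / n = k * x := by rw [hx]; ring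
    rw [e1]
    set y : ℝ := k * x with hy
    have hy0 : 0 ≤ y := by positivity
    have h3 : (1 - x) ^ k ≤ Real.exp (-y) := by
      rw [hy, ← mul_neg, Real.exp_nat_mul]
      exact pow_le_pow_left₀ (by linarith) (by linarith [Real.add_one_le_exp (-x)]) k
    have h4 : Real.exp (-y) ≤ 1 / (1 + y) := by
      rw [Real.exp_neg, inv_eq_one_div]
      exact one_div_le_one_div_of_le (by linarith) (by linarith [Real.add_one_le_exp y])
    have h5 : min 1 y ≤ 2 * (1 - 1 / (1 + y)) := by
      have : 1 - 1 / (1 + y) = y / (1 + y) := by field_simp; ring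
      rw [this, mul_div_assoc', le_div_iff₀ (by linarith)]
      rcases le_total 1 y with h | h
      · rw [min_eq_left h]; linarith
      · rw [min_eq_right h]; nlinarith
    linarith
  calc _ ≤ ∑ e, 2 * (1 - (1 - ((edgesAt X e).card : ℝ) / n) ^ k) :=
        Finset.sum_le_sum fun e _ => h2 e
    _ = 2 * ∑ e, (1 - (1 - ((edgesAt X e).card : ℝ) / n) ^ k) := by rw [Finset.mul_sum]
    _ ≤ _ := by linarith

/-- Bounding the degrees reduces the optimal value only slightly. -/
theorem le_optCover_of_degree_bound {k : ℕ} (hk : 1 ≤ k) (hkn : k ≤ n) {ε : ℝ} (h0 : 0 < ε)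
    (h1 : ε ≤ 1 / 3) {G H : Finset (Fin n × Fin m)} (hHG : H ⊆ G)
    (hdeg : ∀ e, edgesAt H e = edgesAt G e ∨
      ((bucketThreshold n k ε < (edgesAt G e).card) ∧
        (edgesAt H e).card = ⌊bucketThreshold n k ε⌋₊))
    {P : Finset (Fin n)} (hP : P.card = k) :
    (1 - 3 * ε) * (coverNbrs G P).card ≤ optCover k H := by
  classical
  have hn0 : (0 : ℝ) < n := by exact_mod_cast hk.trans hkn
  have hk0 : (0 : ℝ) < k := by exact_mod_cast hk
  have hexp : Real.exp 1 < 3 := Real.exp_one_lt_d9.trans (by norm_num)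
  have hlog : 1 ≤ Real.log (1 / ε) := by
    rw [Real.le_log_iff_exp_le (by positivity)]
    refine hexp.le.trans ?_
    rw [le_div_iff₀ h0]; linarith
  have hT : ((bucketThreshold n k ε : ℝ≥0) : ℝ) = n * Real.log (1 / ε) / (ε * k) := by
    rw [bucketThreshold, Real.coe_toNNReal]
    positivity
  set T := bucketThreshold n k ε
  -- If `ε k < 1`, then `T ≥ n` because `log(1/ε) ≥ 1`, and nothing is truncated.
  rcases lt_or_ge (ε * k) 1 with hs | hs
  · have hH : ∀ e, edgesAt H e = edgesAt G e := by
      intro e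
      refine (hdeg e).resolve_right fun h => ?_
      have h2 : (T : ℝ) < ((edgesAt G e).card : ℝ) := by exact_mod_cast h.1
      have h3 : ((edgesAt G e).card : ℝ) ≤ n := by exact_mod_cast card_edgesAt_le G e
      have h4 : (n : ℝ) ≤ T := by
        rw [hT, le_div_iff₀ (by positivity)]
        nlinarith
      linarith
    have hHG2 : H = G := by
      refine hHG.antisymm fun x hx => ?_
      have : x ∈ edgesAt H x.2 := by rw [hH]; simp [edgesAt, hx]
      exact (Finset.mem_filter.1 this).1
    have h2 : ((coverNbrs G P).card : ℝ) ≤ optCover k H := by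
      rw [hHG2]
      exact_mod_cast card_coverNbrs_le_optCover hkn G hP.le
    have h3 : (0 : ℝ) ≤ (coverNbrs G P).card := by positivity
    nlinarith
  -- Otherwise `r` of the `k` sets are exchanged for `r` random ones. As `ε k ≥ 1`, rounding up
  -- gives `r ≤ 2 ε k`. `L` collects the covered elements with intact degree, `B` those that were
  -- truncated.
  · set r := ⌈ε * k⌉₊ with hr
    have hr1 : ε * k ≤ r := Nat.le_ceil _
    have hr2 : (r : ℝ) ≤ 2 * (ε * k) := by
      have := Nat.ceil_lt_add_one (a := ε * k) (by positivity)
      linarith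
    have hrk : r ≤ k := by
      have : (r : ℝ) ≤ k := by nlinarith
      exact_mod_cast this
    set L := (coverNbrs G P).filter fun e => edgesAt H e = edgesAt G e with hL
    set B := (coverNbrs G P).filter fun e => ¬ edgesAt H e = edgesAt G e with hB
    obtain ⟨Q, hQP, hQ, hQL⟩ := exists_subset_cover G L P r (hP ▸ hrk)
    obtain ⟨R, hR, hRB⟩ := exists_card_le_sum_le_card_cover (hk.trans hkn) H B r
    have hLP : coverNbrs G P ∩ L = L := Finset.inter_eq_right.2 (Finset.filter_subset _ _)
    rw [hLP, hP] at hQL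
    have hlow : (1 - 2 * ε) * (L.card : ℝ) ≤ ((coverNbrs G Q ∩ L).card : ℝ) := by
      have h2 : ((k : ℝ) - r) * L.card ≤ k * (coverNbrs G Q ∩ L).card := by
        rw [← Nat.cast_sub hrk]
        exact_mod_cast hQL
      have h3 : (k : ℝ) * ((1 - 2 * ε) * L.card) ≤ k * (coverNbrs G Q ∩ L).card := by
        refine le_trans ?_ h2
        have : (0 : ℝ) ≤ L.card := by positivity
        nlinarith
      exact le_of_mul_le_mul_left h3 hk0
    have hhigh : (1 - 3 * ε) * (B.card : ℝ) ≤ ((coverNbrs H R ∩ B).card : ℝ) := by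
      refine le_trans ?_ hRB
      rw [mul_comm, ← nsmul_eq_mul, ← Finset.sum_const]
      refine Finset.sum_le_sum fun e he => ?_
      have hd := ((hdeg e).resolve_left (Finset.mem_filter.1 he).2).2
      rw [hd]
      have hfl : (T : ℝ) - 1 ≤ (⌊T⌋₊ : ℝ) := by
        have : (T : ℝ) < (⌊T⌋₊ : ℝ) + 1 := by exact_mod_cast Nat.lt_floor_add_one T
        linarith
      have hle : (⌊T⌋₊ : ℝ) ≤ n := by
        rw [← hd]; exact_mod_cast card_edgesAt_le H e
      have h2 : (1 - (⌊T⌋₊ : ℝ) / n) ^ r ≤ 3 * ε := by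
        calc (1 - (⌊T⌋₊ : ℝ) / n) ^ r ≤ (Real.exp (-((⌊T⌋₊ : ℝ) / n))) ^ r := by
              refine pow_le_pow_left₀ ?_ ?_ r
              · rw [sub_nonneg, div_le_one hn0]; exact hle
              · linarith [Real.add_one_le_exp (-((⌊T⌋₊ : ℝ) / n))]
          _ = Real.exp (-(r * ⌊T⌋₊ / n)) := by
              rw [← Real.exp_nat_mul]; congr 1; ring
          -- The summand `1` pays for the floor: `r(T - 1)/n ≥ log(1/ε) - r/n` and `r ≤ n`. This
          -- yields the factor `e < 3`.
          _ ≤ Real.exp (1 + Real.log ε) := by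
              refine Real.exp_le_exp.2 ?_
              have h3 : (r : ℝ) * (T - 1) / n ≤ r * ⌊T⌋₊ / n := by gcongr
              have h4 : Real.log (1 / ε) ≤ r * T / n := by
                rw [hT, le_div_iff₀ hn0]
                have : (r : ℝ) * (n * Real.log (1 / ε) / (ε * k)) =
                  (r / (ε * k)) * (Real.log (1 / ε) * n) := by field_simp
                rw [this]
                have h5 : 1 ≤ (r : ℝ) / (ε * k) := (one_le_div (by positivity)).2 hr1
                have h6 : 0 ≤ Real.log (1 / ε) * n := by positivity
                nlinarith
              have h5 : (r : ℝ) / n ≤ 1 :=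
                (div_le_one hn0).2 (by exact_mod_cast hrk.trans hkn)
              have h6 : Real.log (1 / ε) = - Real.log ε := by rw [one_div, Real.log_inv]
              have h7 : (r : ℝ) * (T - 1) / n = r * T / n - r / n := by ring
              linarith
          _ = Real.exp 1 * ε := by rw [Real.exp_add, Real.exp_log h0]
          _ ≤ _ := by nlinarith
      linarith
    have hsub : (coverNbrs G Q ∩ L) ∪ (coverNbrs H R ∩ B) ⊆ coverNbrs H (Q ∪ R) := by
      intro e he
      rcases Finset.mem_union.1 he with he | he
      · obtain ⟨h2, h3⟩ := Finset.mem_inter.1 he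
        obtain ⟨S, hS, hX⟩ := mem_coverNbrs.1 h2
        have h4 : (S, e) ∈ edgesAt H e := by
          rw [(Finset.mem_filter.1 h3).2]; simp [edgesAt, hX]
        exact mem_coverNbrs.2 ⟨S, Finset.mem_union_left _ hS, (Finset.mem_filter.1 h4).1⟩
      · exact coverNbrs_mono subset_rfl Finset.subset_union_right (Finset.mem_inter.1 he).1
    have hdisj : Disjoint (coverNbrs G Q ∩ L) (coverNbrs H R ∩ B) :=
      Finset.disjoint_of_subset_left Finset.inter_subset_right
        (Finset.disjoint_of_subset_right Finset.inter_subset_right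
          (Finset.disjoint_filter_filter_not _ _ _))
    have hcard : (Q ∪ R).card ≤ k := by
      refine (Finset.card_union_le _ _).trans ?_
      rw [hQ, hP]; omega
    have h2 : ((coverNbrs G Q ∩ L).card : ℝ) + (coverNbrs H R ∩ B).card ≤ optCover k H := by
      rw [← Nat.cast_add, ← Finset.card_union_of_disjoint hdisj]
      exact_mod_cast (Finset.card_le_card hsub).trans (card_coverNbrs_le_optCover hkn H hcard)
    have h3 : ((coverNbrs G P).card : ℝ) = L.card + B.card := by
      rw [← Nat.cast_add, hL, hB, Finset.card_filter_add_card_filter_not]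
    rw [h3]
    have h4 : (0 : ℝ) ≤ L.card := by positivity
    nlinarith

end Cover

/-! ### The sketch for `k`-cover and subsampled graphs -/

section KCoverSketch

variable {n m : ℕ} (ħ : Fin m → unitInterval) (p : ℝ) (T : ℝ≥0)

theorem kCoverSketch_items (X : Finset (Fin n × Fin m)) (e : Fin m) :
    (kCoverSketch ħ p T 0).items X e = if (ħ e : ℝ) ≤ p then edgesAt X e else ∅ := by
  ext x
  simp only [SubSketch.items, kCoverSketch, edgesAt]
  split_ifs with h
  · simp only [Finset.mem_filter, decide_eq_true_eq]
    constructor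
    · exact fun hx => ⟨hx.1, hx.2.2⟩
    · rintro ⟨hx, rfl⟩
      exact ⟨hx, h, rfl⟩
  · simp only [Finset.mem_filter, decide_eq_true_eq, Finset.notMem_empty, iff_false]
    rintro ⟨-, hx, rfl⟩
    exact h hx

theorem kCoverSketch_space (Y : Finset (Fin n × Fin m)) :
    (kCoverSketch ħ p T 0).space Y = Y.card := by
  simp [SubSketch.space, kCoverSketch]

theorem mem_image_diag {α : Type*} [DecidableEq α] {H : Finset α} {x y : α} :
    (x, y) ∈ H.image (fun x => (x, x)) ↔ x ∈ H ∧ y = x := by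
  simp only [Finset.mem_image, Prod.mk.injEq]
  constructor
  · rintro ⟨a, ha, rfl, rfl⟩
    exact ⟨ha, rfl⟩
  · rintro ⟨h, rfl⟩
    exact ⟨y, h, rfl, rfl⟩

/-- With unit sizes, the condition on an overfull bucket reads `|Y| ≤ T < |Y| + 1`, that is `|Y| =
⌊T⌋`. Conversely, a set of `⌊T⌋` edges leaves out some edge of a bucket with more than `T`. -/
theorem kCoverSketch_isOutput_iff (X : Finset (Fin n × Fin m))
    (Y : Fin 1 → Finset ((Fin n × Fin m) × (Fin n × Fin m))) :
    (kCoverSketch ħ p T).IsOutput X Y ↔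
      ∃ H, IsSubsampledGraph ħ p T X H ∧ Y = fun _ => H.image fun x => (x, x) := by
  have hthr : (kCoverSketch (n := n) ħ p T 0).threshold = T := rfl
  have hproc : ∀ x, (kCoverSketch (n := n) ħ p T 0).process x = x := fun _ => rfl
  have hsize : ∀ x, (kCoverSketch (n := n) ħ p T 0).size x = 1 := fun _ => rfl
  have hfil : ∀ x, (kCoverSketch (n := n) ħ p T 0).filter x = true ↔ (ħ x.2 : ℝ) ≤ p :=
    fun x => by simp [kCoverSketch]
  have hout : (kCoverSketch ħ p T).IsOutput X Y ↔ (kCoverSketch ħ p T 0).IsOutput X (Y 0) := by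
    constructor
    · exact fun h => h 0
    · intro h i
      rw [Subsingleton.elim i 0]
      exact h
  rw [hout]
  simp only [SubSketch.IsOutput, kCoverSketch_items, kCoverSketch_space, hthr, hproc, hsize, hfil]
  constructor
  · rintro ⟨h1, h2⟩
    have hYH : ∀ x, (x, x) ∈ Y 0 → x ∈ X ∧ (ħ x.2 : ℝ) ≤ p := fun x hx =>
      ⟨(h1 _ hx).1, (h1 _ hx).2.1⟩
    refine ⟨X.filter fun x => (x, x) ∈ Y 0, ⟨Finset.filter_subset _ _, fun e => ?_⟩, ?_⟩
    · have hedge : edgesAt (X.filter fun x => (x, x) ∈ Y 0) e =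
          (edgesAt X e).filter fun x => (x, x) ∈ Y 0 := Finset.filter_comm _ _ _
      have h3 := h2 e
      rw [hedge]
      split_ifs with hp hc
      · rw [if_pos hp, if_pos hc] at h3
        exact Finset.filter_true_of_mem h3
      · rw [if_pos hp, if_neg hc] at h3
        obtain ⟨h4, x', -, -, h5⟩ := h3
        refine ((Nat.floor_eq_iff (zero_le)).2 ⟨h4, ?_⟩).symm
        rwa [add_comm] at h5
      · refine Finset.filter_false_of_mem fun x hx hxY => hp ?_
        have := (hYH x hxY).2
        rwa [(Finset.mem_filter.1 hx).2] at this
    · funext i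
      rw [Subsingleton.elim i 0]
      ext ⟨x, y⟩
      rw [mem_image_diag, Finset.mem_filter]
      constructor
      · intro h
        have := h1 _ h
        simp only at this
        obtain ⟨h3, h4, rfl⟩ := this
        exact ⟨⟨h3, h⟩, rfl⟩
      · rintro ⟨⟨-, h⟩, rfl⟩
        exact h
  · rintro ⟨H, ⟨hHX, hH⟩, rfl⟩
    have hHp : ∀ x ∈ H, (ħ x.2 : ℝ) ≤ p := by
      intro x hx
      by_contra hp
      have h3 := hH x.2
      rw [if_neg hp] at h3
      have : x ∈ edgesAt H x.2 := by simp [edgesAt, hx]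
      rw [h3] at this
      simp at this
    refine ⟨?_, fun e => ?_⟩
    · rintro ⟨x, y⟩ h
      obtain ⟨h3, rfl⟩ := mem_image_diag.1 h
      exact ⟨hHX h3, hHp _ h3, rfl⟩
    · have h3 := hH e
      have hfilt : ((edgesAt X e).filter fun x => (x, x) ∈ H.image fun x => (x, x)) =
          edgesAt H e := by
        ext x
        simp only [Finset.mem_filter, mem_image_diag, edgesAt]
        constructor
        · exact fun h => ⟨h.2.1, h.1.2⟩
        · exact fun h => ⟨⟨hHX h.1, h.2⟩, h.1, trivial⟩
      split_ifs with hp hc hc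
      · rw [if_pos hp, if_pos hc] at h3
        intro x hx
        rw [← h3] at hx
        exact mem_image_diag.2 ⟨(Finset.mem_filter.1 hx).1, rfl⟩
      · rw [if_pos hp, if_neg hc] at h3
        rw [hfilt, h3]
        refine ⟨Nat.floor_le zero_le, ?_⟩
        have hlt : (edgesAt H e).card < (edgesAt X e).card := by
          rw [h3]
          have h4 : ((⌊T⌋₊ : ℕ) : ℝ≥0) < (edgesAt X e).card :=
            (Nat.floor_le zero_le).trans_lt (not_le.1 hc)
          exact_mod_cast h4
        obtain ⟨x', hx', hxn⟩ := Finset.exists_mem_notMem_of_card_lt_card hlt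
        refine ⟨x', hx', fun h => hxn ?_, ?_⟩
        · exact Finset.mem_filter.2 ⟨(mem_image_diag.1 h).1, (Finset.mem_filter.1 hx').2⟩
        · rw [add_comm]
          exact Nat.lt_floor_add_one T
      · simp
      · simp at hc

/-- Elements without edges contribute zero, so the budget is a weighted sum of sampling indicators,
as the tail bound requires. -/
theorem kCoverSketch_spaceBudget (X : Finset (Fin n × Fin m)) :
    ((kCoverSketch ħ p T).spaceBudget X : ℝ) =
      ∑ e, min (T : ℝ) (edgesAt X e).card * (if (ħ e : ℝ) ≤ p then 1 else 0) := by
  rw [BucketingSketch.spaceBudget, Fin.sum_univ_one, SubSketch.budget]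
  have hb : (kCoverSketch (n := n) ħ p T 0).bucket = Prod.snd := rfl
  have hthr : (kCoverSketch (n := n) ħ p T 0).threshold = T := rfl
  simp only [hb, hthr, kCoverSketch_items, kCoverSketch_space]
  push_cast
  rw [← Finset.sum_subset (Finset.subset_univ (X.image Prod.snd))]
  · refine Finset.sum_congr rfl fun e _ => ?_
    split_ifs <;> simp
  · intro e _ he
    have : edgesAt X e = ∅ := by
      refine Finset.filter_false_of_mem fun x hx hxe => he ?_
      exact Finset.mem_image.2 ⟨x, hx, hxe⟩
    simp [this]

/-- The edges at the elements with hash value at most `p`. -/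
def sampledGraph (X : Finset (Fin n × Fin m)) : Finset (Fin n × Fin m) :=
  X.filter fun x => (ħ x.2 : ℝ) ≤ p

variable {ħ p T}

theorem IsSubsampledGraph.subset_sampledGraph {X H : Finset (Fin n × Fin m)}
    (h : IsSubsampledGraph ħ p T X H) : H ⊆ sampledGraph ħ p X := by
  intro x hx
  refine Finset.mem_filter.2 ⟨h.1 hx, ?_⟩
  by_contra hp
  have h3 := h.2 x.2
  rw [if_neg hp] at h3
  have : x ∈ edgesAt H x.2 := by simp [edgesAt, hx]
  rw [h3] at this
  simp at this

/-- The form needed by `le_optCover_of_degree_bound`: relative to the sampled graph, only truncation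
remains. -/
theorem IsSubsampledGraph.edgesAt_eq_or {X H : Finset (Fin n × Fin m)}
    (h : IsSubsampledGraph ħ p T X H) (e : Fin m) :
    edgesAt H e = edgesAt (sampledGraph ħ p X) e ∨
      (T < (edgesAt (sampledGraph ħ p X) e).card ∧ (edgesAt H e).card = ⌊T⌋₊) := by
  have h3 := h.2 e
  have hs : edgesAt (sampledGraph ħ p X) e = if (ħ e : ℝ) ≤ p then edgesAt X e else ∅ := by
    ext x
    split_ifs with hp <;> simp only [edgesAt, sampledGraph, Finset.mem_filter]
    · constructor
      · exact fun h => ⟨h.1.1, h.2⟩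
      · rintro ⟨h, rfl⟩
        exact ⟨⟨h, hp⟩, rfl⟩
    · simp only [Finset.notMem_empty, iff_false]
      rintro ⟨⟨-, h⟩, rfl⟩
      exact hp h
  rw [hs]
  split_ifs at h3 ⊢ with hp hc
  · exact Or.inl h3
  · exact Or.inr ⟨not_le.1 hc, h3⟩
  · exact Or.inl h3

theorem coverNbrs_sampledGraph (X : Finset (Fin n × Fin m)) (P : Finset (Fin n)) :
    coverNbrs (sampledGraph ħ p X) P = (coverNbrs X P).filter fun e => (ħ e : ℝ) ≤ p := by
  ext e
  simp only [mem_coverNbrs, sampledGraph, Finset.mem_filter]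
  constructor
  · rintro ⟨S, hS, h1, h2⟩
    exact ⟨⟨S, hS, h1⟩, h2⟩
  · rintro ⟨⟨S, hS, h1⟩, h2⟩
    exact ⟨S, hS, h1, h2⟩

end KCoverSketch

/-! ### Reasoning about programs -/

/-- Started in `s`, the program `P` halts after a number of steps and in a state that satisfy
`Q`. -/
def RamProg.Achieves (P : RamProg) (s : RamState) (Q : ℕ → RamState → Prop) : Prop :=
  ∃ c s', RamRun P s c s' ∧ Q c s'

namespace RamProg

variable {P R : RamProg} {s : RamState} {Q Q' : ℕ → RamState → Prop}

theorem Achieves.mono (h : P.Achieves s Q) (hQ : ∀ c s', Q c s' → Q' c s') : P.Achieves s Q' := by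
  obtain ⟨c, s', hr, hq⟩ := h
  exact ⟨c, s', hr, hQ _ _ hq⟩

theorem achieves_skip (h : Q 0 s) : RamProg.skip.Achieves s Q := ⟨_, _, .skip s, h⟩

theorem achieves_setWord {a : ℕ} {i v : WordExp}
    (h : Q 1 (s.setWord a (i.eval s) (v.eval s))) : (RamProg.setWord a i v).Achieves s Q :=
  ⟨_, _, .setWord a i v s, h⟩

theorem achieves_setWord_of {a : ℕ} {i v : WordExp} {I V : ℕ} (hi : i.eval s = I)
    (hv : v.eval s = V) (h : Q 1 (s.setWord a I V)) : (RamProg.setWord a i v).Achieves s Q :=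
  achieves_setWord (by rwa [hi, hv])

theorem achieves_setReal {a : ℕ} {i : WordExp} {v : RealExp}
    (h : Q 1 (s.setReal a (i.eval s) (v.eval s))) : (RamProg.setReal a i v).Achieves s Q :=
  ⟨_, _, .setReal a i v s, h⟩

theorem achieves_seq (h : P.Achieves s fun c s' => R.Achieves s' fun d s'' => Q (c + d) s'') :
    (RamProg.seq P R).Achieves s Q := by
  obtain ⟨c, s', h1, d, s'', h2, h3⟩ := h
  exact ⟨_, _, .seq h1 h2, h3⟩

theorem achieves_ite {b : RamTest} (h1 : b.Holds s → P.Achieves s fun c s' => Q (1 + c) s')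
    (h2 : ¬ b.Holds s → R.Achieves s fun c s' => Q (1 + c) s') :
    (RamProg.ite b P R).Achieves s Q := by
  by_cases hb : b.Holds s
  · obtain ⟨c, s', h3, h4⟩ := h1 hb
    exact ⟨_, _, .iteTrue hb h3, h4⟩
  · obtain ⟨c, s', h3, h4⟩ := h2 hb
    exact ⟨_, _, .iteFalse hb h3, h4⟩

/-- The amortized rule for loops: `J s φ` is the invariant with `φ` steps left. -/
theorem achieves_while {b : RamTest} (J : RamState → ℕ → Prop)
    (h : ∀ s φ, J s φ → b.Holds s → P.Achieves s fun c s' => ∃ φ', J s' φ' ∧ 1 + c + φ' ≤ φ) :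
    ∀ φ s, J s φ → (RamProg.while b P).Achieves s fun c s' =>
      ∃ φ', J s' φ' ∧ ¬ b.Holds s' ∧ c + φ' ≤ φ + 1 := by
  intro φ
  induction φ using Nat.strong_induction_on with
  | _ φ ih =>
    intro s hJ
    by_cases hb : b.Holds s
    · obtain ⟨c, s', hr, φ', hJ', hc⟩ := h s φ hJ hb
      obtain ⟨d, s'', hr', φ'', hJ'', hb'', hd⟩ := ih φ' (by omega) s' hJ'
      exact ⟨_, _, .whileTrue hb hr hr', φ'', hJ'', hb'', by omega⟩
    -- The failing test is the extra step in `φ + 1`.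
    · exact ⟨_, _, .whileFalse hb, φ, hJ, hb, by omega⟩

end RamProg

namespace RamState

theorem word_setWord (s : RamState) (a i v b : ℕ) :
    (s.setWord a i v).word b = if b = a then Function.update (s.word a) i v else s.word b := by
  by_cases h : b = a
  · subst h; simp [setWord]
  · simp [setWord, h]

theorem word_setWord_self (s : RamState) (a i v : ℕ) : (s.setWord a i v).word a i = v := by
  simp [setWord]

theorem word_setWord_of_ne (s : RamState) {a b : ℕ} (i v : ℕ) (h : b ≠ a) :
    (s.setWord a i v).word b = s.word b := by
  simp [setWord, h]

theorem real_setWord (s : RamState) (a i v : ℕ) : (s.setWord a i v).real = s.real := rfl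

theorem word_setReal (s : RamState) (a i : ℕ) (v : ℝ) : (s.setReal a i v).word = s.word := rfl

theorem real_setReal (s : RamState) (a i : ℕ) (v : ℝ) (b : ℕ) :
    (s.setReal a i v).real b = if b = a then Function.update (s.real a) i v else s.real b := by
  by_cases h : b = a
  · subst h; simp [setReal]
  · simp [setReal, h]

/-- The states differ at most in the word arrays `A`. -/
def SameExcept (A : List ℕ) (s s' : RamState) : Prop :=
  (∀ a, a ∉ A → s'.word a = s.word a) ∧ s'.real = s.real

theorem SameExcept.refl (A : List ℕ) (s : RamState) : SameExcept A s s := ⟨fun _ _ => rfl, rfl⟩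

theorem SameExcept.setWord {A : List ℕ} {s s' : RamState} (h : SameExcept A s s') {a : ℕ}
    (ha : a ∈ A) (i v : ℕ) : SameExcept A s (s'.setWord a i v) := by
  refine ⟨fun b hb => ?_, h.2⟩
  have : b ≠ a := fun h => hb (h ▸ ha)
  rw [word_setWord, if_neg this, h.1 b hb]

theorem SameExcept.trans {A B : List ℕ} {s s' s'' : RamState} (h : SameExcept A s s')
    (h' : SameExcept B s' s'') (hBA : B ⊆ A) : SameExcept A s s'' :=
  ⟨fun a ha => (h'.1 a fun hb => ha (hBA hb)).trans (h.1 a ha), h'.2.trans h.2⟩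

end RamState

/-- The word in position `0` of the array `a`. -/
abbrev WordExp.var (a : ℕ) : WordExp := .get a (.lit 0)

/-! ### The program for the filter, bucketing and processing functions -/

/-- One step of Horner's rule. -/
def hornerStep : RamProg :=
  .seq (.setWord 2 (.lit 0) (.sub (.var 2) (.lit 1)))
    (.setReal 2 (.lit 0) (.add (.mul (.get 2 (.lit 0)) (.ofWord (.get 0 (.lit 1))))
      (.get 1 (.var 2))))

def edgeProgram : RamProg :=
  .seq (.setWord 2 (.lit 0) (.get 0 (.lit 2)))
  (.seq (.while (.wordLe (.lit 1) (.var 2)) hornerStep)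
  (.seq (.ite (.realLe (.fract (.get 2 (.lit 0))) (.get 0 (.lit 0)))
    (.setWord 1 (.lit 0) (.lit 1)) (.setWord 1 (.lit 0) (.lit 0)))
  (.seq (.setWord 1 (.lit 1) (.get 0 (.lit 1)))
  (.seq (.setWord 1 (.lit 2) (.get 0 (.lit 0)))
    (.setWord 1 (.lit 3) (.get 0 (.lit 1)))))))

/-- Horner's rule from the top coefficient down: with counter `i`, the accumulator is `∑ l < t - i,
a (i + l) x^l`. One pass takes three steps, including the test, and reduction modulo one happens
once, at the end. -/
theorem edgeProgram_achieves {n m t : ℕ} (p : ℝ) (T : ℝ≥0) (ω : Fin t → unitInterval)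
    (x : Fin n × Fin m) :
    edgeProgram.Achieves (edgeInput p ω x) fun c s =>
      EdgeOutput (kCoverSketch (fun e : Fin m => polyHash ω e) p T 0) x s ∧ c ≤ 3 * t + 7 := by
  set a : ℕ → ℝ := fun i => if h : i < t then (ω ⟨i, h⟩ : ℝ) else 0 with ha
  set s0 := edgeInput p ω x with hs0
  have w00 : s0.word 0 0 = x.1 := by simp [hs0, edgeInput]
  have w01 : s0.word 0 1 = x.2 := by simp [hs0, edgeInput]
  have w02 : s0.word 0 2 = t := by simp [hs0, edgeInput]
  have r0 : s0.real 0 0 = p := by simp [hs0, edgeInput]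
  have r1 : s0.real 1 = a := by ext i; simp [hs0, edgeInput, ha]
  have r2 : s0.real 2 0 = 0 := by simp [hs0, edgeInput]
  have hloop := RamProg.achieves_while (b := .wordLe (.lit 1) (.var 2)) (P := hornerStep)
    (fun s φ => s.word 0 = s0.word 0 ∧ s.real 0 = s0.real 0 ∧ s.real 1 = s0.real 1 ∧
      s.word 2 0 ≤ t ∧ φ = 3 * s.word 2 0 ∧
      s.real 2 0 = ∑ l ∈ Finset.range (t - s.word 2 0), a (s.word 2 0 + l) * (x.2 : ℝ) ^ l)
    (by
      rintro s φ ⟨h0, hr0, hr1, hle, rfl, hacc⟩ hb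
      simp only [RamTest.Holds, WordExp.eval] at hb
      obtain ⟨i, hi⟩ : ∃ i, s.word 2 0 = i + 1 := ⟨s.word 2 0 - 1, by omega⟩
      refine RamProg.achieves_seq (RamProg.achieves_setWord (RamProg.achieves_setReal ?_))
      refine ⟨3 * i, ⟨?_, ?_, ?_, ?_, ?_, ?_⟩, by omega⟩
      · simp [RamState.word_setReal, RamState.word_setWord, h0]
      · simp [RamState.real_setReal, RamState.real_setWord, hr0]
      · simp [RamState.real_setReal, RamState.real_setWord, hr1]
      · simp [RamState.word_setReal, RamState.word_setWord, WordExp.eval, hi]; omega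
      · simp [RamState.word_setReal, RamState.word_setWord, WordExp.eval, hi]
      · simp only [RamState.word_setReal, RamState.word_setWord, RamState.real_setReal,
          RamState.real_setWord, WordExp.eval, RealExp.eval, hi, h0, hr1, hacc, r1]
        simp only [Nat.add_sub_cancel, if_true, Function.update_self, if_false,
          show (0 : ℕ) ≠ 2 by norm_num]
        have e1 : t - i = (t - (i + 1)) + 1 := by omega
        rw [e1, Finset.sum_range_succ', Finset.sum_mul, w01]
        simp only [add_zero, pow_zero, mul_one]
        congr 1
        refine Finset.sum_congr rfl fun l _ => ?_
        rw [pow_succ, show i + 1 + l = i + (l + 1) by ring]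
        ring)
  refine RamProg.achieves_seq (RamProg.achieves_setWord (RamProg.achieves_seq ?_))
  refine RamProg.Achieves.mono (hloop (3 * t) _ ⟨?_, ?_, ?_, ?_, ?_, ?_⟩) ?_
  · simp [RamState.word_setWord]
  · simp [RamState.real_setWord]
  · simp [RamState.real_setWord]
  · simp [RamState.word_setWord, WordExp.eval, w02]
  · simp [RamState.word_setWord, WordExp.eval, w02]
  · simp [RamState.word_setWord, RamState.real_setWord, WordExp.eval, w02, r2]
  · rintro c s ⟨φ', ⟨h0, hr0, hr1, -, rfl, hacc⟩, hb, hc⟩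
    simp only [RamTest.Holds, WordExp.eval, not_le, Nat.lt_one_iff] at hb
    have hhash : Int.fract (s.real 2 0) = (polyHash ω (x.2 : ℕ) : ℝ) := by
      rw [hacc, hb]
      simp only [polyHash, unitFract, Nat.sub_zero, zero_add]
      rw [← Fin.sum_univ_eq_sum_range (fun l => a l * (x.2 : ℝ) ^ l)]
      simp [ha]
    refine RamProg.achieves_seq (RamProg.achieves_ite (fun h => ?_) fun h => ?_) <;>
    · simp only [RamTest.Holds, RealExp.eval, WordExp.eval, hhash, hr0, r0] at h
      refine RamProg.achieves_setWord (RamProg.achieves_seq (RamProg.achieves_setWord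
        (RamProg.achieves_seq (RamProg.achieves_setWord (RamProg.achieves_setWord ?_)))))
      refine ⟨⟨?_, ?_, ?_, ?_⟩, by omega⟩ <;>
      simp [RamState.word_setWord, WordExp.eval, h0, w00, w01, kCoverSketch, h]

/-! ### Linked lists -/

/-- The greatest `p ≤ i` with `key (p - 1) = κ`, or `0` if there is none. -/
def lastKey (key : ℕ → ℕ) (κ : ℕ) : ℕ → ℕ
  | 0 => 0
  | i + 1 => if key i = κ then i + 1 else lastKey key κ i

theorem lastKey_cases (key : ℕ → ℕ) (κ i : ℕ) :
    (lastKey key κ i = 0 ∧ ∀ j < i, key j ≠ κ) ∨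
      ∃ j < i, lastKey key κ i = j + 1 ∧ key j = κ ∧ ∀ l, j < l → l < i → key l ≠ κ := by
  induction i with
  | zero => exact Or.inl ⟨rfl, fun j hj => by omega⟩
  | succ i ih =>
    by_cases h : key i = κ
    · exact Or.inr ⟨i, by omega, by simp [lastKey, h], h, fun l h1 h2 => by omega⟩
    · have he : lastKey key κ (i + 1) = lastKey key κ i := by simp [lastKey, h]
      rw [he]
      rcases ih with ⟨h0, h1⟩ | ⟨j, hj, h0, h1, h2⟩
      · refine Or.inl ⟨h0, fun j hj => ?_⟩
        rcases Nat.lt_succ_iff_lt_or_eq.1 hj with h' | rfl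
        · exact h1 j h'
        · exact h
      · refine Or.inr ⟨j, by omega, h0, h1, fun l hl hl' => ?_⟩
        rcases Nat.lt_succ_iff_lt_or_eq.1 hl' with h' | rfl
        · exact h2 l hl h'
        · exact h

/-- The positions below `i` with a given key. -/
def withKey (key : ℕ → ℕ) (κ i : ℕ) : Finset ℕ := (Finset.range i).filter fun j => key j = κ

/-- Go through the list with the links in the array `next`, with the current position, increased
by one, in the variable `a`. -/
def walkList (a next : ℕ) (body : RamProg) : RamProg :=
  .while (.wordLe (.lit 1) (.var a))
    (.seq body (.setWord a (.lit 0) (.get next (.var a))))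

/-- Links store positions increased by one, so the default content `0` ends a list, and positions
come in decreasing order. `J i` expresses that all positions from `i` on with key `κ` have been
treated. The `2` in `hbody` pays for the loop test and for following the link. -/
theorem achieves_walkList {a next : ℕ} {body : RamProg} {key : ℕ → ℕ} {κ N : ℕ}
    (J : ℕ → RamState → ℕ → Prop)
    (hnext : ∀ i s φ, J i s φ → ∀ j < N, s.word next (j + 1) = lastKey key (key j) j)
    (hset : ∀ i s φ x, J i s φ → J i (s.setWord a 0 x) φ)
    (hskip : ∀ i s φ, key i ≠ κ → J (i + 1) s φ → J i s φ)
    (hbody : ∀ i s φ, i < N → key i = κ → J (i + 1) s φ → s.word a 0 = i + 1 →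
      body.Achieves s fun c s' => ∃ φ', J i s' φ' ∧ s'.word a 0 = i + 1 ∧ c + 2 + φ' ≤ φ) :
    ∀ i ≤ N, ∀ s φ, J i s φ → s.word a 0 = lastKey key κ i →
      (walkList a next body).Achieves s fun c s' => ∃ φ', J 0 s' φ' ∧ c + φ' ≤ φ + 1 := by
  -- Positions with other keys between two list entries are passed over at no cost.
  have hdesc : ∀ d i s φ, (∀ l, i ≤ l → l < i + d → key l ≠ κ) → J (i + d) s φ → J i s φ := by
    intro d
    induction d with
    | zero => exact fun i s φ _ h => h
    | succ d ih =>
      intro i s φ hl h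
      exact ih i s φ (fun l h1 h2 => hl l h1 (by omega))
        (hskip (i + d) s φ (hl _ (by omega) (by omega)) h)
  intro i hi s φ hJ hp
  have hmain := RamProg.achieves_while (b := .wordLe (.lit 1) (.var a))
    (P := .seq body (.setWord a (.lit 0) (.get next (.var a))))
    (fun s φ => ∃ i ≤ N, J i s φ ∧ s.word a 0 = lastKey key κ i) (by
      rintro s φ ⟨i, hi, hJ, hp⟩ hb
      simp only [RamTest.Holds, WordExp.eval, hp] at hb
      rcases lastKey_cases key κ i with ⟨h0, -⟩ | ⟨j, hj, h0, h1, h2⟩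
      · omega
      · have hJ' : J (j + 1) s φ := hdesc (i - (j + 1)) (j + 1) s φ
          (fun l hl hl' => h2 l (by omega) (by omega)) (by
            rwa [show j + 1 + (i - (j + 1)) = i by omega])
        refine RamProg.achieves_seq ((hbody j s φ (by omega) h1 hJ' (by rw [hp, h0])).mono ?_)
        rintro c s' ⟨φ', hJ'', hp', hc⟩
        refine RamProg.achieves_setWord ⟨φ', ⟨j, by omega, hset _ _ _ _ hJ'', ?_⟩, by omega⟩
        simp only [WordExp.eval, RamState.word_setWord, if_true, Function.update_self, hp',
          hnext _ _ _ hJ'' j (by omega), h1])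
    φ s ⟨i, hi, hJ, hp⟩
  refine hmain.mono ?_
  rintro c s' ⟨φ', ⟨i, hi, hJ, hp⟩, hb, hc⟩
  simp only [RamTest.Holds, WordExp.eval, hp] at hb
  refine ⟨φ', ?_, hc⟩
  rcases lastKey_cases key κ i with ⟨-, h1⟩ | ⟨j, hj, h0, h1, h2⟩
  · exact hdesc i 0 s' φ' (fun l _ hl => h1 l (by omega)) (by rwa [zero_add])
  · omega

/-! ### Greedy covers -/

section Greedy

variable (S E : ℕ → ℕ) (N : ℕ)

/-- The elements that are covered by the sets in `Q`, where `(S j, E j)` for `j < N` are the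
edges. -/
def coveredBy (Q : Finset ℕ) : Finset ℕ := ((Finset.range N).filter fun j => S j ∈ Q).image E

/-- The number of edges of the set `x` to elements outside `C`. -/
def liveDegree (C : Finset ℕ) (x : ℕ) : ℕ :=
  ((Finset.range N).filter fun j => S j = x ∧ E j ∉ C).card

variable {S E N}

theorem mem_coveredBy {Q : Finset ℕ} {e : ℕ} :
    e ∈ coveredBy S E N Q ↔ ∃ j < N, S j ∈ Q ∧ E j = e := by
  simp [coveredBy, and_assoc]

theorem liveDegree_anti {C D : Finset ℕ} (h : C ⊆ D) (x : ℕ) :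
    liveDegree S E N D x ≤ liveDegree S E N C x :=
  Finset.card_le_card fun j hj => by
    simp only [Finset.mem_filter] at hj ⊢
    exact ⟨hj.1, hj.2.1, fun hC => hj.2.2 (h hC)⟩

theorem liveDegree_eq_zero {Q : Finset ℕ} {x : ℕ} (hx : x ∈ Q) :
    liveDegree S E N (coveredBy S E N Q) x = 0 := by
  rw [liveDegree, Finset.card_eq_zero]
  refine Finset.filter_false_of_mem fun j hj h => h.2 ?_
  exact mem_coveredBy.2 ⟨j, Finset.mem_range.1 hj, h.1 ▸ hx, rfl⟩

/-- Each set of `P` adds at most its residual degree to what `Q` covers; for a set of maximal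
residual degree this is the greedy inequality. -/
theorem card_coveredBy_le (P Q : Finset ℕ) :
    (coveredBy S E N P).card ≤ (coveredBy S E N Q).card +
      ∑ x ∈ P, liveDegree S E N (coveredBy S E N Q) x := by
  classical
  have hsub : coveredBy S E N P ⊆ coveredBy S E N Q ∪ P.biUnion fun x =>
      ((Finset.range N).filter fun j => S j = x ∧ E j ∉ coveredBy S E N Q).image E := by
    intro e he
    obtain ⟨j, hj, hS, rfl⟩ := mem_coveredBy.1 he
    by_cases h : E j ∈ coveredBy S E N Q
    · exact Finset.mem_union_left _ h
    · refine Finset.mem_union_right _ (Finset.mem_biUnion.2 ⟨S j, hS, ?_⟩)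
      exact Finset.mem_image.2 ⟨j, by simp [hj, h], rfl⟩
  refine (Finset.card_le_card hsub).trans ((Finset.card_union_le _ _).trans ?_)
  refine Nat.add_le_add_left (Finset.card_biUnion_le.trans ?_) _
  exact Finset.sum_le_sum fun x _ => Finset.card_image_le

/-- Without parallel edges, distinct residual edges of `x` lead to distinct new elements. -/
theorem card_coveredBy_insert (hinj : ∀ i < N, ∀ j < N, S i = S j → E i = E j → i = j)
    (Q : Finset ℕ) (x : ℕ) :
    (coveredBy S E N Q).card + liveDegree S E N (coveredBy S E N Q) x ≤
      (coveredBy S E N (insert x Q)).card := by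
  classical
  have h1 : (((Finset.range N).filter fun j => S j = x ∧ E j ∉ coveredBy S E N Q).image E).card =
      liveDegree S E N (coveredBy S E N Q) x := by
    refine Finset.card_image_of_injOn fun i hi j hj h => ?_
    simp only [Finset.coe_filter, Finset.mem_range] at hi hj
    exact hinj i hi.1 j hj.1 (hi.2.1.trans hj.2.1.symm) h
  rw [← h1, ← Finset.card_union_of_disjoint]
  · refine Finset.card_le_card fun e he => ?_
    rcases Finset.mem_union.1 he with he | he
    · obtain ⟨j, hj, hS, rfl⟩ := mem_coveredBy.1 he
      exact mem_coveredBy.2 ⟨j, hj, Finset.mem_insert_of_mem hS, rfl⟩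
    · obtain ⟨j, hj, rfl⟩ := Finset.mem_image.1 he
      simp only [Finset.mem_filter, Finset.mem_range] at hj
      exact mem_coveredBy.2 ⟨j, hj.1, by simp [hj.2.1], rfl⟩
  · rw [Finset.disjoint_left]
    intro e he he'
    obtain ⟨j, hj, rfl⟩ := Finset.mem_image.1 he'
    exact (Finset.mem_filter.1 hj).2.2 he

variable (S E N) in
/-- The progress guarantee of the greedy algorithm. -/
def GreedyBound (k : ℕ) (Q : Finset ℕ) : Prop :=
  ∀ P : Finset ℕ, P.card ≤ k →
    ((coveredBy S E N P).card : ℝ) - (coveredBy S E N Q).card ≤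
      (1 - 1 / (k : ℝ)) ^ Q.card * (coveredBy S E N P).card

theorem greedyBound_empty (k : ℕ) : GreedyBound S E N k ∅ := by
  intro P _
  simp

/-- If `a` and `b` are the coverages of `P` and `Q` and `v` is the maximal residual degree, then `a
- b ≤ k v`. Gaining `v` thus shrinks the gap by the factor `1 - 1/k`. -/
theorem GreedyBound.insert {k : ℕ} (hk : 1 ≤ k) {Q : Finset ℕ} (h : GreedyBound S E N k Q)
    (hinj : ∀ i < N, ∀ j < N, S i = S j → E i = E j → i = j) {x : ℕ} (hx : x ∉ Q)
    (hmax : ∀ y, liveDegree S E N (coveredBy S E N Q) y ≤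
      liveDegree S E N (coveredBy S E N Q) x) : GreedyBound S E N k (insert x Q) := by
  intro P hP
  set v := liveDegree S E N (coveredBy S E N Q) x
  have hk0 : (1 : ℝ) ≤ k := by exact_mod_cast hk
  have h1 : ((coveredBy S E N Q).card : ℝ) + v ≤ (coveredBy S E N (Insert.insert x Q)).card := by
    exact_mod_cast card_coveredBy_insert hinj Q x
  have h2 : ((coveredBy S E N P).card : ℝ) ≤ (coveredBy S E N Q).card + k * v := by
    have h3 : ∑ y ∈ P, liveDegree S E N (coveredBy S E N Q) y ≤ k * v :=
      (Finset.sum_le_card_nsmul P _ v fun y _ => hmax y).trans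
        (by rw [smul_eq_mul]; exact Nat.mul_le_mul_right _ hP)
    exact_mod_cast (card_coveredBy_le P Q).trans (Nat.add_le_add_left h3 _)
  have h4 := h P hP
  rw [Finset.card_insert_of_notMem hx, pow_succ]
  set a : ℝ := ((coveredBy S E N P).card : ℝ)
  set b : ℝ := ((coveredBy S E N Q).card : ℝ)
  have h5 : a - b - v ≤ (1 - 1 / (k : ℝ)) * (a - b) := by
    have : (a - b) / k ≤ v := by rw [div_le_iff₀ (by linarith)]; linarith
    have e : (1 - 1 / (k : ℝ)) * (a - b) = (a - b) - (a - b) / k := by ring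
    rw [e]; linarith
  have h6 : (0 : ℝ) ≤ 1 - 1 / (k : ℝ) := by
    rw [sub_nonneg, div_le_one (by linarith)]; exact hk0
  nlinarith [mul_le_mul_of_nonneg_left h4 h6]

/-- After `k` choices `(1 - 1/k)^k ≤ 1/e`. Stopping with fewer sets is harmless, since then every
edge leads to a covered element. -/
theorem GreedyBound.le_card {k : ℕ} (hk : 1 ≤ k) {Q : Finset ℕ} (h : GreedyBound S E N k Q)
    (hQ : Q.card = k ∨ ∀ x, liveDegree S E N (coveredBy S E N Q) x = 0) {P : Finset ℕ}
    (hP : P.card ≤ k) :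
    (1 - 1 / Real.exp 1) * (coveredBy S E N P).card ≤ (coveredBy S E N Q).card := by
  have hP0 : (0 : ℝ) ≤ (coveredBy S E N P).card := by positivity
  have he : (0 : ℝ) < 1 / Real.exp 1 := by positivity
  rcases hQ with hQ | hQ
  · have h1 := h P hP
    rw [hQ] at h1
    have h2 : (1 - 1 / (k : ℝ)) ^ k ≤ 1 / Real.exp 1 := by
      have := Real.one_sub_div_pow_le_exp_neg (n := k) (t := 1) (by exact_mod_cast hk)
      rwa [Real.exp_neg, inv_eq_one_div] at this
    nlinarith
  · have h1 := card_coveredBy_le (S := S) (E := E) (N := N) P Q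
    rw [Finset.sum_congr rfl fun x _ => hQ x, Finset.sum_const_zero, add_zero] at h1
    have h2 : ((coveredBy S E N P).card : ℝ) ≤ (coveredBy S E N Q).card := by exact_mod_cast h1
    nlinarith

end Greedy

/-! ### The greedy program -/

/-- The word of the array `a` that belongs to the list position in the variable `p`. -/
abbrev WordExp.at (a p : ℕ) : WordExp := .get a (.sub (.var p) (.lit 1))

/-- Add the position in the variable `3` to the list with the given key, with heads in the array
`h` and links in the array `l`. -/
def pushList (h l : ℕ) (key : WordExp) : RamProg :=
  .seq (.setWord l (.add (.var 3) (.lit 1)) (.get h key))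
    (.setWord h key (.add (.var 3) (.lit 1)))

/-- Compute the degrees (array `4`) and the lists of the edges by set (arrays `5`, `6`), by
element (`7`, `8`) and by the rank of the edge in its set (`9`, `10`). -/
def buildLists : RamProg :=
  .while (.wordLe (.add (.var 3) (.lit 1)) (.get 0 (.lit 3)))
    (.seq (.setWord 4 (.get 1 (.var 3)) (.add (.get 4 (.get 1 (.var 3))) (.lit 1)))
    (.seq (pushList 5 6 (.get 1 (.var 3)))
    (.seq (pushList 7 8 (.get 2 (.var 3)))
    -- The degree counter was just increased, so it now equals the rank of this edge in its set,
    -- counted from one.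
    (.seq (pushList 9 10 (.get 4 (.get 1 (.var 3))))
      (.setWord 3 (.lit 0) (.add (.var 3) (.lit 1)))))))

/-- Decrement the residual degrees (array `4`) of the sets that contain the element of the list
in the variable `14`. -/
def updateDegrees : RamProg :=
  walkList 14 8 (.setWord 4 (.at 1 14) (.sub (.get 4 (.at 1 14)) (.lit 1)))

/-- Cover (array `11`) the elements of the set of the list in the variable `13`, and count them
in the variable `16`. -/
def coverSet : RamProg :=
  walkList 13 6 (.ite (.wordLe (.get 11 (.at 2 13)) (.lit 0))
    (.seq (.setWord 11 (.at 2 13) (.lit 1))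
    (.seq (.setWord 16 (.lit 0) (.add (.var 16) (.lit 1)))
    (.seq (.setWord 14 (.lit 0) (.get 7 (.at 2 13)))
      updateDegrees)))
    .skip)

/-- Select the sets whose residual degree is at least the level in the variable `3`, while there
are sets left (variable `15`). -/
def selectLevel : RamProg :=
  walkList 12 10 (.ite (.and (.wordLe (.var 3) (.get 4 (.at 1 12))) (.wordLe (.lit 1) (.var 15)))
    (.seq (.setWord 15 (.lit 0) (.sub (.var 15) (.lit 1)))
    (.seq (.setWord 13 (.lit 0) (.get 5 (.at 1 12)))
      coverSet))
    .skip)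

/-- The greedy algorithm for `k`-cover, with an estimate of the value before sampling. -/
def recoverProgram : RamProg :=
  .seq buildLists
  (.seq (.setWord 15 (.lit 0) (.get 0 (.lit 2)))
  -- Variable `3` still holds the number of edges, which bounds every degree; the levels descend
  -- from there.
  (.seq (.while (.wordLe (.lit 1) (.var 3))
    (.seq (.setWord 12 (.lit 0) (.get 9 (.var 3)))
    (.seq selectLevel
      (.setWord 3 (.lit 0) (.sub (.var 3) (.lit 1))))))
    (.setReal 1 (.lit 0) (.div (.mul
      (.sub (.ofWord (.lit 1)) (.div (.get 0 (.lit 0)) (.ofWord (.lit 4))))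
      (.ofWord (.var 16))) (.get 0 (.lit 1))))))

/-- The rank of an edge among the edges of its set. -/
def edgeRank (S : ℕ → ℕ) (j : ℕ) : ℕ := (withKey S (S j) (j + 1)).card

theorem withKey_succ (key : ℕ → ℕ) (κ i : ℕ) :
    withKey key κ (i + 1) = if key i = κ then insert i (withKey key κ i) else withKey key κ i := by
  rw [withKey, Finset.range_add_one, Finset.filter_insert]
  rfl

theorem notMem_withKey (key : ℕ → ℕ) (κ i : ℕ) : i ∉ withKey key κ i := by
  simp [withKey]

theorem card_withKey_succ (key : ℕ → ℕ) (κ i : ℕ) :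
    (withKey key κ (i + 1)).card = (withKey key κ i).card + if key i = κ then 1 else 0 := by
  rw [withKey_succ]
  split_ifs
  · rw [Finset.card_insert_of_notMem (notMem_withKey key κ i)]
  · rfl

/-- Each number up to the degree of a set is the rank of one of its edges. -/
theorem exists_edgeRank_eq (S : ℕ → ℕ) (x : ℕ) {v : ℕ} (hv : 1 ≤ v) :
    ∀ {N : ℕ}, v ≤ (withKey S x N).card → ∃ j < N, S j = x ∧ edgeRank S j = v := by
  intro N
  induction N with
  | zero => intro h; simp [withKey] at h; omega
  | succ N ih =>
    intro h
    by_cases h1 : v ≤ (withKey S x N).card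
    · obtain ⟨j, hj, h2⟩ := ih h1
      exact ⟨j, by omega, h2⟩
    · have h2 := card_withKey_succ S x N
      split_ifs at h2 with h3
      · refine ⟨N, by omega, h3, ?_⟩
        rw [edgeRank, h3]; omega
      · omega

/-- The linked list with heads in the array `h` and links in the array `l` contains the positions
below `i`. -/
def ListBuilt (key : ℕ → ℕ) (h l i : ℕ) (s : RamState) : Prop :=
  (∀ κ, s.word h κ = lastKey key κ i) ∧
    ∀ j < i, s.word l (j + 1) = lastKey key (key j) j

theorem ListBuilt.congr {key : ℕ → ℕ} {h l i : ℕ} {s s' : RamState} (hL : ListBuilt key h l i s)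
    (hh : s'.word h = s.word h) (hl : s'.word l = s.word l) : ListBuilt key h l i s' := by
  rwa [ListBuilt, hh, hl]

/-- The key expression is evaluated again after the link has been written; `he` says that this write
does not change it. -/
theorem achieves_pushList {key : ℕ → ℕ} {h l i : ℕ} {s : RamState} {e : WordExp}
    (hL : ListBuilt key h l i s) (hhl : h ≠ l) (hl : l ≠ 3) (h3 : s.word 3 0 = i)
    (he : ∀ x y, e.eval (s.setWord l x y) = key i) (he' : e.eval s = key i) :
    (pushList h l e).Achieves s fun c s' => c = 2 ∧ ListBuilt key h l (i + 1) s' ∧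
      RamState.SameExcept [h, l] s s' := by
  refine RamProg.achieves_seq (RamProg.achieves_setWord_of (I := i + 1) (V := s.word h (key i))
    (by simp [WordExp.eval, h3]) (by simp [WordExp.eval, he'])
    (RamProg.achieves_setWord_of (I := key i) (V := i + 1) (he _ _)
    (by simp [WordExp.eval, RamState.word_setWord, h3, hl.symm]) ⟨rfl, ⟨fun κ => ?_, ?_⟩, ?_⟩))
  · rw [RamState.word_setWord, if_pos rfl, RamState.word_setWord_of_ne _ _ _ hhl]
    by_cases hκ : κ = key i
    · subst hκ; simp [lastKey]
    · rw [Function.update_of_ne hκ, hL.1, lastKey, if_neg (Ne.symm hκ)]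
  · intro j hj
    rw [RamState.word_setWord_of_ne _ _ _ hhl.symm, RamState.word_setWord, if_pos rfl]
    by_cases hji : j = i
    · subst hji; rw [Function.update_self, hL.1]
    · rw [Function.update_of_ne (by omega), hL.2 j (by omega)]
  · exact ((RamState.SameExcept.refl _ s).setWord (by simp) _ _).setWord (by simp) _ _

/-- The linked lists of the edges with positions below `i`. -/
structure ListsBuilt (S E : ℕ → ℕ) (i : ℕ) (s : RamState) : Prop where
  sets : s.word 1 = S
  elems : s.word 2 = E
  bySet : ListBuilt S 5 6 i s
  byElem : ListBuilt E 7 8 i s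
  byRank : ListBuilt (edgeRank S) 9 10 i s

theorem ListsBuilt.congr {S E : ℕ → ℕ} {i : ℕ} {A : List ℕ} {s s' : RamState}
    (h : ListsBuilt S E i s) (hs : RamState.SameExcept A s s')
    (hA : ∀ a ∈ [1, 2, 5, 6, 7, 8, 9, 10], a ∉ A) : ListsBuilt S E i s' where
  sets := (hs.1 1 (hA 1 (by simp))).trans h.sets
  elems := (hs.1 2 (hA 2 (by simp))).trans h.elems
  bySet := h.bySet.congr (hs.1 5 (hA 5 (by simp))) (hs.1 6 (hA 6 (by simp)))
  byElem := h.byElem.congr (hs.1 7 (hA 7 (by simp))) (hs.1 8 (hA 8 (by simp)))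
  byRank := h.byRank.congr (hs.1 9 (hA 9 (by simp))) (hs.1 10 (hA 10 (by simp)))

theorem achieves_buildLists {S E : ℕ → ℕ} {N : ℕ} {s : RamState} (h0 : ListsBuilt S E 0 s)
    (h3 : s.word 3 0 = 0) (h4 : ∀ x, s.word 4 x = 0) (hN : s.word 0 3 = N) :
    buildLists.Achieves s fun c s' => ListsBuilt S E N s' ∧ s'.word 3 0 = N ∧
      (∀ x, s'.word 4 x = (withKey S x N).card) ∧
      RamState.SameExcept [3, 4, 5, 6, 7, 8, 9, 10] s s' ∧ c ≤ 9 * N + 1 := by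
  refine (RamProg.achieves_while (fun s' φ => ∃ i ≤ N, ListsBuilt S E i s' ∧ s'.word 3 0 = i ∧
    (∀ x, s'.word 4 x = (withKey S x i).card) ∧
    RamState.SameExcept [3, 4, 5, 6, 7, 8, 9, 10] s s' ∧ φ = 9 * (N - i)) ?_ (9 * N) s
    ⟨0, by omega, h0, h3, by simpa [withKey] using h4, .refl _ _, by omega⟩).mono ?_
  · rintro s1 φ ⟨i, hi, hL, h3, h4, hs, rfl⟩ hb
    have h0 : s1.word 0 3 = N := by rw [hs.1 0 (by simp), hN]
    simp only [RamTest.Holds, WordExp.eval, h3, h0] at hb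
    have hrank : (withKey S (S i) i).card + 1 = edgeRank S i := by
      rw [edgeRank, card_withKey_succ, if_pos rfl]
    refine RamProg.achieves_seq (RamProg.achieves_setWord_of (I := S i) (V := edgeRank S i)
      (by simp [WordExp.eval, h3, hL.sets]) (by simp [WordExp.eval, h3, hL.sets, h4, hrank]) ?_)
    set s2 := s1.setWord 4 (S i) (edgeRank S i) with hs2
    have h12 : RamState.SameExcept [4] s1 s2 := (RamState.SameExcept.refl _ _).setWord (by simp) _ _
    have hL2 := hL.congr h12 (by decide)
    have h23 : s2.word 3 0 = i := by rw [h12.1 3 (by decide), h3]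
    have h24 : s2.word 4 (S i) = edgeRank S i := RamState.word_setWord_self _ _ _ _
    refine RamProg.achieves_seq ((achieves_pushList hL2.bySet (by decide) (by decide)
      h23 (fun x y => by simp [WordExp.eval, RamState.word_setWord, h23, hL2.sets])
      (by simp [WordExp.eval, h23, hL2.sets])).mono ?_)
    rintro _ s3 ⟨rfl, hb3, hs3⟩
    have h33 : s3.word 3 0 = i := by rw [hs3.1 3 (by decide), h23]
    have h3e : s3.word 2 = E := by rw [hs3.1 2 (by decide), hL2.elems]
    refine RamProg.achieves_seq ((achieves_pushList
      (hL2.byElem.congr (hs3.1 7 (by decide)) (hs3.1 8 (by decide)))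
      (by decide) (by decide)
      h33 (fun x y => by simp [WordExp.eval, RamState.word_setWord, h33, h3e])
      (by simp [WordExp.eval, h33, h3e])).mono ?_)
    rintro _ s4 ⟨rfl, hb4, hs4⟩
    have hs24 : RamState.SameExcept [5, 6, 7, 8] s2 s4 :=
      RamState.SameExcept.trans (B := [7, 8]) ⟨fun a ha => hs3.1 a (by simp at ha ⊢; omega), hs3.2⟩
        hs4 (by simp)
    have h43 : s4.word 3 0 = i := by rw [hs24.1 3 (by decide), h23]
    have h4s : s4.word 1 = S := by rw [hs24.1 1 (by decide), hL2.sets]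
    have h4r : s4.word 4 (S i) = edgeRank S i := by rw [hs24.1 4 (by decide), h24]
    refine RamProg.achieves_seq ((achieves_pushList
      (hL2.byRank.congr (hs24.1 9 (by decide)) (hs24.1 10 (by decide)))
      (by decide) (by decide)
      h43 (fun x y => by simp [WordExp.eval, RamState.word_setWord, h43, h4s, h4r])
      (by simp [WordExp.eval, h43, h4s, h4r])).mono ?_)
    rintro _ s5 ⟨rfl, hb5, hs5⟩
    have h53 : s5.word 3 0 = i := by rw [hs5.1 3 (by decide), h43]
    refine RamProg.achieves_setWord_of (I := 0) (V := i + 1) rfl (by simp [WordExp.eval, h53]) ?_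
    set s6 := s5.setWord 3 0 (i + 1) with hs6
    have h56 : RamState.SameExcept [3] s5 s6 := (RamState.SameExcept.refl _ _).setWord (by simp) _ _
    have hs46 : RamState.SameExcept [3, 9, 10] s4 s6 :=
      RamState.SameExcept.trans (B := [3]) ⟨fun a ha => hs5.1 a (by simp at ha ⊢; omega), hs5.2⟩
        h56 (by simp)
    have hs26 : RamState.SameExcept [3, 5, 6, 7, 8, 9, 10] s2 s6 :=
      RamState.SameExcept.trans (B := [3, 9, 10])
        ⟨fun a ha => hs24.1 a (by simp at ha ⊢; omega), hs24.2⟩ hs46 (by simp)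
    have hs16 : RamState.SameExcept [3, 4, 5, 6, 7, 8, 9, 10] s1 s6 :=
      RamState.SameExcept.trans (B := [3, 5, 6, 7, 8, 9, 10])
        ⟨fun a ha => h12.1 a (by simp at ha ⊢; omega), h12.2⟩ hs26 (by simp)
    refine ⟨9 * (N - (i + 1)), ⟨i + 1, hb, ⟨?_, ?_, ?_, ?_, ?_⟩, ?_, ?_, ?_, rfl⟩, by omega⟩
    · rw [hs46.1 1 (by decide), h4s]
    · rw [hs26.1 2 (by decide), hL2.elems]
    · exact hb3.congr ((hs46.1 5 (by decide)).trans (hs4.1 5 (by decide)))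
        ((hs46.1 6 (by decide)).trans (hs4.1 6 (by decide)))
    · exact hb4.congr (hs46.1 7 (by decide)) (hs46.1 8 (by decide))
    · exact hb5.congr (h56.1 9 (by decide)) (h56.1 10 (by decide))
    · exact RamState.word_setWord_self _ _ _ _
    · intro x
      rw [hs26.1 4 (by decide), hs2, RamState.word_setWord, if_pos rfl, card_withKey_succ]
      by_cases hx : x = S i
      · subst hx; rw [Function.update_self, if_pos rfl, hrank]
      · rw [Function.update_of_ne hx, if_neg (Ne.symm hx), h4, add_zero]
    · exact hs.trans hs16 (by simp)
  · rintro c s' ⟨φ', ⟨i, hi, hL, h3, h4, hs, rfl⟩, hb, hc⟩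
    have h0 : s'.word 0 3 = N := by rw [hs.1 0 (by simp), hN]
    simp only [RamTest.Holds, WordExp.eval, h3, h0] at hb
    obtain rfl : i = N := by omega
    exact ⟨hL, h3, h4, hs, by omega⟩

/-- The memory represents the covered elements `C`. -/
structure Represents (S E : ℕ → ℕ) (N : ℕ) (C : Finset ℕ) (s : RamState) : Prop where
  degree : ∀ x, s.word 4 x = liveDegree S E N C x
  covered : ∀ e, s.word 11 e = if e ∈ C then 1 else 0
  size : s.word 16 0 = C.card

/-- The number of edges to elements outside `C`. -/
def liveEdges (E : ℕ → ℕ) (N : ℕ) (C : Finset ℕ) : ℕ :=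
  ((Finset.range N).filter fun j => E j ∉ C).card

/-- The accounting identity: used with the elements, it pays for updating degrees when an element is
covered; used with the sets, it pays for scanning a set when it is selected. -/
theorem liveEdges_insert {E : ℕ → ℕ} {N e : ℕ} {C : Finset ℕ} (he : e ∉ C) :
    liveEdges E N (insert e C) + (withKey E e N).card = liveEdges E N C := by
  rw [liveEdges, liveEdges, withKey, ← Finset.card_union_of_disjoint]
  · congr 1
    ext j
    simp only [Finset.mem_union, Finset.mem_filter, Finset.mem_insert, not_or]
    constructor
    · rintro (h | ⟨h, rfl⟩)
      · exact ⟨h.1, h.2.2⟩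
      · exact ⟨h, he⟩
    · rintro ⟨h1, h2⟩
      by_cases h : E j = e
      · exact Or.inr ⟨h1, h⟩
      · exact Or.inl ⟨h1, h, h2⟩
  · rw [Finset.disjoint_left]
    intro j hj hj'
    simp only [Finset.mem_filter, Finset.mem_insert, not_or] at hj hj'
    exact hj.2.1 hj'.2

/-- In the middle of the walk the degree array counts the edges to elements outside `insert e C`
together with the edges at `e` in positions below `i`, which are still to be removed. -/
theorem achieves_updateDegrees {S E : ℕ → ℕ} {N e : ℕ} {C : Finset ℕ} {s : RamState}
    (hL : ListsBuilt S E N s) (he : e ∉ C) (h14 : s.word 14 0 = lastKey E e N)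
    (h4 : ∀ x, s.word 4 x = liveDegree S E N C x) :
    updateDegrees.Achieves s fun c s' => RamState.SameExcept [4, 14] s s' ∧
      (∀ x, s'.word 4 x = liveDegree S E N (insert e C) x) ∧
      c ≤ 3 * (withKey E e N).card + 1 := by
  refine (achieves_walkList (κ := e) (key := E) (N := N) (fun i s' φ =>
    RamState.SameExcept [4, 14] s s' ∧
      (∀ x, s'.word 4 x = ((Finset.range N).filter fun j => S j = x ∧
        (E j ∉ insert e C ∨ (E j = e ∧ j < i))).card) ∧ φ = 3 * (withKey E e i).card)
    ?_ ?_ ?_ ?_ N le_rfl s (3 * (withKey E e N).card) ⟨.refl _ _, ?_, rfl⟩ h14).mono ?_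
  · rintro i s' φ ⟨hs, -, -⟩
    exact (hL.congr hs (by decide)).byElem.2
  · rintro i s' φ x ⟨hs, h4, hφ⟩
    exact ⟨hs.setWord (by simp) _ _, by rwa [RamState.word_setWord_of_ne _ _ _ (by decide)], hφ⟩
  · rintro i s' φ hi ⟨hs, h4, hφ⟩
    refine ⟨hs, fun x => ?_, ?_⟩
    · rw [h4]
      congr 1
      refine Finset.filter_congr fun j _ => ?_
      have : E j = e → j ≠ i := fun h h' => hi (h' ▸ h)
      constructor
      · rintro ⟨h1, h2⟩
        exact ⟨h1, h2.imp_right fun h => ⟨h.1, by have := this h.1; omega⟩⟩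
      · rintro ⟨h1, h2⟩
        exact ⟨h1, h2.imp_right fun h => ⟨h.1, by omega⟩⟩
    · rw [hφ, card_withKey_succ, if_neg hi, add_zero]
  · rintro i s' φ hiN hi ⟨hs, h4, rfl⟩ hp
    have hL' := hL.congr hs (by decide)
    refine RamProg.achieves_setWord_of (I := S i) (V := s'.word 4 (S i) - 1)
      (by simp [WordExp.eval, hp, hL'.sets]) (by simp [WordExp.eval, hp, hL'.sets])
      ⟨3 * (withKey E e i).card, ⟨hs.setWord (by simp) _ _, fun x => ?_, rfl⟩, ?_, ?_⟩
    · rw [RamState.word_setWord, if_pos rfl]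
      by_cases hx : x = S i
      · subst hx
        rw [Function.update_self, h4]
        have hins : ((Finset.range N).filter fun j => S j = S i ∧
            (E j ∉ insert e C ∨ (E j = e ∧ j < i + 1))) =
            insert i ((Finset.range N).filter fun j => S j = S i ∧
              (E j ∉ insert e C ∨ (E j = e ∧ j < i))) := by
          ext j
          simp only [Finset.mem_filter, Finset.mem_insert, Finset.mem_range]
          constructor
          · rintro ⟨h1, h2, h3 | h3⟩
            · exact Or.inr ⟨h1, h2, Or.inl h3⟩
            · by_cases hji : j = i
              · exact Or.inl hji
              · exact Or.inr ⟨h1, h2, Or.inr ⟨h3.1, by omega⟩⟩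
          · rintro (rfl | ⟨h1, h2, h3⟩)
            · exact ⟨hiN, rfl, Or.inr ⟨hi, by omega⟩⟩
            · exact ⟨h1, h2, h3.imp_right fun h => ⟨h.1, by omega⟩⟩
        rw [hins, Finset.card_insert_of_notMem, Nat.add_sub_cancel]
        simp [hi]
      · rw [Function.update_of_ne hx, h4]
        congr 1
        refine Finset.filter_congr fun j _ => ?_
        have : S j = x → j ≠ i := fun h h' => hx (h' ▸ h.symm)
        constructor
        · rintro ⟨h1, h2⟩
          exact ⟨h1, h2.imp_right fun h => ⟨h.1, by have := this h1; omega⟩⟩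
        · rintro ⟨h1, h2⟩
          exact ⟨h1, h2.imp_right fun h => ⟨h.1, by omega⟩⟩
    · rw [RamState.word_setWord_of_ne _ _ _ (by decide), hp]
    · rw [card_withKey_succ, if_pos hi]; omega
  · intro x
    rw [h4, liveDegree]
    congr 1
    refine Finset.filter_congr fun j hj => ?_
    have hj' := Finset.mem_range.1 hj
    by_cases h : E j = e
    · simp [h, he, hj']
    · simp [h]
  · rintro c s' ⟨φ', ⟨hs, h4, rfl⟩, hc⟩
    refine ⟨hs, fun x => ?_, by omega⟩
    rw [h4, liveDegree]
    simp

/-! ### Amortized analysis of the greedy program. -/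

section GreedyProgram

variable {S E : ℕ → ℕ} {N : ℕ}

/-- Each edge of `x` costs at most seven steps outside the inner walk. The walk itself costs three
steps per edge of a newly covered element, taken from the drop in `liveEdges`. -/
theorem achieves_coverSet {x : ℕ} {C : Finset ℕ} {s : RamState} (hL : ListsBuilt S E N s)
    (hC : Represents S E N C s) (h13 : s.word 13 0 = lastKey S x N) :
    coverSet.Achieves s fun c s' => RamState.SameExcept [4, 11, 13, 14, 16] s s' ∧
      Represents S E N (C ∪ (withKey S x N).image E) s' ∧
      c + 3 * liveEdges E N (C ∪ (withKey S x N).image E) ≤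
        7 * (withKey S x N).card + 3 * liveEdges E N C + 1 := by
  refine (achieves_walkList (κ := x) (key := S) (N := N) (fun i s' φ => ∃ D : Finset ℕ,
    D = C ∪ ((withKey S x N).filter fun j => i ≤ j).image E ∧
    RamState.SameExcept [4, 11, 13, 14, 16] s s' ∧ Represents S E N D s' ∧
      φ = 7 * (withKey S x i).card + 3 * liveEdges E N D)
    ?_ ?_ ?_ ?_ N le_rfl s (7 * (withKey S x N).card + 3 * liveEdges E N C)
    ⟨C, ?_, .refl _ _, hC, rfl⟩ h13).mono ?_
  · rintro i s' φ ⟨D, -, hs, -⟩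
    exact (hL.congr hs (by decide)).bySet.2
  · rintro i s' φ y ⟨D, hD, hs, hR, hφ⟩
    refine ⟨D, hD, hs.setWord (by simp) _ _, ⟨?_, ?_, ?_⟩, hφ⟩
    · rw [RamState.word_setWord_of_ne _ _ _ (by decide)]; exact hR.degree
    · rw [RamState.word_setWord_of_ne _ _ _ (by decide)]; exact hR.covered
    · rw [RamState.word_setWord_of_ne _ _ _ (by decide)]; exact hR.size
  · rintro i s' φ hi ⟨D, hD, hs, hR, hφ⟩
    refine ⟨D, ?_, hs, hR, ?_⟩
    · rw [hD]
      congr 2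
      refine Finset.filter_congr fun j hj => ?_
      have : j ≠ i := fun h => hi (h ▸ (Finset.mem_filter.1 hj).2)
      omega
    · rw [hφ, card_withKey_succ, if_neg hi, add_zero]
  · rintro i s' φ hiN hi ⟨D, hD, hs, hR, rfl⟩ hp
    have hL' := hL.congr hs (by decide)
    have hD' : insert (E i) D = C ∪ ((withKey S x N).filter fun j => i ≤ j).image E := by
      have : ((withKey S x N).filter fun j => i ≤ j) =
          insert i ((withKey S x N).filter fun j => i + 1 ≤ j) := by
        ext j
        simp only [Finset.mem_filter, Finset.mem_insert, withKey, Finset.mem_range]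
        constructor
        · rintro ⟨⟨h1, h2⟩, h3⟩
          by_cases h : j = i
          · exact Or.inl h
          · exact Or.inr ⟨⟨h1, h2⟩, by omega⟩
        · rintro (rfl | ⟨⟨h1, h2⟩, h3⟩)
          · exact ⟨⟨hiN, hi⟩, le_rfl⟩
          · exact ⟨⟨h1, h2⟩, by omega⟩
      rw [this, Finset.image_insert, Finset.union_insert, hD]
    have hcard : (withKey S x (i + 1)).card = (withKey S x i).card + 1 := by
      rw [card_withKey_succ, if_pos hi]
    refine RamProg.achieves_ite (fun hb => ?_) fun hb =>
      RamProg.achieves_skip ⟨_, ⟨insert (E i) D, hD', hs, ?_, rfl⟩, hp, ?_⟩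
    · have he : E i ∉ D := by
        intro h
        simp [RamTest.Holds, WordExp.eval, hp, hL'.elems, hR.covered, h] at hb
      have h0 := RamState.SameExcept.refl [11, 14, 16] s'
      refine RamProg.achieves_seq (RamProg.achieves_setWord_of (I := E i) (V := 1)
        (by simp [WordExp.eval, hp, hL'.elems]) rfl ?_)
      set s1 := s'.setWord 11 (E i) 1 with hs1
      have h1 : RamState.SameExcept [11, 14, 16] s' s1 := h0.setWord (by simp) _ _
      refine RamProg.achieves_seq (RamProg.achieves_setWord_of (I := 0) (V := D.card + 1)
        rfl (by simp [WordExp.eval, hs1, RamState.word_setWord, hR.size]) ?_)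
      set s2 := s1.setWord 16 0 (D.card + 1) with hs2
      have h2 : RamState.SameExcept [11, 14, 16] s' s2 := h1.setWord (by simp) _ _
      refine RamProg.achieves_seq (RamProg.achieves_setWord_of (I := 0) (V := lastKey E (E i) N)
        rfl (by simp [WordExp.eval, h2.1 13 (by decide), h2.1 2 (by decide), h2.1 7 (by decide),
          hp, hL'.elems, hL'.byElem.1]) ?_)
      set s3 := s2.setWord 14 0 (lastKey E (E i) N) with hs3
      have h3 : RamState.SameExcept [11, 14, 16] s' s3 := h2.setWord (by simp) _ _
      refine (achieves_updateDegrees (hL'.congr h3 (by decide)) he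
        (RamState.word_setWord_self _ _ _ _) (by rw [h3.1 4 (by decide)]; exact hR.degree)).mono ?_
      rintro c s4 ⟨h34, h4, hc⟩
      refine ⟨_, ⟨insert (E i) D, hD', (hs.trans h3 (by simp)).trans h34 (by simp),
        ⟨h4, fun e => ?_, ?_⟩, rfl⟩, ?_, ?_⟩
      · rw [h34.1 11 (by decide), hs3, RamState.word_setWord_of_ne _ _ _ (by decide), hs2,
          RamState.word_setWord_of_ne _ _ _ (by decide), hs1, RamState.word_setWord, if_pos rfl]
        by_cases h : e = E i
        · subst h; simp
        · rw [Function.update_of_ne h, hR.covered]; simp [h]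
      · rw [h34.1 16 (by decide), hs3, RamState.word_setWord_of_ne _ _ _ (by decide), hs2,
          RamState.word_setWord_self, Finset.card_insert_of_notMem he]
      · rw [h34.1 13 (by decide), h3.1 13 (by decide), hp]
      · have := liveEdges_insert (E := E) (N := N) he
        omega
    · have he : E i ∈ D := by
        by_contra h
        simp [RamTest.Holds, WordExp.eval, hp, hL'.elems, hR.covered, h] at hb
      rwa [Finset.insert_eq_of_mem he]
    · have he : E i ∈ D := by
        by_contra h
        simp [RamTest.Holds, WordExp.eval, hp, hL'.elems, hR.covered, h] at hb
      rw [Finset.insert_eq_of_mem he]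
      omega
  · have : ((withKey S x N).filter fun j => N ≤ j) = ∅ := by
      refine Finset.filter_false_of_mem fun j hj => ?_
      have := Finset.mem_range.1 (Finset.mem_filter.1 hj).1
      omega
    simp [this]
  · rintro c s' ⟨φ', ⟨D, hD, hs, hR, rfl⟩, hc⟩
    simp only [Nat.zero_le, Finset.filter_true] at hD
    subst hD
    exact ⟨hs, hR, by omega⟩

theorem coveredBy_insert (Q : Finset ℕ) (x : ℕ) :
    coveredBy S E N (insert x Q) = coveredBy S E N Q ∪ (withKey S x N).image E := by
  ext e
  simp only [mem_coveredBy, Finset.mem_union, Finset.mem_image, withKey, Finset.mem_filter,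
    Finset.mem_range, Finset.mem_insert]
  constructor
  · rintro ⟨j, hj, h | h, rfl⟩
    · exact Or.inr ⟨j, ⟨hj, h⟩, rfl⟩
    · exact Or.inl ⟨j, hj, h, rfl⟩
  · rintro (⟨j, hj, h, rfl⟩ | ⟨j, ⟨hj, h⟩, rfl⟩)
    · exact ⟨j, hj, Or.inr h, rfl⟩
    · exact ⟨j, hj, Or.inl h, rfl⟩

/-- The memory represents the greedily selected sets `Q`. -/
structure Selected (S E : ℕ → ℕ) (N k : ℕ) (Q : Finset ℕ) (s : RamState) : Prop where
  lists : ListsBuilt S E N s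
  repr : Represents S E N (coveredBy S E N Q) s
  left : s.word 15 0 + Q.card = k
  greedy : GreedyBound S E N k Q

theorem Selected.congr {k : ℕ} {Q : Finset ℕ} {A : List ℕ} {s s' : RamState}
    (h : Selected S E N k Q s) (hs : RamState.SameExcept A s s')
    (hA : ∀ a ∈ [1, 2, 4, 5, 6, 7, 8, 9, 10, 11, 15, 16], a ∉ A) : Selected S E N k Q s' where
  lists := h.lists.congr hs fun a ha => hA a (by simp at ha ⊢; omega)
  repr := ⟨by rw [hs.1 4 (hA 4 (by simp))]; exact h.repr.degree,
    by rw [hs.1 11 (hA 11 (by simp))]; exact h.repr.covered,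
    by rw [hs.1 16 (hA 16 (by simp))]; exact h.repr.size⟩
  left := by rw [hs.1 15 (hA 15 (by simp))]; exact h.left
  greedy := h.greedy

/-- The number of steps that the greedy algorithm may still spend on the lists by set and by
element. -/
def selectBudget (S E : ℕ → ℕ) (N : ℕ) (Q : Finset ℕ) : ℕ :=
  7 * liveEdges S N Q + 3 * liveEdges E N (coveredBy S E N Q)

/-- Every set of degree at least `v` owns exactly one edge of rank `v`, so the list of rank `v`
visits all candidates. A selected set has the maximal residual degree `v`. Residual degrees only
decrease, so a visited set that is rejected for its degree stays below `v`. -/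
theorem achieves_selectLevel {k v : ℕ} (hk : 1 ≤ k) (hv : 1 ≤ v)
    (hinj : ∀ i < N, ∀ j < N, S i = S j → E i = E j → i = j) {Q : Finset ℕ} {s : RamState}
    (hQ : Selected S E N k Q s) (h3 : s.word 3 0 = v)
    (h12 : s.word 12 0 = lastKey (edgeRank S) v N)
    (hmax : Q.card = k ∨ ∀ x, liveDegree S E N (coveredBy S E N Q) x ≤ v) :
    selectLevel.Achieves s fun c s' => RamState.SameExcept [4, 11, 12, 13, 14, 15, 16] s s' ∧
      ∃ Q', Selected S E N k Q' s' ∧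
        (Q'.card = k ∨ ∀ x, liveDegree S E N (coveredBy S E N Q') x ≤ v - 1) ∧
        c + selectBudget S E N Q' ≤
          6 * (withKey (edgeRank S) v N).card + selectBudget S E N Q + 1 := by
  refine (achieves_walkList (κ := v) (key := edgeRank S) (N := N) (fun i s' φ =>
    RamState.SameExcept [4, 11, 12, 13, 14, 15, 16] s s' ∧ ∃ Q' : Finset ℕ,
    Selected S E N k Q' s' ∧
    (Q'.card = k ∨ ((∀ x, liveDegree S E N (coveredBy S E N Q') x ≤ v) ∧
      ∀ j < N, i ≤ j → edgeRank S j = v → liveDegree S E N (coveredBy S E N Q') (S j) < v)) ∧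
      φ = 6 * (withKey (edgeRank S) v i).card + selectBudget S E N Q')
    ?_ ?_ ?_ ?_ N le_rfl s _
    ⟨.refl _ _, Q, hQ, hmax.imp_right fun h => ⟨h, fun j _ _ => by omega⟩, rfl⟩ h12).mono ?_
  · rintro i s' φ ⟨hs, Q', hQ', -⟩
    exact hQ'.lists.byRank.2
  · rintro i s' φ y ⟨hs, Q', hQ', h⟩
    exact ⟨hs.setWord (by simp) _ _, Q', hQ'.congr
      ((RamState.SameExcept.refl [12] _).setWord (by simp) _ _) (by decide), h⟩
  · rintro i s' φ hi ⟨hs, Q', hQ', h, hφ⟩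
    refine ⟨hs, Q', hQ', h.imp_right fun h => ⟨h.1, fun j hj hij hr => ?_⟩, ?_⟩
    · have : j ≠ i := fun h => hi (h ▸ hr)
      exact h.2 j hj (by omega) hr
    · rw [hφ, card_withKey_succ, if_neg hi, add_zero]
  · rintro i s' φ hiN hi ⟨hs, Q', hQ', h, rfl⟩ hp
    have hcard : (withKey (edgeRank S) v (i + 1)).card =
        (withKey (edgeRank S) v i).card + 1 := by
      rw [card_withKey_succ, if_pos hi]
    have h3' : s'.word 3 0 = v := by rw [hs.1 3 (by decide), h3]
    have hL := hQ'.lists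
    have hleft := hQ'.left
    refine RamProg.achieves_ite (fun hb => ?_) fun hb => RamProg.achieves_skip
      ⟨6 * (withKey (edgeRank S) v i).card + selectBudget S E N Q', ⟨hs, Q', hQ', ?_, rfl⟩, hp,
        by omega⟩
    · simp only [RamTest.Holds, WordExp.eval, hp, h3', hL.sets, hQ'.repr.degree,
        Nat.add_sub_cancel] at hb
      obtain ⟨hb1, hb2⟩ := hb
      -- A positive counter of remaining sets excludes `Q'.card = k`.
      have h' := h.resolve_left (by omega)
      have hx : S i ∉ Q' := by
        intro hx
        rw [liveDegree_eq_zero hx] at hb1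
        omega
      have hcard' := Finset.card_insert_of_notMem hx
      have h0 := RamState.SameExcept.refl [13, 15] s'
      refine RamProg.achieves_seq (RamProg.achieves_setWord_of (I := 0)
        (V := s'.word 15 0 - 1) rfl (by simp [WordExp.eval]) ?_)
      set s1 := s'.setWord 15 0 (s'.word 15 0 - 1) with hs1
      have h1 : RamState.SameExcept [13, 15] s' s1 := h0.setWord (by simp) _ _
      refine RamProg.achieves_seq (RamProg.achieves_setWord_of (I := 0)
        (V := lastKey S (S i) N) rfl (by simp [WordExp.eval, h1.1 12 (by decide),
          h1.1 1 (by decide), h1.1 5 (by decide), hp, hL.sets, hL.bySet.1]) ?_)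
      set s2 := s1.setWord 13 0 (lastKey S (S i) N) with hs2
      have h2 : RamState.SameExcept [13, 15] s' s2 := h1.setWord (by simp) _ _
      have hR2 : Represents S E N (coveredBy S E N Q') s2 :=
        ⟨by rw [h2.1 4 (by decide)]; exact hQ'.repr.degree,
          by rw [h2.1 11 (by decide)]; exact hQ'.repr.covered,
          by rw [h2.1 16 (by decide)]; exact hQ'.repr.size⟩
      refine (achieves_coverSet (hL.congr h2 (by decide)) hR2
        (RamState.word_setWord_self _ _ _ _)).mono ?_
      rintro c s4 ⟨h24, hR4, hc⟩
      rw [← coveredBy_insert] at hR4 hc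
      have hmono : coveredBy S E N Q' ⊆ coveredBy S E N (insert (S i) Q') := by
        rw [coveredBy_insert]; exact Finset.subset_union_left
      refine ⟨6 * (withKey (edgeRank S) v i).card + selectBudget S E N (insert (S i) Q'),
        ⟨(hs.trans h2 (by simp)).trans h24 (by simp), insert (S i) Q',
        ⟨(hL.congr h2 (by decide)).congr h24 (by decide), hR4, ?_, ?_⟩, ?_, rfl⟩, ?_, ?_⟩
      · rw [h24.1 15 (by decide), hs2, RamState.word_setWord_of_ne _ _ _ (by decide), hs1,
          RamState.word_setWord_self]
        omega
      · exact hQ'.greedy.insert hk hinj hx fun y => (h'.1 y).trans hb1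
      · refine Or.inr ⟨fun y => (liveDegree_anti hmono y).trans (h'.1 y), fun j hj hij hr => ?_⟩
        by_cases hji : j = i
        · subst hji
          rw [liveDegree_eq_zero (Finset.mem_insert_self _ _)]
          omega
        · exact (liveDegree_anti hmono _).trans_lt (h'.2 j hj (by omega) hr)
      · rw [h24.1 12 (by decide), h2.1 12 (by decide), hp]
      · have h5 := liveEdges_insert (E := S) (N := N) hx
        simp only [selectBudget]
        omega
    · by_cases hk' : Q'.card = k
      · exact Or.inl hk'
      · have h' := h.resolve_left hk'
        refine Or.inr ⟨h'.1, fun j hj hij hr => ?_⟩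
        by_cases hji : j = i
        · subst hji
          by_contra hlt
          refine hb ?_
          simp only [RamTest.Holds, WordExp.eval, hp, h3', hL.sets, hQ'.repr.degree,
            Nat.add_sub_cancel]
          omega
        · exact h'.2 j hj (by omega) hr
  · rintro c s' ⟨φ', ⟨hs, Q', hQ', h, rfl⟩, hc⟩
    refine ⟨hs, Q', hQ', h.imp_right fun h x => ?_, by omega⟩
    by_contra hlt
    -- A set still of residual degree `v` would have original degree at least `v`, hence an edge of
    -- rank `v`, and would have been visited.
    have hle : liveDegree S E N (coveredBy S E N Q') x ≤ (withKey S x N).card :=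
      Finset.card_le_card fun j hj => by
        simp only [withKey, Finset.mem_filter] at hj ⊢
        exact ⟨hj.1, hj.2.1⟩
    obtain ⟨j, hj, rfl, hr⟩ := exists_edgeRank_eq S x hv (N := N) (by omega)
    have := h.2 j hj (Nat.zero_le _) hr
    omega

/-- The program computes an estimate from a greedy solution, in linear time. -/
theorem achieves_recoverProgram {k : ℕ} {s : RamState} (hk : 1 ≤ k) (hN : s.word 0 3 = N)
    (h0 : s.word 0 2 = k) (hS : s.word 1 = S) (hE : s.word 2 = E)
    (hz : ∀ a, 3 ≤ a → ∀ i, s.word a i = 0)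
    (hinj : ∀ i < N, ∀ j < N, S i = S j → E i = E j → i = j) :
    recoverProgram.Achieves s fun c s' => (∃ Q : Finset ℕ, Q.card ≤ k ∧
      (∀ P : Finset ℕ, P.card ≤ k → (1 - 1 / Real.exp 1) * ((coveredBy S E N P).card : ℝ) ≤
        (coveredBy S E N Q).card) ∧
      s'.real 1 0 = (1 - s.real 0 0 / 4) * (coveredBy S E N Q).card / s.real 0 1) ∧
      c ≤ 29 * N + 4 := by
  have hL0 : ListsBuilt S E 0 s := by
    refine ⟨hS, hE, ⟨fun _ => ?_, fun _ h => ?_⟩, ⟨fun _ => ?_, fun _ h => ?_⟩,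
      ⟨fun _ => ?_, fun _ h => ?_⟩⟩
    all_goals first | omega | exact hz _ (by norm_num) _
  refine RamProg.achieves_seq ((achieves_buildLists hL0 (hz 3 le_rfl 0)
    (hz 4 (by norm_num)) hN).mono ?_)
  rintro c1 s1 ⟨hL1, h13, h14, h01, hc1⟩
  refine RamProg.achieves_seq (RamProg.achieves_setWord_of (I := 0) (V := k) rfl
    (by simp [WordExp.eval, h01.1 0 (by decide), h0]) ?_)
  set s2 := s1.setWord 15 0 k with hs2
  have h12 : RamState.SameExcept [15] s1 s2 := (RamState.SameExcept.refl _ _).setWord (by simp) _ _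
  have h02 : RamState.SameExcept [3, 4, 5, 6, 7, 8, 9, 10, 15] s s2 :=
    RamState.SameExcept.trans (B := [15]) ⟨fun a ha => h01.1 a (by simp at ha ⊢; omega), h01.2⟩
      h12 (by simp)
  have hsel : Selected S E N k ∅ s2 := by
    refine ⟨hL1.congr h12 (by decide), ⟨fun x => ?_, fun e => ?_, ?_⟩, ?_, greedyBound_empty k⟩
    · rw [h12.1 4 (by decide), h14]
      simp [withKey, liveDegree, coveredBy]
    · rw [h02.1 11 (by decide), hz 11 (by norm_num)]
      simp [coveredBy]
    · rw [h02.1 16 (by decide), hz 16 (by norm_num)]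
      simp [coveredBy]
    · rw [hs2, RamState.word_setWord_self]; simp
  have hloop := RamProg.achieves_while (b := .wordLe (.lit 1) (.var 3))
    (P := .seq (.setWord 12 (.lit 0) (.get 9 (.var 3)))
      (.seq selectLevel (.setWord 3 (.lit 0) (.sub (.var 3) (.lit 1)))))
    -- The steps left: four per remaining level, six per edge whose rank is still to come, and the
    -- budget for lists by set and by element. Every edge has one rank, so the middle term is linear
    -- in `N` over all levels.
    (fun s' φ => s'.real = s.real ∧ ∃ Q, Selected S E N k Q s' ∧
      (Q.card = k ∨ ∀ x, liveDegree S E N (coveredBy S E N Q) x ≤ s'.word 3 0) ∧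
      φ = 4 * s'.word 3 0 +
        6 * ((Finset.range N).filter fun j => edgeRank S j ≤ s'.word 3 0).card +
          selectBudget S E N Q) (by
      rintro s3 φ ⟨hr, Q, hQ, hmax, rfl⟩ hb
      simp only [RamTest.Holds, WordExp.eval] at hb
      obtain ⟨v, hv⟩ : ∃ v, s3.word 3 0 = v + 1 := ⟨s3.word 3 0 - 1, by omega⟩
      rw [hv] at hmax
      refine RamProg.achieves_seq (RamProg.achieves_setWord_of (I := 0)
        (V := lastKey (edgeRank S) (v + 1) N) rfl
        (by simp [WordExp.eval, hv, hQ.lists.byRank.1]) ?_)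
      set s4 := s3.setWord 12 0 (lastKey (edgeRank S) (v + 1) N) with hs4
      have h34 : RamState.SameExcept [12] s3 s4 :=
        (RamState.SameExcept.refl _ _).setWord (by simp) _ _
      have h43 : s4.word 3 0 = v + 1 := by rw [h34.1 3 (by decide), hv]
      refine RamProg.achieves_seq ((achieves_selectLevel hk (by omega) hinj
        (hQ.congr h34 (by decide)) h43 (RamState.word_setWord_self _ _ _ _) hmax).mono ?_)
      rintro c s5 ⟨h45, Q', hQ', hmax', hc⟩
      have h53 : s5.word 3 0 = v + 1 := by rw [h45.1 3 (by decide), h43]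
      refine RamProg.achieves_setWord_of (I := 0) (V := v) rfl (by simp [WordExp.eval, h53]) ?_
      set s6 := s5.setWord 3 0 v with hs6
      have h56 : RamState.SameExcept [3] s5 s6 :=
        (RamState.SameExcept.refl _ _).setWord (by simp) _ _
      have h63 : s6.word 3 0 = v := RamState.word_setWord_self _ _ _ _
      refine ⟨_, ⟨?_, Q', hQ'.congr h56 (by decide), ?_, rfl⟩, ?_⟩
      · rw [h56.2, h45.2, h34.2, hr]
      · rw [h63]; exact hmax'
      · rw [h63, hv]
        have hcount : ((Finset.range N).filter fun j => edgeRank S j ≤ v + 1).card =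
            ((Finset.range N).filter fun j => edgeRank S j ≤ v).card +
              (withKey (edgeRank S) (v + 1) N).card := by
          rw [withKey, ← Finset.card_union_of_disjoint]
          · congr 1
            ext j
            simp only [Finset.mem_union, Finset.mem_filter]
            constructor
            · rintro ⟨h1, h2⟩
              rcases Nat.le_succ_iff.1 h2 with h | h
              · exact Or.inl ⟨h1, h⟩
              · exact Or.inr ⟨h1, h⟩
            · rintro (⟨h1, h2⟩ | ⟨h1, h2⟩)
              · exact ⟨h1, by omega⟩
              · exact ⟨h1, by omega⟩
          · rw [Finset.disjoint_left]
            intro j hj hj'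
            have h1 := (Finset.mem_filter.1 hj).2
            have h2 := (Finset.mem_filter.1 hj').2
            omega
        omega)
  have h23 : s2.word 3 0 = N := by rw [h12.1 3 (by decide), h13]
  refine RamProg.achieves_seq ((hloop _ s2 ⟨h02.2, ∅, hsel, Or.inr fun x => ?_, rfl⟩).mono ?_)
  · rw [h23]
    exact (Finset.card_filter_le _ _).trans (by simp)
  · rintro c s3 ⟨φ', ⟨hr, Q, hQ, hmax, rfl⟩, hb, hc⟩
    simp only [RamTest.Holds, WordExp.eval] at hb
    refine RamProg.achieves_setReal ⟨⟨Q, ?_, fun P hP => ?_, ?_⟩, ?_⟩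
    · have := hQ.left; omega
    -- The loop ends at level zero, where the invariant says that `k` sets are chosen or no residual
    -- edge is left.
    · refine hQ.greedy.le_card hk (hmax.imp_right fun h x => ?_) hP
      have := h x
      omega
    · simp [RamState.real_setReal, RealExp.eval, WordExp.eval, hr, hQ.repr.size]
    · have e1 : ((Finset.range N).filter fun j => edgeRank S j ≤ s2.word 3 0).card ≤ N :=
        (Finset.card_filter_le _ _).trans (by simp)
      have e2 : liveEdges S N ∅ ≤ N := (Finset.card_filter_le _ _).trans (by simp)
      have e3 : liveEdges E N (coveredBy S E N ∅) ≤ N :=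
        (Finset.card_filter_le _ _).trans (by simp)
      have e4 : selectBudget S E N ∅ ≤ 10 * N := by
        simp only [selectBudget]; omega
      rw [h23] at e1 hc
      omega

end GreedyProgram

/-! ### Good events of the hash function -/

theorem holdsWithProb_of_measure_le {Ω : Type*} [MeasurableSpace Ω] {μ : Measure Ω}
    [IsProbabilityMeasure μ] {δ : ℝ} (hδ : 0 ≤ δ) {P : Ω → Prop} {B : Set Ω}
    (hB : MeasurableSet B) (hμ : μ B ≤ ENNReal.ofReal δ) (hP : ∀ ω, ω ∉ B → P ω) :
    HoldsWithProb μ (1 - δ) P := by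
  refine ⟨Bᶜ, hB.compl, ?_, fun ω hω => hP ω hω⟩
  rw [prob_compl_eq_one_sub hB, ENNReal.ofReal_sub _ hδ, ENNReal.ofReal_one]
  exact tsub_le_tsub_left hμ 1

theorem holdsWithProb_of_forall {Ω : Type*} [MeasurableSpace Ω] {μ : Measure Ω}
    [IsProbabilityMeasure μ] {δ : ℝ} (hδ : 0 ≤ δ) {P : Ω → Prop} (hP : ∀ ω, P ω) :
    HoldsWithProb μ (1 - δ) P :=
  holdsWithProb_of_measure_le hδ MeasurableSet.empty (by simp) fun ω _ => hP ω

section Events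

variable {Ω : Type*} [MeasurableSpace Ω] {μ : Measure Ω} [IsProbabilityMeasure μ] {n m t : ℕ}
  {ħ : Ω → Fin m → unitInterval} {p M D : ℝ} {r : ℕ}

theorem card_filter_sub_eq_sum (h : Fin m → unitInterval) (F : Finset (Fin m)) :
    ((F.filter fun e => (h e : ℝ) ≤ p).card : ℝ) - p * F.card =
      ∑ e, (if e ∈ F then 1 else 0) * centredInd p (h e) := by
  simp_rw [centredInd, ite_mul, one_mul, zero_mul]
  rw [Finset.sum_ite_mem, Finset.univ_inter, Finset.sum_sub_distrib, Finset.sum_boole,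
    Finset.sum_const, nsmul_eq_mul, mul_comm p]

/-- A union bound over the `k`-element families. Each covers at most `OPT` elements, so the same `M`
and `D` serve for all. -/
theorem IsWiseIndependentHash.holdsWithProb_cover (hħ : IsWiseIndependentHash μ t ħ)
    (X : Finset (Fin n × Fin m)) {k : ℕ} (hk : k ≤ n) (hp0 : 0 ≤ p) (hp1 : p ≤ 1)
    (hM : p * optCover k X ≤ M) (hr : 1 ≤ r) (hrt : 2 * r ≤ t) (hrM : (2 * r : ℕ) ≤ M)
    (hD : 0 < D) (hDM : Real.exp 4 * (2 * r : ℕ) * M ≤ D ^ 2) {δ : ℝ} (hδ : 0 ≤ δ)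
    (hcount : (n : ℝ) ^ k * Real.exp (-(2 * r : ℕ)) ≤ δ) :
    HoldsWithProb μ (1 - δ) fun ω => ∀ P : Finset (Fin n), P.card = k →
      |((coverNbrs (sampledGraph (ħ ω) p X) P).card : ℝ) - p * (coverNbrs X P).card| ≤ D := by
  have hgm : ∀ (F : Finset (Fin m)) e,
      Measurable fun u => (if e ∈ F then (1 : ℝ) else 0) * centredInd p u :=
    fun F e => (measurable_centredInd p).const_mul _
  let B : Finset (Fin n) → Set Ω := fun P => {ω | D ≤ |∑ e,
    (if e ∈ coverNbrs X P then (1 : ℝ) else 0) * centredInd p (ħ ω e)|}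
  have hBm : ∀ P, MeasurableSet (B P) := fun P =>
    measurableSet_le measurable_const (hħ.measurable_sum (hgm (coverNbrs X P))).abs
  have hBμ : ∀ P ∈ (Finset.univ : Finset (Fin n)).powersetCard k,
      μ (B P) ≤ ENNReal.ofReal (Real.exp (-(2 * r : ℕ))) := by
    intro P hP
    refine hħ.measure_abs_sum_ge_le (fun e => ?_) (fun e => ?_) hp0 hp1 ?_ hr hrt hrM hD hDM
    · split_ifs <;> norm_num
    · split_ifs <;> norm_num
    · rw [Finset.sum_boole]
      refine le_trans (mul_le_mul_of_nonneg_left ?_ hp0) hM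
      rw [Finset.filter_mem_eq_inter, Finset.univ_inter]
      exact_mod_cast card_coverNbrs_le_optCover hk X (Finset.mem_powersetCard.1 hP).2.le
  refine holdsWithProb_of_measure_le hδ
    (Finset.measurableSet_biUnion ((Finset.univ : Finset (Fin n)).powersetCard k)
      fun P _ => hBm P) ?_ fun ω hω P hP => ?_
  · refine (measure_biUnion_finset_le _ _).trans ((Finset.sum_le_sum hBμ).trans ?_)
    rw [Finset.sum_const, Finset.card_powersetCard, Finset.card_univ, Fintype.card_fin,
      nsmul_eq_mul, ← ENNReal.ofReal_natCast, ← ENNReal.ofReal_mul (by positivity)]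
    refine ENNReal.ofReal_le_ofReal (le_trans ?_ hcount)
    refine mul_le_mul_of_nonneg_right ?_ (Real.exp_pos _).le
    exact_mod_cast Nat.choose_le_pow n k
  · rw [coverNbrs_sampledGraph, card_filter_sub_eq_sum]
    simp only [Set.mem_iUnion, not_exists] at hω
    exact (not_le.1 (hω P (Finset.mem_powersetCard.2 ⟨Finset.subset_univ _, hP⟩))).le

/-- The tail bound with deviation `D = M`, added to a mean of at most `M`. -/
theorem IsWiseIndependentHash.holdsWithProb_sum (hħ : IsWiseIndependentHash μ t ħ)
    {w : Fin m → ℝ} (hw0 : ∀ e, 0 ≤ w e) (hw1 : ∀ e, w e ≤ 1) (hp0 : 0 ≤ p) (hp1 : p ≤ 1)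
    (hM : p * ∑ e, w e ≤ M) (hr : 1 ≤ r) (hrt : 2 * r ≤ t)
    (hrM : Real.exp 4 * (2 * r : ℕ) ≤ M) {δ : ℝ} (hδ : Real.exp (-(2 * r : ℕ)) ≤ δ) :
    HoldsWithProb μ (1 - δ) fun ω =>
      ∑ e, w e * (if (ħ ω e : ℝ) ≤ p then 1 else 0) ≤ 2 * M := by
  have hr0 : (0 : ℝ) < (2 * r : ℕ) := by exact_mod_cast (by omega : 0 < 2 * r)
  have h4 : 1 ≤ Real.exp 4 := Real.one_le_exp (by norm_num)
  have hrM' : ((2 * r : ℕ) : ℝ) ≤ M := by nlinarith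
  have hM0 : 0 < M := hr0.trans_le hrM'
  have hgm : ∀ e, Measurable fun u => w e * centredInd p u :=
    fun e => (measurable_centredInd p).const_mul _
  refine holdsWithProb_of_measure_le ((Real.exp_pos _).le.trans hδ)
    (B := {ω | M ≤ |∑ e, w e * centredInd p (ħ ω e)|})
    (measurableSet_le measurable_const (hħ.measurable_sum hgm).abs)
    ((hħ.measure_abs_sum_ge_le hw0 hw1 hp0 hp1 hM hr hrt hrM' hM0 (by nlinarith)).trans
      (ENNReal.ofReal_le_ofReal hδ)) fun ω hω => ?_
  have h1 : ∑ e, w e * centredInd p (ħ ω e) ≤ M := (le_abs_self _).trans (le_of_not_ge hω)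
  simp_rw [centredInd, mul_sub] at h1
  rw [Finset.sum_sub_distrib, ← Finset.sum_mul, mul_comm _ p] at h1
  linarith

end Events

/-! ### The estimate of the recover function -/

section Estimate

variable {n m k : ℕ} {ε p : ℝ}

/-- `y` is the estimate from a solution in `H` that is optimal up to the factor `α`. -/
def IsEstimate (k : ℕ) (ε p α : ℝ) (H : Finset (Fin n × Fin m)) (y : ℝ) : Prop :=
  ∃ P : Finset (Fin n), P.card ≤ k ∧ α * optCover k H ≤ (coverNbrs H P).card ∧
    y = (1 - ε / 4) * (coverNbrs H P).card / p

/-- The factor `1 - ε/4` compensates the sampling error from above: `(1 - ε/4)(1 + ε/4) ≤ 1`. From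
below the losses are `ε/4` for this factor, `ε/4` for sampling and `3cε ≤ ε/2` for truncation, which
is where `c ≤ 1/6` enters. -/
theorem IsEstimate.isApproximation (hk : 1 ≤ k) (hkn : k ≤ n) (hε0 : 0 < ε) (hε1 : ε < 1 / 2)
    (hp : 0 < p) {α c : ℝ} (hα0 : 0 ≤ α) (hα1 : α ≤ 1) (hc0 : 0 < c) (hc1 : c ≤ 1 / 6)
    {h : Fin m → unitInterval} {X H : Finset (Fin n × Fin m)}
    (hH : IsSubsampledGraph h p (bucketThreshold n k (c * ε)) X H)
    (hgood : ∀ P : Finset (Fin n), P.card = k →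
      |((coverNbrs (sampledGraph h p X) P).card : ℝ) - p * (coverNbrs X P).card| ≤
        ε / 4 * (p * optCover k X)) {y : ℝ} (hy : IsEstimate k ε p α H y) :
    IsApproximation (α - ε) (optCover k X) y := by
  obtain ⟨P, hP, hopt, rfl⟩ := hy
  obtain ⟨P0, hP0, hX⟩ := exists_card_coverNbrs_eq_optCover hkn X
  obtain ⟨P', hPP', -, hP'⟩ :=
    Finset.exists_subsuperset_card_eq (Finset.subset_univ P) hP (by simpa)
  have hsub := hH.subset_sampledGraph
  have hup : ((coverNbrs H P).card : ℝ) ≤ (1 + ε / 4) * (p * optCover k X) := by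
    have h1 : ((coverNbrs H P).card : ℝ) ≤ (coverNbrs (sampledGraph h p X) P').card := by
      exact_mod_cast Finset.card_le_card (coverNbrs_mono hsub hPP')
    have h2 := (abs_le.1 (hgood P' hP')).2
    have h3 : p * ((coverNbrs X P').card : ℝ) ≤ p * optCover k X := by
      refine mul_le_mul_of_nonneg_left ?_ hp.le
      exact_mod_cast card_coverNbrs_le_optCover hkn X hP'.le
    linarith
  have hlow : (1 - ε / 2) * (1 - ε / 4) * (p * optCover k X) ≤ optCover k H := by
    have hce : c * ε ≤ ε / 6 := by nlinarith
    have h1 := le_optCover_of_degree_bound hk hkn (ε := c * ε) (by positivity) (by linarith)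
      hsub hH.edgesAt_eq_or hP0
    have h2 := (abs_le.1 (hgood P0 hP0)).1
    rw [hX] at h2
    have h3 : (1 - ε / 4) * (p * optCover k X) ≤
        (coverNbrs (sampledGraph h p X) P0).card := by linarith
    have h4 : (0 : ℝ) ≤ (coverNbrs (sampledGraph h p X) P0).card := by positivity
    calc (1 - ε / 2) * (1 - ε / 4) * (p * optCover k X)
        ≤ (1 - ε / 2) * (coverNbrs (sampledGraph h p X) P0).card := by
          rw [mul_assoc]
          exact mul_le_mul_of_nonneg_left h3 (by linarith)
      _ ≤ (1 - 3 * (c * ε)) * (coverNbrs (sampledGraph h p X) P0).card :=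
          mul_le_mul_of_nonneg_right (by linarith) h4
      _ ≤ _ := h1
  have hO : (0 : ℝ) ≤ optCover k X := by positivity
  set O : ℝ := (optCover k X : ℝ)
  set g : ℝ := ((coverNbrs H P).card : ℝ)
  have hg : 0 ≤ g := by positivity
  have he : 0 ≤ 1 - ε / 4 := by linarith
  refine ⟨by positivity, Or.inr ⟨by linarith, ?_, ?_⟩⟩
  · rw [le_div_iff₀ hp]
    have h1 : α * ((1 - ε / 2) * (1 - ε / 4) * (p * O)) ≤ g :=
      (mul_le_mul_of_nonneg_left hlow hα0).trans hopt
    have h2 := mul_le_mul_of_nonneg_left h1 he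
    refine le_trans ?_ h2
    have h3 : (α - ε) ≤ (1 - ε / 4) * (α * ((1 - ε / 2) * (1 - ε / 4))) := by
      have h4 : (1 - ε) ≤ (1 - ε / 4) * ((1 - ε / 2) * (1 - ε / 4)) := by
        -- The difference of the two sides is `ε²(10 - ε)/32`.
        nlinarith [mul_nonneg (sq_nonneg ε) (by linarith : 0 ≤ 10 - ε)]
      have h5 := mul_le_mul_of_nonneg_left h4 hα0
      nlinarith
    have h6 : 0 ≤ p * O := by positivity
    calc (α - ε) * O * p = (α - ε) * (p * O) := by ring
      _ ≤ (1 - ε / 4) * (α * ((1 - ε / 2) * (1 - ε / 4))) * (p * O) :=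
          mul_le_mul_of_nonneg_right h3 h6
      _ = _ := by ring
  · rw [div_le_iff₀ hp]
    have h2 := mul_le_mul_of_nonneg_left hup he
    refine h2.trans ?_
    have h6 : 0 ≤ p * O := by positivity
    have h7 : (1 - ε / 4) * ((1 + ε / 4) * (p * O)) = (p * O) - (ε / 4) ^ 2 * (p * O) := by ring
    have h8 : 0 ≤ (ε / 4) ^ 2 * (p * O) := by positivity
    linarith

/-- The edges of a stored sketch. -/
def storedEdges (l : List ((Fin n × Fin m) × (Fin n × Fin m))) : Finset (Fin n × Fin m) :=
  l.toFinset.image Prod.snd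

/-- Each edge is stored once, with itself as the information. -/
def IsEdgeList (l : List ((Fin n × Fin m) × (Fin n × Fin m))) : Prop :=
  l.Nodup ∧ ∀ y ∈ l, y.1 = y.2

/-- Transfers the guarantee from numbered sets and elements to `Fin n` and `Fin m`. The default `0`
beyond the list is never read as an edge, and storing each edge once excludes parallel edges. -/
theorem exists_recoverProgram_run (hk : 1 ≤ k) (hkn : k ≤ n)
    {l : List ((Fin n × Fin m) × (Fin n × Fin m))} (hl : IsEdgeList l) :
    ∃ c s, RamRun recoverProgram (recoverInput k ε p l) c s ∧
      IsEstimate k ε p (1 - 1 / Real.exp 1) (storedEdges l) (s.real 1 0) ∧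
      c ≤ 29 * l.length + 4 := by
  set S : ℕ → ℕ := fun i => (l.map fun y => (y.2.1 : ℕ)).getD i 0 with hS
  set E : ℕ → ℕ := fun i => (l.map fun y => (y.2.2 : ℕ)).getD i 0 with hE
  have hSj : ∀ j (hj : j < l.length), S j = (l[j].2.1 : ℕ) := fun j hj => by
    simp [hS, hj]
  have hEj : ∀ j (hj : j < l.length), E j = (l[j].2.2 : ℕ) := fun j hj => by
    simp [hE, hj]
  have hcov : ∀ Q : Finset ℕ, coveredBy S E l.length Q =
      (coverNbrs (storedEdges l) (Finset.univ.filter fun x => (x : ℕ) ∈ Q)).image Fin.val := by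
    intro Q
    ext e
    simp only [mem_coveredBy, Finset.mem_image, mem_coverNbrs, storedEdges, Finset.mem_filter,
      Finset.mem_univ, true_and, List.mem_toFinset]
    constructor
    · rintro ⟨j, hj, h1, rfl⟩
      refine ⟨l[j].2.2, ⟨l[j].2.1, by rwa [← hSj j hj], l[j], List.getElem_mem hj, rfl⟩,
        (hEj j hj).symm⟩
    · rintro ⟨e, ⟨x, hx, y, hy, hyx⟩, rfl⟩
      obtain ⟨j, hj, rfl⟩ := List.getElem_of_mem hy
      refine ⟨j, hj, ?_, ?_⟩
      · rw [hSj j hj, hyx]; exact hx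
      · rw [hEj j hj, hyx]
  have hcard : ∀ Q : Finset ℕ, (coveredBy S E l.length Q).card =
      (coverNbrs (storedEdges l) (Finset.univ.filter fun x => (x : ℕ) ∈ Q)).card := fun Q => by
    rw [hcov, Finset.card_image_of_injective _ Fin.val_injective]
  have hinj : ∀ i < l.length, ∀ j < l.length, S i = S j → E i = E j → i = j := by
    intro i hi j hj h1 h2
    rw [hSj i hi, hSj j hj] at h1
    rw [hEj i hi, hEj j hj] at h2
    have h3 : l[i].2 = l[j].2 := Prod.ext (Fin.ext h1) (Fin.ext h2)
    have h4 : l[i].1 = l[j].1 := by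
      rw [hl.2 _ (List.getElem_mem hi), hl.2 _ (List.getElem_mem hj), h3]
    exact (hl.1.getElem_inj_iff).1 (Prod.ext h4 h3)
  obtain ⟨c, s, hrun, ⟨Q, hQ, hgr, hval⟩, hc⟩ := achieves_recoverProgram
    (s := recoverInput k ε p l) (S := S) (E := E) (N := l.length) hk (by simp [recoverInput])
    (by simp [recoverInput]) (by ext; simp [recoverInput, hS]) (by ext; simp [recoverInput, hE])
    (fun a ha i => by
      have h0 : a ≠ 0 := by omega
      have h1 : a ≠ 1 := by omega
      have h2 : a ≠ 2 := by omega
      simp [recoverInput, h0, h1, h2]) hinj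
  refine ⟨c, s, hrun, ⟨Finset.univ.filter fun x => (x : ℕ) ∈ Q, ?_, ?_, ?_⟩, hc⟩
  · refine le_trans ?_ hQ
    refine Finset.card_le_card_of_injOn Fin.val (fun x hx => ?_) Fin.val_injective.injOn
    simpa using hx
  · obtain ⟨P, hP, hopt⟩ := exists_card_coverNbrs_eq_optCover hkn (storedEdges l)
    have h1 := hgr (P.image Fin.val) (Finset.card_image_le.trans hP.le)
    rw [hcard, hcard] at h1
    have h2 : (Finset.univ.filter fun x : Fin n => (x : ℕ) ∈ P.image Fin.val) = P := by
      ext x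
      simp [Fin.val_inj]
    rwa [h2, hopt] at h1
  · rw [hval, hcard]
    simp [recoverInput]

/-- For `α ≤ 1 - 1/e` the value is by definition the output of the greedy program; for larger `α` an
optimal solution in the sketch is used. Lists that are no edge lists get the dummy value `0`. -/
theorem exists_estimate (hk : 1 ≤ k) (hkn : k ≤ n) {α : ℝ} (hα1 : α ≤ 1)
    (l : List ((Fin n × Fin m) × (Fin n × Fin m))) :
    ∃ y, IsEdgeList l → IsEstimate k ε p α (storedEdges l) y ∧
      (α ≤ 1 - 1 / Real.exp 1 → ∃ c s, RamRun recoverProgram (recoverInput k ε p l) c s ∧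
        s.real 1 0 = y ∧ c ≤ 29 * l.length + 4) := by
  by_cases hl : IsEdgeList l
  · by_cases hα : α ≤ 1 - 1 / Real.exp 1
    · obtain ⟨c, s, hrun, ⟨P, hP, hopt, hy⟩, hc⟩ :=
        exists_recoverProgram_run (ε := ε) (p := p) hk hkn hl
      refine ⟨s.real 1 0, fun _ => ⟨⟨P, hP, le_trans ?_ hopt, hy⟩, fun _ => ⟨c, s, hrun, rfl, hc⟩⟩⟩
      exact mul_le_mul_of_nonneg_right hα (by positivity)
    · obtain ⟨P, hP, hopt⟩ := exists_card_coverNbrs_eq_optCover hkn (storedEdges l)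
      refine ⟨_, fun _ => ⟨⟨P, hP.le, ?_, rfl⟩, fun h => absurd h hα⟩⟩
      rw [hopt]
      exact mul_le_of_le_one_left (by positivity) hα1
  · exact ⟨0, fun h => absurd h hl⟩

theorem isEdgeList_of_isStored {h : Fin m → unitInterval} {T : ℝ≥0}
    {X : Finset (Fin n × Fin m)} {L : Fin 1 → List ((Fin n × Fin m) × (Fin n × Fin m))}
    (hL : (kCoverSketch h p T).IsStored X L) :
    IsEdgeList (L 0) ∧ IsSubsampledGraph h p T X (storedEdges (L 0)) := by
  obtain ⟨hnd, hout⟩ := hL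
  obtain ⟨H, hH, hY⟩ := (kCoverSketch_isOutput_iff h p T X _).1 hout
  have h0 : (L 0).toFinset = H.image fun x => (x, x) := congrFun hY 0
  refine ⟨⟨hnd 0, fun y hy => ?_⟩, ?_⟩
  · rw [← List.mem_toFinset, h0] at hy
    obtain ⟨x, -, rfl⟩ := Finset.mem_image.1 hy
    rfl
  · rw [storedEdges, h0, Finset.image_image]
    simpa [Function.comp_def] using hH

end Estimate

/-! ### The parameters -/

theorem log_le_of_lt_half {x : ℝ} (h0 : 0 < x) (h1 : x < 1 / 2) : 0.69 ≤ Real.log (1 / x) := by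
  have h2 : (2 : ℝ) ≤ 1 / x := by rw [le_div_iff₀ h0]; linarith
  have h3 := Real.log_le_log (by norm_num) h2
  linarith [Real.log_two_gt_d9]

theorem log_hundredth_le {x : ℝ} (h0 : 0 < x) (h1 : x < 1 / 2) :
    Real.log (1 / (1 / 100 * x)) ≤ 8 * Real.log (1 / x) := by
  have h2 : (2 : ℝ) ≤ 1 / x := by rw [le_div_iff₀ h0]; linarith
  have h3 := Real.log_le_log (by norm_num) h2
  have h4 : Real.log 100 ≤ 7 * Real.log 2 := by
    have : (7 : ℝ) * Real.log 2 = Real.log (2 ^ 7) := by rw [Real.log_pow]; norm_num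
    rw [this]
    exact Real.log_le_log (by norm_num) (by norm_num)
  have h5 : 1 / (1 / 100 * x) = 100 * (1 / x) := by field_simp
  rw [h5, Real.log_mul (by norm_num) (by positivity)]
  linarith

theorem log_le_log_hundredth {x : ℝ} (h0 : 0 < x) :
    Real.log (1 / x) ≤ Real.log (1 / (1 / 100 * x)) :=
  Real.log_le_log (by positivity) (one_div_le_one_div_of_le (by positivity) (by linarith))

theorem exp_four_le : Real.exp 4 ≤ 55 := by
  have h1 : Real.exp 4 = Real.exp 1 ^ 4 := by rw [← Real.exp_nat_mul]; norm_num
  rw [h1]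
  calc Real.exp 1 ^ 4 ≤ 2.7182818286 ^ 4 :=
        pow_le_pow_left₀ (Real.exp_pos _).le Real.exp_one_lt_d9.le 4
    _ ≤ 55 := by norm_num

section Parameters

variable {n k : ℕ} {ε δ o : ℝ}

theorem le_log_natCast (hn : 2 ≤ n) : 0.69 ≤ Real.log n := by
  have h2 : (2 : ℝ) ≤ n := by exact_mod_cast hn
  have h3 := Real.log_le_log (by norm_num) h2
  linarith [Real.log_two_gt_d9]

/-- Both factors `x = k log n` and `y = log(1/δ)` are at least `0.69`, so each of `x`, `y` is at
most `1.45 xy` and `1 ≤ 2.11 xy`. This determines the constant `6` in `t`; the summand `1` covers an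
odd `t`. -/
theorem le_coverLog (hn : 2 ≤ n) (hk : 1 ≤ k) (hδ0 : 0 < δ) (hδ1 : δ < 1 / 2) :
    k * Real.log n + Real.log (1 / δ) + 1 ≤ 6 * coverLog n k δ ∧ 0.47 ≤ coverLog n k δ := by
  have h1 := le_log_natCast hn
  have h2 := log_le_of_lt_half hδ0 hδ1
  have hk1 : (1 : ℝ) ≤ k := by exact_mod_cast hk
  have hx : 0.69 ≤ k * Real.log n := by nlinarith
  have e : coverLog n k δ = (k * Real.log n) * Real.log (1 / δ) := by rw [coverLog]; ring
  rw [e]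
  set x := k * Real.log n
  set y := Real.log (1 / δ)
  have h3 : 0.69 * y ≤ x * y := mul_le_mul_of_nonneg_right hx (by linarith)
  have h4 : x * 0.69 ≤ x * y := mul_le_mul_of_nonneg_left h2 (by linarith)
  constructor <;> linarith

theorem coverLog_le_hundredth (hn : 2 ≤ n) (hδ0 : 0 < δ) :
    coverLog n k δ ≤ coverLog n k (1 / 100 * δ) := by
  have h1 := le_log_natCast hn
  have := log_le_log_hundredth hδ0
  rw [coverLog, coverLog]
  gcongr

/-- The properties of the even number `2 * (t / 2)`, which is used as the order of a moment. -/
theorem moment_order (hn : 2 ≤ n) (hk : 1 ≤ k) (hδ0 : 0 < δ) (hδ1 : δ < 1 / 2) {t : ℕ}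
    (ht : t = ⌈6 * coverLog n k δ⌉₊) :
    1 ≤ t / 2 ∧ ((2 * (t / 2) : ℕ) : ℝ) ≤ 9 * coverLog n k δ ∧
      (t : ℝ) ≤ 9 * coverLog n k δ ∧
      (n : ℝ) ^ k * Real.exp (-(2 * (t / 2) : ℕ)) ≤ δ := by
  obtain ⟨h1, h2⟩ := le_coverLog hn hk hδ0 hδ1
  have h3 : 6 * coverLog n k δ ≤ t := by rw [ht]; exact Nat.le_ceil _
  have h4 : (t : ℝ) < 6 * coverLog n k δ + 1 := by
    rw [ht]; exact Nat.ceil_lt_add_one (by linarith)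
  have h5 : 2 < t := by
    have : (2 : ℝ) < t := by linarith
    exact_mod_cast this
  have h6 : ((2 * (t / 2) : ℕ) : ℝ) ≤ t := by exact_mod_cast Nat.mul_div_le t 2
  have h7 : (t : ℝ) ≤ (2 * (t / 2) : ℕ) + 1 := by exact_mod_cast (by omega : t ≤ 2 * (t / 2) + 1)
  refine ⟨by omega, by linarith, by linarith, ?_⟩
  have hn0 : (0 : ℝ) < n := by exact_mod_cast (by omega : 0 < n)
  have h8 : (n : ℝ) ^ k = Real.exp (k * Real.log n) := by
    rw [Real.exp_nat_mul, Real.exp_log hn0]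
  rw [h8, ← Real.exp_add, ← Real.le_log_iff_exp_le hδ0]
  have h9 : Real.log (1 / δ) = -Real.log δ := by rw [one_div, Real.log_inv]
  linarith

theorem samplingRate_pos (hn : 2 ≤ n) (hk : 1 ≤ k) (hε0 : 0 < ε) (hδ0 : 0 < δ)
    (hδ1 : δ < 1 / 2) (ho : 1 ≤ o) : 0 < samplingRate n k (1 / 100 * ε) (1 / 100 * δ) o := by
  have h1 := (le_coverLog hn hk hδ0 hδ1).2
  have h2 := coverLog_le_hundredth (k := k) hn hδ0
  have h3 : 0 < coverLog n k (1 / 100 * δ) := by linarith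
  exact lt_min (by positivity) one_pos

theorem samplingRate_mul_of_lt_one (hε0 : 0 < ε) (ho : 1 ≤ o)
    (hp : samplingRate n k (1 / 100 * ε) (1 / 100 * δ) o < 1) :
    samplingRate n k (1 / 100 * ε) (1 / 100 * δ) o * o =
      10000 * coverLog n k (1 / 100 * δ) / ε ^ 2 := by
  have h1 : samplingRate n k (1 / 100 * ε) (1 / 100 * δ) o =
      coverLog n k (1 / 100 * δ) / ((1 / 100 * ε) ^ 2 * o) := by
    rw [samplingRate, min_lt_iff] at hp
    exact min_eq_left (hp.resolve_right (lt_irrefl _)).le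
  rw [h1]
  field_simp
  ring

theorem le_of_samplingRate_eq_one (hε0 : 0 < ε) (ho : 1 ≤ o)
    (hp : samplingRate n k (1 / 100 * ε) (1 / 100 * δ) o = 1) :
    o ≤ 10000 * coverLog n k (1 / 100 * δ) / ε ^ 2 := by
  have h1 : 1 ≤ coverLog n k (1 / 100 * δ) / ((1 / 100 * ε) ^ 2 * o) :=
    hp.ge.trans (min_le_left _ _)
  rw [le_div_iff₀ (by positivity)] at h1 ⊢
  nlinarith

/-- The bound on twice the expected space in terms of the parameters. -/
theorem threshold_mul_le (hn : 2 ≤ n) (hk : 1 ≤ k) (hε0 : 0 < ε) (hε1 : ε < 1 / 2) (hδ0 : 0 < δ)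
    (hδ1 : δ < 1 / 2) :
    (bucketThreshold n k (1 / 100 * ε) : ℝ) *
        (8 * (10000 * coverLog n k (1 / 100 * δ) / ε ^ 2)) ≤
      10 ^ 9 * (n * Real.log (1 / δ) * Real.log (1 / ε) * Real.log n / ε ^ 3) := by
  have h1 := le_log_natCast hn
  have h2 := log_le_of_lt_half hδ0 hδ1
  have h3 := log_le_of_lt_half hε0 hε1
  have h4 := log_hundredth_le hδ0 hδ1
  have h5 := log_hundredth_le hε0 hε1
  have h6 := log_le_log_hundredth hδ0
  have h7 := log_le_log_hundredth hε0
  have hk0 : (0 : ℝ) < k := by exact_mod_cast hk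
  have hT : ((bucketThreshold n k (1 / 100 * ε) : ℝ≥0) : ℝ) =
      n * Real.log (1 / (1 / 100 * ε)) / (1 / 100 * ε * k) := by
    rw [bucketThreshold, Real.coe_toNNReal]
    have : 0 ≤ Real.log (1 / (1 / 100 * ε)) := by linarith
    positivity
  rw [hT, coverLog]
  set a := Real.log (1 / (1 / 100 * ε))
  set b := Real.log (1 / (1 / 100 * δ))
  calc n * a / (1 / 100 * ε * k) * (8 * (10000 * (k * b * Real.log n) / ε ^ 2))
      = 8000000 * (n * (a * b) * Real.log n / ε ^ 3) := by field_simp; ring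
    -- Each logarithm grows at most by the factor `8` when its argument is scaled by `1/100`; the
    -- factor `k` has already cancelled between threshold and rate.
    _ ≤ 8000000 * (n * ((8 * Real.log (1 / ε)) * (8 * Real.log (1 / δ))) * Real.log n / ε ^ 3) := by
        have : a * b ≤ (8 * Real.log (1 / ε)) * (8 * Real.log (1 / δ)) :=
          mul_le_mul h5 h4 (by linarith) (by linarith)
        gcongr
    _ = 512000000 * (n * Real.log (1 / δ) * Real.log (1 / ε) * Real.log n / ε ^ 3) := by ring
    _ ≤ _ := by
        have : 0 ≤ Real.log (1 / ε) := by linarith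
        have : 0 ≤ Real.log (1 / δ) := by linarith
        gcongr
        norm_num

/-- Makes degrees capped at `T` and divided by `T` at most `min(1, dk/n)`, so that
`sum_min_degree_le_optCover` applies. -/
theorem div_le_bucketThreshold (hn : 2 ≤ n) (hk : 1 ≤ k) (hε0 : 0 < ε) (hε1 : ε < 1 / 2) :
    (n : ℝ) / k ≤ bucketThreshold n k (1 / 100 * ε) := by
  have h3 := log_le_of_lt_half hε0 hε1
  have h7 := log_le_log_hundredth hε0
  have hk0 : (0 : ℝ) < k := by exact_mod_cast hk
  have hT : ((bucketThreshold n k (1 / 100 * ε) : ℝ≥0) : ℝ) =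
      n * Real.log (1 / (1 / 100 * ε)) / (1 / 100 * ε * k) := by
    rw [bucketThreshold, Real.coe_toNNReal]
    have : 0 ≤ Real.log (1 / (1 / 100 * ε)) := by linarith
    positivity
  rw [hT, div_le_div_iff₀ hk0 (by positivity)]
  have : 1 / 100 * ε ≤ Real.log (1 / (1 / 100 * ε)) := by linarith
  have h8 : (0 : ℝ) ≤ n * k := by positivity
  nlinarith [mul_le_mul_of_nonneg_left this h8]

end Parameters

/-! ### The theorem -/

section Sketch

variable {Ω : Type*} [MeasurableSpace Ω] {μ : Measure Ω} [IsProbabilityMeasure μ] {n m k t : ℕ}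
  {ε δ o : ℝ} {ħ : Ω → Fin m → unitInterval}

/-- With high probability the sampled graph preserves the values of all solutions. -/
theorem IsWiseIndependentHash.holdsWithProb_good (hħ : IsWiseIndependentHash μ t ħ)
    (hn : 2 ≤ n) (hk : 1 ≤ k) (hkn : k ≤ n) (hε0 : 0 < ε) (hε1 : ε < 1 / 2) (hδ0 : 0 < δ)
    (hδ1 : δ < 1 / 2) (ho : 1 ≤ o) (ht : t = ⌈6 * coverLog n k δ⌉₊) {p : ℝ}
    (hp : p = samplingRate n k (1 / 100 * ε) (1 / 100 * δ) o) {X : Finset (Fin n × Fin m)}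
    (hX : o ≤ optCover k X) :
    HoldsWithProb μ (1 - δ) fun ω => ∀ P : Finset (Fin n), P.card = k →
      |((coverNbrs (sampledGraph (ħ ω) p X) P).card : ℝ) - p * (coverNbrs X P).card| ≤
        ε / 4 * (p * optCover k X) := by
  have hp0 : 0 < p := hp ▸ samplingRate_pos hn hk hε0 hδ0 hδ1 ho
  have hp1 : p ≤ 1 := hp ▸ min_le_right _ _
  rcases hp1.lt_or_eq with hlt | heq
  · obtain ⟨hr, hq, -, hcount⟩ := moment_order hn hk hδ0 hδ1 ht
    have hL := (le_coverLog hn hk hδ0 hδ1).2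
    have hLL := coverLog_le_hundredth (k := k) hn hδ0
    have hpo : p * o = 10000 * coverLog n k (1 / 100 * δ) / ε ^ 2 :=
      hp ▸ samplingRate_mul_of_lt_one hε0 ho (hp ▸ hlt)
    set M := p * (optCover k X : ℝ) with hM
    have hM1 : 10000 * coverLog n k δ ≤ ε ^ 2 * M := by
      have h1 : p * o ≤ M := mul_le_mul_of_nonneg_left hX hp0.le
      rw [hpo, div_le_iff₀ (by positivity)] at h1
      linarith
    have hM0 : 0 < M := by
      by_contra h
      have : ε ^ 2 * M ≤ 0 := mul_nonpos_of_nonneg_of_nonpos (by positivity) (not_lt.1 h)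
      linarith
    have hε2 : ε ^ 2 ≤ 1 := by nlinarith
    have hrM : ((2 * (t / 2) : ℕ) : ℝ) ≤ M := by
      have : ε ^ 2 * M ≤ M := by nlinarith
      linarith
    refine hħ.holdsWithProb_cover X hkn hp0.le hp1 le_rfl hr (Nat.mul_div_le t 2) hrM
      (by positivity) ?_ hδ0.le hcount
    set q : ℝ := ((2 * (t / 2) : ℕ) : ℝ)
    have hq0 : 0 ≤ q := by positivity
    have h2 : Real.exp 4 * q ≤ 55 * q := mul_le_mul_of_nonneg_right exp_four_le hq0
    -- This needs `16 e⁴ q ≤ ε² M`. As `q ≤ 9 coverLog`, the left side is at most `16 · 55 · 9 =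
    -- 7920` times `coverLog`, below the `10000 = 1/c²` provided by the rate.
    calc Real.exp 4 * q * M ≤ (ε ^ 2 * M / 16) * M :=
          mul_le_mul_of_nonneg_right (by linarith) hM0.le
      _ = (ε / 4 * M) ^ 2 := by ring
  · refine holdsWithProb_of_forall hδ0.le fun ω P _ => ?_
    have : sampledGraph (ħ ω) p X = X :=
      Finset.filter_true_of_mem fun x _ => by rw [heq]; exact (ħ ω x.2).2.2
    rw [this, heq]
    simp only [one_mul, sub_self, abs_zero]
    positivity

/-- With high probability the sketch is small. -/
theorem IsWiseIndependentHash.holdsWithProb_spaceBudget_le (hħ : IsWiseIndependentHash μ t ħ)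
    (hn : 2 ≤ n) (hk : 1 ≤ k) (hkn : k ≤ n) (hε0 : 0 < ε) (hε1 : ε < 1 / 2) (hδ0 : 0 < δ)
    (hδ1 : δ < 1 / 2) (ho : 1 ≤ o) (ht : t = ⌈6 * coverLog n k δ⌉₊) {p : ℝ}
    (hp : p = samplingRate n k (1 / 100 * ε) (1 / 100 * δ) o) {X : Finset (Fin n × Fin m)}
    (hX : (optCover k X : ℝ) ≤ 2 * o) :
    HoldsWithProb μ (1 - δ) fun ω =>
      ((kCoverSketch (ħ ω) p (bucketThreshold n k (1 / 100 * ε))).spaceBudget X : ℝ) ≤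
        10 ^ 9 * (n * Real.log (1 / δ) * Real.log (1 / ε) * Real.log n / ε ^ 3) := by
  have hp0 : 0 < p := hp ▸ samplingRate_pos hn hk hε0 hδ0 hδ1 ho
  have hp1 : p ≤ 1 := hp ▸ min_le_right _ _
  have hfin := threshold_mul_le hn hk hε0 hε1 hδ0 hδ1
  have hTn := div_le_bucketThreshold hn hk hε0 hε1
  set T : ℝ≥0 := bucketThreshold n k (1 / 100 * ε)
  set K := 10000 * coverLog n k (1 / 100 * δ) / ε ^ 2 with hK
  have hn0 : (0 : ℝ) < n := by exact_mod_cast (by omega : 0 < n)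
  have hk0 : (0 : ℝ) < k := by exact_mod_cast hk
  have hT0 : (0 : ℝ) < T := (div_pos hn0 hk0).trans_le hTn
  -- Dividing by `T` brings the weights into `[0,1]`; the budget is `T` times the sampled weight.
  set w : Fin m → ℝ := fun e => min (T : ℝ) (edgesAt X e).card / T with hw
  have hw0 : ∀ e, 0 ≤ w e := fun e => by positivity
  have hw1 : ∀ e, w e ≤ 1 := fun e => (div_le_one hT0).2 (min_le_left _ _)
  have hsum : ∑ e, w e ≤ 4 * o := by
    have h1 := sum_min_degree_le_optCover hk hkn X
    have h2 : ∀ e, w e ≤ min 1 (((edgesAt X e).card : ℝ) * k / n) := fun e => by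
      refine le_min (hw1 e) ?_
      rw [hw, div_le_iff₀ hT0]
      refine (min_le_right _ _).trans ?_
      rw [div_le_iff₀ hk0] at hTn
      rw [div_mul_eq_mul_div, le_div_iff₀ hn0, mul_assoc]
      refine mul_le_mul_of_nonneg_left ?_ (by positivity)
      linarith
    have h3 := Finset.sum_le_sum fun e (_ : e ∈ Finset.univ) => h2 e
    linarith
  have hbudget : ∀ ω, ∑ e, w e * (if (ħ ω e : ℝ) ≤ p then 1 else 0) ≤ 8 * K →
      ((kCoverSketch (ħ ω) p T).spaceBudget X : ℝ) ≤
        10 ^ 9 * (n * Real.log (1 / δ) * Real.log (1 / ε) * Real.log n / ε ^ 3) := by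
    intro ω hω
    refine le_trans ?_ hfin
    refine le_trans (le_of_eq ?_) (mul_le_mul_of_nonneg_left hω hT0.le)
    rw [kCoverSketch_spaceBudget, Finset.mul_sum]
    refine Finset.sum_congr rfl fun e _ => ?_
    rw [← mul_assoc, hw, mul_div_cancel₀ _ hT0.ne']
  rcases hp1.lt_or_eq with hlt | heq
  · obtain ⟨hr, hq, -, hcount⟩ := moment_order hn hk hδ0 hδ1 ht
    have hL := (le_coverLog hn hk hδ0 hδ1).2
    have hLL := coverLog_le_hundredth (k := k) hn hδ0
    have hpo : p * o = K := hp ▸ samplingRate_mul_of_lt_one hε0 ho (hp ▸ hlt)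
    have hKL : 10000 * coverLog n k δ ≤ K := by
      rw [hK, le_div_iff₀ (by positivity)]
      have hε2 : ε ^ 2 ≤ 1 := by nlinarith
      nlinarith
    have hM : p * ∑ e, w e ≤ 4 * K := by
      have := mul_le_mul_of_nonneg_left hsum hp0.le
      linarith
    have hexp : Real.exp (-(2 * (t / 2) : ℕ)) ≤ δ := by
      refine le_trans ?_ hcount
      have : (1 : ℝ) ≤ (n : ℝ) ^ k := one_le_pow₀ (by exact_mod_cast (by omega : 1 ≤ n))
      exact le_mul_of_one_le_left (Real.exp_pos _).le this
    have hrM : Real.exp 4 * (2 * (t / 2) : ℕ) ≤ 4 * K := by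
      have := mul_le_mul_of_nonneg_right exp_four_le
        (by positivity : (0 : ℝ) ≤ ((2 * (t / 2) : ℕ) : ℝ))
      linarith
    obtain ⟨A, hA, hμ, h⟩ :=
      hħ.holdsWithProb_sum hw0 hw1 hp0.le hp1 hM hr (Nat.mul_div_le t 2) hrM hexp
    exact ⟨A, hA, hμ, fun ω hω => hbudget ω ((h ω hω).trans (by linarith))⟩
  -- At rate one `o ≤ K`, and the total weight `4 o` is small enough without any sampling.
  · refine holdsWithProb_of_forall hδ0.le fun ω => hbudget ω ?_
    have hoK : o ≤ K := le_of_samplingRate_eq_one hε0 ho (hp ▸ heq)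
    have h1 : ∑ e, w e * (if (ħ ω e : ℝ) ≤ p then 1 else 0) ≤ ∑ e, w e := by
      refine Finset.sum_le_sum fun e _ => ?_
      split_ifs
      · rw [mul_one]
      · rw [mul_zero]; exact hw0 e
    linarith

end Sketch

end

theorem mainTheorem8 :
    ∃ (edgeProg recoverProg : RamProg) (c A C : ℝ), 0 < c ∧ c ≤ 1 ∧ 0 < A ∧ 0 < C ∧
    ∀ (n m k : ℕ) (ε δ o α : ℝ), 2 ≤ n → 1 ≤ k → k ≤ n → 0 < ε → ε < 1 / 2 →
      0 < δ → δ < 1 / 2 → 1 ≤ o → 0 ≤ α → α ≤ 1 →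
    let t : ℕ := ⌈A * coverLog n k δ⌉₊
    let p : ℝ := samplingRate n k (c * ε) (c * δ) o
    let T : ℝ≥0 := bucketThreshold n k (c * ε)
    ∃ (ħ : (Fin t → unitInterval) → Fin m → unitInterval)
      (recover : (Fin 1 → List ((Fin n × Fin m) × (Fin n × Fin m))) → ℝ),
    let Z : (Fin t → unitInterval) →
        BucketingSketch 1 (Fin n × Fin m) (Fin m) (Fin n × Fin m) :=
      fun ω => kCoverSketch (ħ ω) p T
    IsWiseIndependentHash volume t ħ ∧
    -- the values of the sketch are exactly the subsampled sketch graphs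
    (∀ ω X Y, (Z ω).IsOutput X Y ↔
      ∃ H, IsSubsampledGraph (ħ ω) p T X H ∧ Y = fun _ => H.image fun x => (x, x)) ∧
    -- approximation
    IsRestrictedApproxSketch volume Z recover (fun X => (optCover k X : ℝ)) o (α - ε) δ ∧
    -- space budget
    (∀ X : Finset (Fin n × Fin m), (optCover k X : ℝ) ≤ 2 * o →
      HoldsWithProb volume (1 - δ) fun ω =>
        ((Z ω).spaceBudget X : ℝ) ≤
          C * (n * Real.log (1 / δ) * Real.log (1 / ε) * Real.log n / ε ^ 3)) ∧
    -- time for the filter, bucketing and processing functions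
    (∀ (ω : Fin t → unitInterval) (x : Fin n × Fin m), ∃ (steps : ℕ) (s : RamState),
      RamRun edgeProg (edgeInput p ω x) steps s ∧ EdgeOutput (Z ω 0) x s ∧
      (steps : ℝ) ≤ C * (k * Real.log (1 / δ) * Real.log n)) ∧
    -- time for the recover function
    (α ≤ 1 - 1 / Real.exp 1 → ∀ ω X L, (Z ω).IsStored X L → ∃ (steps : ℕ) (s : RamState),
      RamRun recoverProg (recoverInput k ε p (L 0)) steps s ∧ s.real 1 0 = recover L ∧
      (steps : ℝ) ≤ C * (((L 0).length + 1) * Real.log ((L 0).length + 2))) := by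
  -- `1/100` makes `1/c²` exceed `7920`, `6` comes from `le_coverLog`, and `10 ^ 9` dominates the `8
  -- · 10⁶ · 8²` of the space bound.
  refine ⟨edgeProgram, recoverProgram, 1 / 100, 6, 10 ^ 9, by norm_num, by norm_num, by norm_num,
    by norm_num, ?_⟩
  intro n m k ε δ o α hn hk hkn hε0 hε1 hδ0 hδ1 ho hα0 hα1 t p T
  choose est hest using exists_estimate (n := n) (m := m) (ε := ε) (p := p) hk hkn hα1
  have ht : t = ⌈6 * coverLog n k δ⌉₊ := rfl
  have hp0 : 0 < p := samplingRate_pos hn hk hε0 hδ0 hδ1 ho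
  have hħ := isWiseIndependentHash_polyHash t m
    (by have := (moment_order hn hk hδ0 hδ1 ht).1; omega)
  refine ⟨fun ω e => polyHash ω e, fun L => est (L 0), hħ,
    fun ω X Y => kCoverSketch_isOutput_iff _ _ _ _ _, fun X hX => ?_, fun X hX => ?_,
    fun ω x => ?_, fun hα ω X L hL => ?_⟩
  · obtain ⟨A, hA, hμ, h⟩ :=
      hħ.holdsWithProb_good hn hk hkn hε0 hε1 hδ0 hδ1 ho ht (p := p) rfl hX
    refine ⟨A, hA, hμ, fun ω hω L hL => ?_⟩
    obtain ⟨hl, hH⟩ := isEdgeList_of_isStored hL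
    exact (hest _ hl).1.isApproximation hk hkn hε0 hε1 hp0 hα0 hα1 (by norm_num) (by norm_num)
      hH (h ω hω)
  · exact hħ.holdsWithProb_spaceBudget_le hn hk hkn hε0 hε1 hδ0 hδ1 ho ht rfl hX
  · obtain ⟨c, s, hrun, hout, hc⟩ := edgeProgram_achieves p T ω x
    refine ⟨c, s, hrun, hout, ?_⟩
    have h1 := (moment_order hn hk hδ0 hδ1 ht).2.2.1
    have h2 := (le_coverLog hn hk hδ0 hδ1).2
    have h3 : (c : ℝ) ≤ 3 * t + 7 := by exact_mod_cast hc
    change (c : ℝ) ≤ 10 ^ 9 * coverLog n k δ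
    linarith
  · obtain ⟨c, s, hrun, hval, hc⟩ := (hest _ (isEdgeList_of_isStored hL).1).2 hα
    refine ⟨c, s, hrun, hval, ?_⟩
    have h3 : (c : ℝ) ≤ 29 * (L 0).length + 4 := by exact_mod_cast hc
    have h4 : (0 : ℝ) ≤ (L 0).length := by positivity
    -- The run is linear, so the logarithm only has to be bounded away from zero.
    have h5 : 0.69 ≤ Real.log ((L 0).length + 2) := by
      have := Real.log_le_log (by norm_num) (by linarith : (2 : ℝ) ≤ (L 0).length + 2)
      linarith [Real.log_two_gt_d9]
    nlinarith
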